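/- **Setting.** Let $G=(V,E)$ be a directed graph with finitely many links $E$. Packets are routed along fixed paths, i.e. non-empty sequences of at most $D$ consecutive links (nodes may be visited several times). Put $m=\max\{|E|,D\}$. Let $W\in[0,1]^{E\times E}$ with $W_{e,e}=1$ for all $e$, and call $\|W\cdot R\|_\infty=\max_e\sum_{e'}W_{e,e'}R(e')$ the interference measure of $R\colon E\to\mathbb N$. Time is slotted; in a slot each link can transmit at most one packet, and the set of links transmitting successfully has to belong to a given family of feasible sets. *Static algorithm.* Let $\mathcal A(I,n)$ be a randomized algorithm that is given a finite family of requests, each for one transmission over a given link, and computes a schedule for them. Assume that for all real $I$ and $n\ge 1$ and every family of at most $n$ requests of interference measure at most $I$ it serves all requests in a schedule of length $f(m)\cdot I+g(m,n)$ with probability at least $1-\frac1{2n^4}$, where $f(m)>0$ and $g(m,\cdot)$ is non-decreasing on $[1,\infty)$ with $g(m,n)=o(n)$ as $n\to\infty$. *Adversary.* Let $0<\varepsilon<1$, let $w\ge1$ be an integer, and let $\lambda=(1-\varepsilon)/f(m)$. A $(w,\lambda)$-bounded window adversary fixes an arbitrary sequence of packet injections (finitely many per slot, each with its path) such that for every interval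 of $w$ consecutive slots $\|W\cdot R\|_\infty\le w\lambda$, where $R(e)$ is the number of transmissions over $e$ required by the paths of the packets injected in that interval. *Protocol.* Put $\varepsilon'=\varepsilon/2$, $\lambda'=(1-\varepsilon')/f(m)$ and $\delta_{\max}=\lceil 2(D+w)/\varepsilon\rceil$. Time is divided into frames of $T$ slots, where $T\in\mathbb N$ satisfies $$T\ \ge\ \frac{100 f(m)}{\varepsilon'^3}+\frac{48 f(m)\ln m}{\varepsilon'^2},\qquad T\ \ge\ \frac{4f(m)}{\varepsilon'^2}\;g\Bigl(m,\tfrac{m}{f(m)}T\Bigr).$$ Put $J=(1+\varepsilon')\lambda'T$ and $T'=f(m)J+g(m,mJ)$. Each packet independently draws a delay $\delta$ uniformly from $\{0,\dots,\delta_{\max}-1\}$; it waits until the next frame begins and then for another $\delta$ frames. From then on it takes part in the first phase of every frame until it is delivered or fails. In this phase $\mathcal A(J,mJ)$ is executed for $T'$ slots on the next links of all participating unfailed packets; a packet that does not cross its next link fails. In the second phase (clean-up) of a frame, each link with a non-empty buffer of failed packets waiting to cross it selects, independently with probability $1/m$, the packet of this buffer whose failure is longest ago (ties broken by a fixed rule),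 and $\mathcal A(1,mJ)$ is executed for $f(m)+g(m,mJ)$ slots on the selected packets. All random choices (delays, selections, internal randomness of the executions of $\mathcal A$) are independent. **Theorem.** The expected queue lengths are bounded at any time: there is a finite $B$, depending only on the network, on $\mathcal A$, $f$, $g$ and on $\varepsilon,w,T$, such that for every such adversary and every slot $t$ the expected total number of packets that are injected up to slot $t$ and not delivered at time $t$ is at most $B$. Moreover, the expected latency of every packet (the number of slots from its injection until its delivery) is $O(D\cdot w\cdot T/\varepsilon)$: there is an absolute constant $C$ such that it is at most $C\cdot D\cdot w\cdot T/\varepsilon$ for all networks, algorithms, parameters and adversaries as above. (The queue length and the latency are random variables, i.e. measurable.) -/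

import Mathlib

open MeasureTheory
open scoped ENNReal NNReal

namespace WirelessScheduling

/-- A network: a directed graph with finite set `E` of links, a bound `D` on the lengths of routing
paths, the matrix `W` of the linear interference measure (`W e e'` says how much a transmission on
`e` is interfered by one on `e'`), and the physical interference constraint, given by the sets of
links on which simultaneous transmissions can succeed. -/
structure Network (V E : Type*) [Fintype E] where
  src : E → V
  tgt : E → V
  D : ℕ
  W : Matrix E E ℝ
  W_nonneg : ∀ e e', 0 ≤ W e e'
  W_le_one : ∀ e e', W e e' ≤ 1
  W_diag : ∀ e, W e e = 1
  feasible : Set (Set E)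

namespace Network

variable {V E : Type*} [Fintype E] (N : Network V E)

/-- The significant network size `m = max (|E|, D)`. -/
def m : ℕ := max (Fintype.card E) N.D

/-- The interference measure `‖W · R‖_∞` (the norm of `E → ℝ` is the maximum norm). -/
noncomputable def interference (R : E → ℕ) : ℝ :=
  ‖N.W.mulVec (fun e => (R e : ℝ))‖

/-- Routing paths: non-empty sequences of at most `D` consecutive links (nodes may repeat). -/
def IsPath (π : List E) : Prop :=
  π ≠ [] ∧ π.length ≤ N.D ∧ π.IsChain (fun e e' => N.tgt e = N.src e')

/-- The law of a coin that shows `true` with probability `1 / m`. -/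
noncomputable def coinLaw : Measure Bool :=
  ProbabilityTheory.bernoulliMeasure true false
    ⟨(N.m : ℝ)⁻¹, inv_nonneg.2 (Nat.cast_nonneg _), Nat.cast_inv_le_one _⟩

end Network

/-- A randomized static scheduling algorithm `𝒜(I, n)` on the network `N`. An input is a finite
family of requests, request `q` asking for one transmission over `link q`. `run I n link σ q` is the
time slot (counted from `0`) in which `q` is transmitted successfully by the execution of `𝒜(I, n)`
with internal randomness `σ`, and `none` if this never happens. In each slot, every link transmits
at most one packet, and the transmitting links obey the interference constraint. -/
structure StaticAlgorithm {V E : Type*} [Fintype E] (N : Network V E) where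
  Seed : Type
  [seedSpace : MeasurableSpace Seed]
  law : Measure Seed
  [law_prob : IsProbabilityMeasure law]
  run : ℝ → ℝ → ∀ {Q : Type} [Fintype Q], (Q → E) → Seed → Q → Option ℕ
  measurableSet_run : ∀ (I n : ℝ) {Q : Type} [Fintype Q] (link : Q → E) (q : Q) (o : Option ℕ),
    MeasurableSet {σ | run I n link σ q = o}
  one_per_link : ∀ (I n : ℝ) {Q : Type} [Fintype Q] (link : Q → E) (σ : Seed) (q q' : Q) (j : ℕ),
    run I n link σ q = some j → run I n link σ q' = some j → link q = link q' → q = q'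
  feasible_run : ∀ (I n : ℝ) {Q : Type} [Fintype Q] (link : Q → E) (σ : Seed) (j : ℕ),
    {e | ∃ q, link q = e ∧ run I n link σ q = some j} ∈ N.feasible

attribute [instance] StaticAlgorithm.seedSpace StaticAlgorithm.law_prob

open Classical in
/-- Given at most `n` requests of interference measure at most `I`, the algorithm `𝒜(I, n)` serves
all of them by a schedule of length `f(m) · I + g(m, n)`, with probability at least
`1 - 1 / (2 n ^ 4)`. -/
def StaticAlgorithm.HasScheduleLength {V E : Type*} [Fintype E] {N : Network V E}
    (A : StaticAlgorithm N) (f : ℕ → ℝ) (g : ℕ → ℝ → ℝ) : Prop :=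
  ∀ (I n : ℝ), 1 ≤ n → ∀ (Q : Type) [Fintype Q] (link : Q → E),
    (Fintype.card Q : ℝ) ≤ n →
    N.interference (fun e => (Finset.univ.filter (fun q => link q = e)).card) ≤ I →
    1 - 1 / (2 * n ^ 4) ≤
      A.law.real {σ | ∀ q, ∃ j : ℕ, A.run I n link σ q = some j ∧
        (j : ℝ) + 1 ≤ f N.m * I + g N.m n}

/-- The packets `P` injected by an adversary: packet `p` is injected in time slot `time p` with the
routing path `path p`; finitely many packets are injected in each slot. -/
structure Injection (E P : Type*) where
  time : P → ℕ
  path : P → List E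
  finite_slot : ∀ t, {p | time p = t}.Finite

namespace Injection

variable {E P : Type*} (A : Injection E P)

theorem finite_window (a b : ℕ) : {p | a ≤ A.time p ∧ A.time p < b}.Finite := by
  refine ((Set.finite_Ico a b).biUnion (fun t _ => A.finite_slot t)).subset ?_
  intro p hp
  exact Set.mem_biUnion (show A.time p ∈ Set.Ico a b from hp) rfl

/-- The packets injected in the time slots `a, …, b - 1`. -/
noncomputable def injectedIn (a b : ℕ) : Finset P := (A.finite_window a b).toFinset

open Classical in
/-- `R(e)` for the packets injected in the slots `a, …, b - 1`: the number of transmissions over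
`e` that they require. -/
noncomputable def load (a b : ℕ) (e : E) : ℕ :=
  ∑ p ∈ A.injectedIn a b, (A.path p).count e

/-- The injection is `(w, lam)`-bounded: in every interval of `w` slots, the interference measure
induced by the injected paths is at most `w * lam`. -/
def IsBounded {V : Type*} [Fintype E] (N : Network V E) (w : ℕ) (lam : ℝ) : Prop :=
  ∀ t, N.interference (A.load t (t + w)) ≤ w * lam

end Injection

/-- The state of a packet: the links it still has to cross, the frame in which it failed (`⊤` as
long as it has not failed), and the time at which it crossed its latest link. -/
structure PacketState (E : Type*) where
  route : List E
  failFrame : ℕ∞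
  clock : ℕ

/-- The first link of the route is crossed, and this is completed at time `τ`. -/
def PacketState.cross {E : Type*} (x : PacketState E) (τ : ℕ) : PacketState E :=
  { x with route := x.route.tail, clock := τ }

/-- The data of the dynamic protocol: the static algorithm with its length bounds `f`, `g`, the
parameter `ε`, the window size `w` and the frame length `T`. -/
structure Protocol {V E : Type*} [Fintype E] (N : Network V E) where
  alg : StaticAlgorithm N
  f : ℕ → ℝ
  g : ℕ → ℝ → ℝ
  ε : ℝ
  w : ℕ
  T : ℕ

namespace Protocol

variable {V E : Type*} [Fintype E] {N : Network V E} (S : Protocol N)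

/-- The injection rate `λ` of the adversary. -/
noncomputable def rate : ℝ := (1 - S.ε) / S.f N.m

/-- The rate `λ'` for which the protocol is set up. -/
noncomputable def rate' : ℝ := (1 - S.ε / 2) / S.f N.m

/-- `J = (1 + ε') λ' T`, where `λ' = (1 - ε') / f(m)`. -/
noncomputable def J : ℝ := (1 + S.ε / 2) * S.rate' * S.T

/-- The length `T'` of the first phase, in which `𝒜(J, m J)` is executed. -/
noncomputable def mainLength : ℝ := S.f N.m * S.J + S.g N.m (N.m * S.J)

/-- The length of the execution of `𝒜(1, m J)` in the clean-up phase. -/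
noncomputable def cleanLength : ℝ := S.f N.m * 1 + S.g N.m (N.m * S.J)

/-- The number `δ_max` of possible delays. -/
noncomputable def maxDelay : ℕ := ⌈2 * ((N.D : ℝ) + S.w) / S.ε⌉₊

/-- The frame length is large enough for the rate `λ' = (1 - ε') / f(m)`, `ε' = ε / 2`. -/
def FrameLongEnough : Prop :=
  100 * S.f N.m / (S.ε / 2) ^ 3 + 48 * S.f N.m * Real.log N.m / (S.ε / 2) ^ 2 ≤ S.T ∧
  4 * S.f N.m / (S.ε / 2) ^ 2 * S.g N.m (N.m / S.f N.m * S.T) ≤ S.T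

/-- All random choices: the delays of the packets, for each frame and link the coin deciding whether
the link selects a packet in the clean-up phase, and for each frame the internal randomness of the
executions of the static algorithm in the first phase and in the clean-up phase. -/
abbrev Sample (P : Type) : Type _ :=
  (P → ℕ) × (ℕ × E → Bool) × (ℕ → S.alg.Seed) × (ℕ → S.alg.Seed)

/-- The uniform distribution on `0, …, maxDelay - 1`. -/
noncomputable def delayLaw : Measure ℕ :=
  (PMF.uniformOfFinset (Finset.Iic (S.maxDelay - 1)) Finset.nonempty_Iic).toMeasure

/-- All random choices are independent. -/
noncomputable def prob (P : Type) : Measure (S.Sample P) :=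
  (Measure.infinitePi (fun _ : P => S.delayLaw)).prod
    ((Measure.infinitePi (fun _ : ℕ × E => N.coinLaw)).prod
      ((Measure.infinitePi (fun _ : ℕ => S.alg.law)).prod
        (Measure.infinitePi (fun _ : ℕ => S.alg.law))))

variable {P : Type} (A : Injection E P)

open Classical in
/-- Execute `𝒜(I, n)` for `L` time slots on the next links of the packets in `U` (when these are in
the states `x`). The result is the slot of the execution in which a packet crosses its next link,
and `none` if it does not. -/
noncomputable def execute (I n L : ℝ) (x : P → PacketState E) (U : Finset P) (σ : S.alg.Seed)
    (p : P) : Option ℕ :=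
  if h : p ∈ U.filter (fun q => (x q).route ≠ []) then
    (S.alg.run I n
      (fun q : {q // q ∈ U.filter (fun q => (x q).route ≠ [])} =>
        (x q).route.head (Finset.mem_filter.1 q.2).2) σ ⟨p, h⟩).filter
      (fun j => decide ((j : ℝ) + 1 ≤ L))
  else none

open Classical in
/-- The packets taking part in the first phase of frame `k`, which consists of the slots
`k T, …, (k + 1) T - 1`: a packet waits for the beginning of the next frame, spends another `δ`
frames waiting, and then takes part until it is delivered or fails. -/
noncomputable def unfailed (ω : S.Sample P) (k : ℕ) (x : P → PacketState E) : Finset P :=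
  (A.injectedIn 0 (k * S.T)).filter (fun p =>
    A.time p / S.T + 1 + ω.1 p ≤ k ∧ (x p).route ≠ [] ∧ (x p).failFrame = ⊤)

open Classical in
/-- The first phase of frame `k`: `𝒜(J, m J)` is executed on the unfailed packets; those that do not
cross their next link fail. -/
noncomputable def mainPhase (ω : S.Sample P) (k : ℕ) (x : P → PacketState E) :
    P → PacketState E := fun p =>
  if p ∈ S.unfailed A ω k x then
    match S.execute S.J (N.m * S.J) S.mainLength x (S.unfailed A ω k x) (ω.2.2.1 k) p with
    | some j => (x p).cross (k * S.T + j + 1)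
    | none => { x p with failFrame := k }
  else x p

open Classical in
/-- The buffer of the failed packets waiting to cross `e`. -/
noncomputable def buffer (k : ℕ) (x : P → PacketState E) (e : E) : Finset P :=
  (A.injectedIn 0 (k * S.T)).filter (fun p =>
    (x p).failFrame ≠ ⊤ ∧ (x p).route.head? = some e)

open Classical in
/-- The packets in the buffer of `e` whose failure is longest ago. -/
noncomputable def oldest (k : ℕ) (x : P → PacketState E) (e : E) : Finset P :=
  (S.buffer A k x e).filter (fun p => ∀ q ∈ S.buffer A k x e, (x p).failFrame ≤ (x q).failFrame)

open Classical in
/-- The packets selected for the clean-up phase: each link whose coin shows `true` selects from its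
buffer the packet whose failure is longest ago, with ties broken by `tie`. -/
noncomputable def selected (tie : (U : Finset P) → U.Nonempty → {p // p ∈ U})
    (ω : S.Sample P) (k : ℕ) (x : P → PacketState E) : Finset P :=
  (A.injectedIn 0 (k * S.T)).filter (fun p =>
    ∃ e, ω.2.1 (k, e) = true ∧ ∃ h : (S.oldest A k x e).Nonempty, p = tie (S.oldest A k x e) h)

/-- The clean-up phase of frame `k`, following the first phase: `𝒜(1, m J)` is executed on the
selected packets. -/
noncomputable def cleanPhase (tie : (U : Finset P) → U.Nonempty → {p // p ∈ U})
    (ω : S.Sample P) (k : ℕ) (x : P → PacketState E) : P → PacketState E := fun p =>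
  match S.execute 1 (N.m * S.J) S.cleanLength x (S.selected A tie ω k x) (ω.2.2.2 k) p with
  | some j => (x p).cross (k * S.T + ⌊S.mainLength⌋₊ + j + 1)
  | none => x p

/-- The states of the packets at the beginning of frame `k`. -/
noncomputable def state (tie : (U : Finset P) → U.Nonempty → {p // p ∈ U})
    (ω : S.Sample P) : ℕ → P → PacketState E
  | 0 => fun p => { route := A.path p, failFrame := ⊤, clock := A.time p }
  | k + 1 => S.cleanPhase A tie ω k (S.mainPhase A ω k (state tie ω k))

open Classical in
/-- The time at which packet `p` has crossed the last link of its path (`⊤` if this never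
happens). -/
noncomputable def deliveryTime (tie : (U : Finset P) → U.Nonempty → {p // p ∈ U})
    (p : P) (ω : S.Sample P) : ℕ∞ :=
  ⨅ k : ℕ, if (S.state A tie ω k p).route = [] then ((S.state A tie ω k p).clock : ℕ∞) else ⊤

/-- The latency of `p`: the number of time slots from its injection until its delivery. -/
noncomputable def latency (tie : (U : Finset P) → U.Nonempty → {p // p ∈ U})
    (p : P) (ω : S.Sample P) : ℝ≥0∞ :=
  ((S.deliveryTime A tie p ω - A.time p : ℕ∞) : ℝ≥0∞)

open Classical in
/-- The total queue length in time slot `t`: the number of packets that have been injected up to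
(and including) slot `t` and are not delivered at time `t`. -/
noncomputable def queueLength (tie : (U : Finset P) → U.Nonempty → {p // p ∈ U})
    (t : ℕ) (ω : S.Sample P) : ℝ≥0∞ :=
  (((A.injectedIn 0 (t + 1)).filter (fun p => (t : ℕ∞) < S.deliveryTime A tie p ω)).card : ℝ≥0∞)

end Protocol
end WirelessScheduling

open WirelessScheduling

/-! The delays separate the load from the history. As long as a packet has not failed it crosses one
link per frame from its first frame on, so its position in frame `k` is a function of its own delay.
Hence the requests in the first phase of frame `k` are among those of a virtual process without
failures, whose load depends only on the delays of the packets injected in the `span` = D + δ_max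
frames before frame `k`. A given position of a path meets frame `k` for at most one delay, so
averaging over the delays turns the bound on the adversary into an expected interference of at most
λ'T at every link (`Valid.sum_avg_impact_le`). By a Chernoff bound, the virtual interference exceeds
J = (1 + ε')λ'T with probability at most 1/(mJ)^4 (`Valid.lintegral_overload_le`). Given the delays
and the earlier frames, a failure in frame `k` has probability at most `failBound`: the indicator of
an overload plus 1/(2(mJ)^4).

The failed packets form a queue, measured by their total remaining route length. Whatever the past,
a clean-up succeeds with probability at least 1/(4m) (`Valid.le_law_success`): the coin of a link
holding an oldest failed packet is the only one to show `true` with probability at least 1/(em), and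
a single request is then served with probability at least 0.99. A success lowers the queue by one; a
frame with a failure raises it by at most D times the virtual number of requests. Failures in nearby
frames are correlated through common delays, but frames that are `span` apart involve disjoint sets
of packets. The queue is therefore dominated by one reflected process for the services and one for
the arrivals in each residue class modulo `span` (`queue_le_reflected`). Exponential moments of
reflected processes obey affine recursions, which are averaged in two stages: over coins and seeds
for fixed delays (`Valid.lintegral_serviceRec_le`, `Valid.lintegral_arrivalRec_le`), then over the
delays (`Valid.lintegral_delayRec_le`). The expected failed work is at most 6 + 2m(mJ) · `span`,
uniformly in time; all other undelivered packets were injected recently, and the adversary limits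
their number.

For the latency, a packet that never fails is done within `span` frames of its first possible frame.
After a failure its `rank`, the remaining work of the packets that failed no later, never grows,
because the oldest failures go first, and it drops by one with probability at least 1/(4m) per
frame. So the expected number of frames in the buffers is at most 4m times the expected rank at the
failure. For a given delay a packet can fail only in the at most D frames of its virtual journey,
and in each of them the expected work found, restricted to a failure, is of order `span` ·
m(mJ)/(mJ)^4. Since mJ ≥ 400m, the product is at most `span` frames. This step conditions on the
delay of the packet itself, which is why the moment bounds are stated for `Function.update δ p d`;
one packet changes the interference by at most 1. -/

namespace WirelessScheduling

/-! ### Resampling coordinates of a product measure -/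

section Resampling

variable {ι : Type*} {X : ι → Type*}

open Classical in
/-- Replacing the coordinates in `s` of `z.1` by those of `z.2`. -/
noncomputable def mix (s : Set ι) (z : (∀ i, X i) × (∀ i, X i)) : ∀ i, X i :=
  fun i => if i ∈ s then z.2 i else z.1 i

theorem mix_of_mem {s : Set ι} {z : (∀ i, X i) × (∀ i, X i)} {i : ι} (hi : i ∈ s) :
    mix s z i = z.2 i := if_pos hi

theorem mix_of_notMem {s : Set ι} {z : (∀ i, X i) × (∀ i, X i)} {i : ι} (hi : i ∉ s) :
    mix s z i = z.1 i := if_neg hi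

variable [∀ i, MeasurableSpace (X i)]

theorem measurable_mix (s : Set ι) :
    Measurable (mix s : (∀ i, X i) × (∀ i, X i) → ∀ i, X i) := by
  refine measurable_pi_lambda _ fun i => ?_
  by_cases hi : i ∈ s
  · simp only [mix_of_mem hi]; fun_prop
  · simp only [mix_of_notMem hi]; fun_prop

variable (μ : ∀ i, Measure (X i)) [∀ i, IsProbabilityMeasure (μ i)]

/-- Resampling takes the place of conditional expectations: a function that ignores the coordinates
in `s` does not notice `mix s`, while the coordinates in `s` become a fresh sample, independent of
the first one. -/
theorem measurePreserving_mix (s : Set ι) :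
    MeasurePreserving (mix s) ((Measure.infinitePi μ).prod (Measure.infinitePi μ))
      (Measure.infinitePi μ) := by
  classical
  refine ⟨measurable_mix s, Measure.eq_infinitePi μ fun u t ht => ?_⟩
  have hm : MeasurableSet (Set.pi (u : Set ι) t) :=
    MeasurableSet.pi u.countable_toSet fun i _ => ht i
  rw [Measure.map_apply (measurable_mix s) hm]
  have : mix s ⁻¹' (Set.pi (u : Set ι) t) =
      (Set.pi ((u.filter (· ∉ s) : Finset ι) : Set ι) t) ×ˢ
        (Set.pi ((u.filter (· ∈ s) : Finset ι) : Set ι) t) := by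
    ext z
    simp only [Set.mem_preimage, Set.mem_pi, Set.mem_prod, Finset.coe_filter, Set.mem_ofPred_eq,
      Finset.mem_coe]
    constructor
    · intro h
      exact ⟨fun i hi => mix_of_notMem (z := z) hi.2 ▸ h i hi.1,
        fun i hi => mix_of_mem (z := z) hi.2 ▸ h i hi.1⟩
    · rintro ⟨h1, h2⟩ i hi
      by_cases his : i ∈ s
      · rw [mix_of_mem his]; exact h2 i ⟨hi, his⟩
      · rw [mix_of_notMem his]; exact h1 i ⟨hi, his⟩
  rw [this, Measure.prod_prod, Measure.infinitePi_pi _ fun i _ => ht i,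
    Measure.infinitePi_pi _ fun i _ => ht i, mul_comm]
  exact Finset.prod_filter_mul_prod_filter_not u (· ∈ s) _

/-- Functions of disjoint sets of coordinates are uncorrelated. -/
theorem lintegral_infinitePi_mul_of_disjoint (s : Set ι) {F G : (∀ i, X i) → ℝ≥0∞}
    (hF : Measurable F) (hG : Measurable G)
    (hF' : ∀ x y, (∀ i, i ∉ s → x i = y i) → F x = F y)
    (hG' : ∀ x y, (∀ i ∈ s, x i = y i) → G x = G y) :
    ∫⁻ x, F x * G x ∂(Measure.infinitePi μ) =
      (∫⁻ x, F x ∂(Measure.infinitePi μ)) * ∫⁻ x, G x ∂(Measure.infinitePi μ) := by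
  rw [← (measurePreserving_mix μ s).lintegral_comp (f := fun x => F x * G x) (hF.mul hG)]
  have : ∀ z, F (mix s z) * G (mix s z) = F z.1 * G z.2 := fun z => by
    rw [hF' (mix s z) z.1 fun i hi => mix_of_notMem hi, hG' (mix s z) z.2 fun i hi => mix_of_mem hi]
  simp only [this]
  exact lintegral_prod_mul hF.aemeasurable hG.aemeasurable

/-- Integrating out the coordinate `i` first. -/
theorem lintegral_infinitePi_update [DecidableEq ι] (i : ι) {F : (∀ i, X i) → ℝ≥0∞}
    (hF : Measurable F) :
    ∫⁻ x, F x ∂(Measure.infinitePi μ) =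
      ∫⁻ a, ∫⁻ x, F (Function.update x i a) ∂(Measure.infinitePi μ) ∂(μ i) := by
  have hmix : ∀ z : (∀ i, X i) × (∀ i, X i), mix {i} z = Function.update z.1 i (z.2 i) := by
    intro z; funext j
    by_cases hj : j = i
    · subst hj; simp [mix]
    · simp [mix, hj]
  have hm : Measurable fun z => F (mix {i} z) := hF.comp (measurable_mix {i})
  rw [← (measurePreserving_mix μ {i}).lintegral_comp hF, lintegral_prod_symm _ hm.aemeasurable]
  simp only [hmix]
  have hu : Measurable fun z : X i × (∀ j, X j) => F (Function.update z.2 i z.1) := by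
    refine hF.comp (measurable_pi_lambda _ fun j => ?_)
    by_cases hj : j = i
    · subst hj; simp only [Function.update_self]; fun_prop
    · simp only [Function.update_of_ne hj]; fun_prop
  exact (measurePreserving_eval_infinitePi μ i).lintegral_comp
    (f := fun a => ∫⁻ x, F (Function.update x i a) ∂(Measure.infinitePi μ)) hu.lintegral_prod_right'

theorem lintegral_infinitePi_prod_eval (s : Finset ι) (F : ∀ i, X i → ℝ≥0∞)
    (hF : ∀ i, Measurable (F i)) :
    ∫⁻ x, ∏ i ∈ s, F i (x i) ∂(Measure.infinitePi μ) = ∏ i ∈ s, ∫⁻ a, F i a ∂(μ i) := by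
  have h := ProbabilityTheory.lintegral_prod_eq_prod_lintegral_of_indepFun s
    (fun i (x : ∀ i, X i) => F i (x i))
    (ProbabilityTheory.iIndepFun_infinitePi (P := μ) (X := F) hF)
    (fun i => (hF i).comp (measurable_pi_apply i))
  rw [h]
  refine Finset.prod_congr rfl fun i _ => ?_
  exact (measurePreserving_eval_infinitePi μ i).lintegral_comp (hF i)

end Resampling

theorem measurePreserving_prod_prod_comm {X Y Z W : Type*} [MeasurableSpace X] [MeasurableSpace Y]
    [MeasurableSpace Z] [MeasurableSpace W] (μ : Measure X) (ν : Measure Y) (κ : Measure Z)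
    (ξ : Measure W) [IsProbabilityMeasure μ] [IsProbabilityMeasure ν] [IsProbabilityMeasure κ]
    [IsProbabilityMeasure ξ] :
    MeasurePreserving (fun z : (X × Y) × (Z × W) => ((z.1.1, z.2.1), (z.1.2, z.2.2)))
      ((μ.prod ν).prod (κ.prod ξ)) ((μ.prod κ).prod (ν.prod ξ)) := by
  have hm : Measurable (fun z : (X × Y) × (Z × W) => ((z.1.1, z.2.1), (z.1.2, z.2.2))) := by
    fun_prop
  refine ⟨hm, ?_⟩
  refine Measure.ext_of_lintegral _ fun f hf => ?_
  have hf' : Measurable fun z : (X × Y) × (Z × W) => f ((z.1.1, z.2.1), (z.1.2, z.2.2)) :=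
    hf.comp hm
  rw [lintegral_map hf hm, lintegral_prod _ hf'.aemeasurable, lintegral_prod _ hf.aemeasurable,
    lintegral_prod _ (by fun_prop), lintegral_prod _ (by fun_prop)]
  refine lintegral_congr fun x => ?_
  have h1 : ∀ y, ∫⁻ b, f ((x, b.1), (y, b.2)) ∂(κ.prod ξ) =
      ∫⁻ z, ∫⁻ w, f ((x, z), (y, w)) ∂ξ ∂κ := fun y =>
    lintegral_prod _ (by fun_prop)
  have h2 : ∀ z, ∫⁻ b, f ((x, z), b) ∂(ν.prod ξ) =
      ∫⁻ y, ∫⁻ w, f ((x, z), (y, w)) ∂ξ ∂ν := fun z =>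
    lintegral_prod _ (by fun_prop)
  simp only [h1, h2]
  exact lintegral_lintegral_swap (by fun_prop)

/-- Allows the blocks of randomness (coins, seeds of either phase) to be resampled separately inside
one product space. -/
theorem MeasurePreserving.prod_prod {X Y : Type*} [MeasurableSpace X] [MeasurableSpace Y]
    {μ : Measure X} {ν : Measure Y} [IsProbabilityMeasure μ] [IsProbabilityMeasure ν]
    {g : X × X → X} {h : Y × Y → Y} (hg : MeasurePreserving g (μ.prod μ) μ)
    (hh : MeasurePreserving h (ν.prod ν) ν) :
    MeasurePreserving (fun z : (X × Y) × (X × Y) => (g (z.1.1, z.2.1), h (z.1.2, z.2.2)))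
      ((μ.prod ν).prod (μ.prod ν)) (μ.prod ν) :=
  (hg.prod hh).comp (measurePreserving_prod_prod_comm μ ν μ ν)

/-! ### Conditional probabilities by resampling -/

section Conditioning

variable {R : Type*} [MeasurableSpace R] {ν : Measure R} [IsProbabilityMeasure ν] {r : R × R → R}

/-- If the resampling `r` leaves `F` unchanged and moves every point into `s` with probability at
most `p`, then `s` has conditional probability at most `p` given `F`. -/
theorem lintegral_mul_indicator_le (hr : MeasurePreserving r (ν.prod ν) ν) {F : R → ℝ≥0∞}
    (hF : Measurable F) {s : Set R} (hs : MeasurableSet s) {p : ℝ≥0∞}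
    (hFr : ∀ z, F (r z) = F z.1) (hp : ∀ x, ν {y | r (x, y) ∈ s} ≤ p) :
    ∫⁻ x, F x * s.indicator 1 x ∂ν ≤ p * ∫⁻ x, F x ∂ν := by
  have hm : Measurable fun x => F x * s.indicator 1 x :=
    hF.mul (measurable_one.indicator hs)
  have hm' : Measurable fun z => F (r z) * s.indicator 1 (r z) := hm.comp hr.measurable
  rw [← hr.lintegral_comp hm, lintegral_prod _ hm'.aemeasurable,
    ← lintegral_const_mul _ hF]
  refine lintegral_mono fun x => ?_
  simp only [hFr]
  have hs' : MeasurableSet {y | r (x, y) ∈ s} := (hr.measurable.comp measurable_prodMk_left) hs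
  have : ∀ y, s.indicator (1 : R → ℝ≥0∞) (r (x, y)) = {y | r (x, y) ∈ s}.indicator 1 y := fun y => by
    simp [Set.indicator]
  simp only [this]
  rw [lintegral_const_mul _ (measurable_one.indicator hs'), lintegral_indicator_one hs', mul_comm]
  gcongr
  exact hp x

theorem le_lintegral_mul_indicator (hr : MeasurePreserving r (ν.prod ν) ν) {F : R → ℝ≥0∞}
    (hF : Measurable F) {s : Set R} (hs : MeasurableSet s) {p : ℝ≥0∞}
    (hFr : ∀ z, F (r z) = F z.1) (hp : ∀ x, p ≤ ν {y | r (x, y) ∈ s}) :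
    p * ∫⁻ x, F x ∂ν ≤ ∫⁻ x, F x * s.indicator 1 x ∂ν := by
  have hm : Measurable fun x => F x * s.indicator 1 x :=
    hF.mul (measurable_one.indicator hs)
  have hm' : Measurable fun z => F (r z) * s.indicator 1 (r z) := hm.comp hr.measurable
  rw [← hr.lintegral_comp hm, lintegral_prod _ hm'.aemeasurable,
    ← lintegral_const_mul _ hF]
  refine lintegral_mono fun x => ?_
  simp only [hFr]
  have hs' : MeasurableSet {y | r (x, y) ∈ s} := (hr.measurable.comp measurable_prodMk_left) hs
  have : ∀ y, s.indicator (1 : R → ℝ≥0∞) (r (x, y)) = {y | r (x, y) ∈ s}.indicator 1 y := fun y => by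
    simp [Set.indicator]
  simp only [this]
  rw [lintegral_const_mul _ (measurable_one.indicator hs'), lintegral_indicator_one hs', mul_comm]
  gcongr
  exact hp x

end Conditioning

end WirelessScheduling

/-! ### Pathwise analysis of the protocol -/

namespace WirelessScheduling

theorem Injection.mem_injectedIn {E P : Type*} (A : Injection E P) {a b : ℕ} {p : P} :
    p ∈ A.injectedIn a b ↔ a ≤ A.time p ∧ A.time p < b := by
  simp [Injection.injectedIn]

namespace Protocol

variable {V E : Type*} [Fintype E] {N : Network V E} (S : Protocol N) {P : Type}
  (A : Injection E P) (tie : (U : Finset P) → U.Nonempty → {p // p ∈ U})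

/-- The first frame in which a packet may take part if its delay is `0`. -/
def start (p : P) : ℕ := A.time p / S.T + 1

/-- The link that `p` has to cross in frame `k` if its delay is `d` and it never fails. -/
def pos (p : P) (d k : ℕ) : Option E :=
  if S.start A p + d ≤ k then (A.path p)[k - (S.start A p + d)]? else none

/-- The number of frames which a packet spends in the system if it never fails. -/
noncomputable def span : ℕ := N.D + S.maxDelay

/-- The packets that can take part in the first phase of frame `k`. -/
noncomputable def window (k : ℕ) : Finset P := A.injectedIn ((k - S.span) * S.T) (k * S.T)

open Classical in
/-- The number of transmissions over `e` in frame `k` if no packet ever fails. -/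
noncomputable def virtualLoad (δ : P → ℕ) (k : ℕ) (e : E) : ℕ :=
  ((S.window A k).filter fun p => S.pos A p (δ p) k = some e).card

open Classical in
/-- The number of transmissions in frame `k` if no packet ever fails. -/
noncomputable def virtualCount (δ : P → ℕ) (k : ℕ) : ℕ :=
  ((S.window A k).filter fun p => S.pos A p (δ p) k ≠ none).card

/-- The states after the first phase of frame `k`. -/
noncomputable def mid (ω : S.Sample P) (k : ℕ) : P → PacketState E :=
  S.mainPhase A ω k (S.state A tie ω k)

open Classical in
/-- The total length of the routes of the packets in `U` that failed before frame `c`. -/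
noncomputable def work (c : ℕ∞) (U : Finset P) (x : P → PacketState E) : ℕ :=
  ∑ p ∈ U, if (x p).failFrame < c then (x p).route.length else 0

/-- Packet `p` fails in frame `k`. -/
def FailsAt (p : P) (k : ℕ) (ω : S.Sample P) : Prop :=
  (S.state A tie ω k p).failFrame = ⊤ ∧ (S.mid A tie ω k p).failFrame ≠ ⊤

/-- Some packet fails in frame `k`. -/
def Bad (k : ℕ) (ω : S.Sample P) : Prop :=
  ∃ p ∈ A.injectedIn 0 (k * S.T), S.FailsAt A tie p k ω

/-- In the clean-up phase of frame `k`, no failed packet is waiting or one whose failure is longest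
ago crosses a link. -/
def Success (k : ℕ) (ω : S.Sample P) : Prop :=
  (∀ q ∈ A.injectedIn 0 (k * S.T),
    (S.mid A tie ω k q).failFrame = ⊤ ∨ (S.mid A tie ω k q).route = []) ∨
  ∃ q ∈ A.injectedIn 0 (k * S.T), (S.mid A tie ω k q).failFrame ≠ ⊤ ∧
    (∀ q' ∈ A.injectedIn 0 (k * S.T), (S.mid A tie ω k q').failFrame ≠ ⊤ →
      (S.mid A tie ω k q').route ≠ [] →
      (S.mid A tie ω k q).failFrame ≤ (S.mid A tie ω k q').failFrame) ∧
    (S.state A tie ω (k + 1) q).route.length < (S.mid A tie ω k q).route.length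

section Phases

variable (ω : S.Sample P) (k : ℕ) (x : P → PacketState E) (p : P)

theorem execute_eq_some {I n L : ℝ} {U : Finset P} {σ : S.alg.Seed} {j : ℕ}
    (h : S.execute I n L x U σ p = some j) : p ∈ U ∧ (x p).route ≠ [] ∧ (j : ℝ) + 1 ≤ L := by
  classical
  unfold execute at h
  split_ifs at h with hp
  · rw [Option.filter_eq_some_iff] at h
    rw [Finset.mem_filter] at hp
    exact ⟨hp.1, hp.2, by simpa using h.2⟩

theorem mem_unfailed : p ∈ S.unfailed A ω k x ↔ p ∈ A.injectedIn 0 (k * S.T) ∧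
    S.start A p + ω.1 p ≤ k ∧ (x p).route ≠ [] ∧ (x p).failFrame = ⊤ := by
  simp [unfailed, start]

theorem mem_buffer (e : E) : p ∈ S.buffer A k x e ↔ p ∈ A.injectedIn 0 (k * S.T) ∧
    (x p).failFrame ≠ ⊤ ∧ (x p).route.head? = some e := by
  simp [buffer]

theorem mem_oldest (e : E) : p ∈ S.oldest A k x e ↔ p ∈ S.buffer A k x e ∧
    ∀ q ∈ S.buffer A k x e, (x p).failFrame ≤ (x q).failFrame := by
  simp [oldest]

theorem mem_selected : p ∈ S.selected A tie ω k x ↔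
    ∃ e, ω.2.1 (k, e) = true ∧ ∃ h : (S.oldest A k x e).Nonempty,
      p = tie (S.oldest A k x e) h := by
  classical
  simp only [selected, Finset.mem_filter, and_iff_right_iff_imp]
  rintro ⟨e, -, h, rfl⟩
  exact ((S.mem_buffer A k x _ e).1 ((S.mem_oldest A k x _ e).1 (tie _ h).2).1).1

theorem buffer_of_mem_selected (h : p ∈ S.selected A tie ω k x) : ∃ e, p ∈ S.buffer A k x e := by
  obtain ⟨e, -, h', rfl⟩ := (S.mem_selected A tie ω k x p).1 h
  exact ⟨e, ((S.mem_oldest A k x _ e).1 (tie _ h').2).1⟩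

theorem mainPhase_cases :
    (p ∉ S.unfailed A ω k x ∧ S.mainPhase A ω k x p = x p) ∨
    (p ∈ S.unfailed A ω k x ∧ ∃ j : ℕ, (j : ℝ) + 1 ≤ S.mainLength ∧
      S.mainPhase A ω k x p = (x p).cross (k * S.T + j + 1)) ∨
    (p ∈ S.unfailed A ω k x ∧
      S.execute S.J (N.m * S.J) S.mainLength x (S.unfailed A ω k x) (ω.2.2.1 k) p = none ∧
      S.mainPhase A ω k x p = { x p with failFrame := k }) := by
  by_cases hp : p ∈ S.unfailed A ω k x
  · right
    cases h : S.execute S.J (N.m * S.J) S.mainLength x (S.unfailed A ω k x) (ω.2.2.1 k) p with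
    | none => right; exact ⟨hp, rfl, by simp [mainPhase, hp, h]⟩
    | some j =>
      left
      exact ⟨hp, j, (S.execute_eq_some x p h).2.2, by simp [mainPhase, hp, h]⟩
  · left; exact ⟨hp, by simp [mainPhase, hp]⟩

theorem cleanPhase_cases :
    S.cleanPhase A tie ω k x p = x p ∨
    (p ∈ A.injectedIn 0 (k * S.T) ∧ (x p).failFrame ≠ ⊤ ∧ ∃ j : ℕ,
      (j : ℝ) + 1 ≤ S.cleanLength ∧
      S.cleanPhase A tie ω k x p = (x p).cross (k * S.T + ⌊S.mainLength⌋₊ + j + 1)) := by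
  cases h : S.execute 1 (N.m * S.J) S.cleanLength x (S.selected A tie ω k x) (ω.2.2.2 k) p with
  | none => left; simp [cleanPhase, h]
  | some j =>
    obtain ⟨h1, -, h3⟩ := S.execute_eq_some x p h
    obtain ⟨e, he⟩ := S.buffer_of_mem_selected A tie ω k x p h1
    rw [mem_buffer] at he
    right; exact ⟨he.1, he.2.1, j, h3, by simp [cleanPhase, h]⟩

theorem failFrame_cleanPhase : (S.cleanPhase A tie ω k x p).failFrame = (x p).failFrame := by
  rcases S.cleanPhase_cases A tie ω k x p with h | ⟨-, -, j, -, h⟩ <;> rw [h]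
  rfl

theorem length_route_cleanPhase_le :
    (S.cleanPhase A tie ω k x p).route.length ≤ (x p).route.length := by
  rcases S.cleanPhase_cases A tie ω k x p with h | ⟨-, -, j, -, h⟩ <;> rw [h]
  simp [PacketState.cross]

end Phases

theorem state_succ (ω : S.Sample P) (k : ℕ) :
    S.state A tie ω (k + 1) = S.cleanPhase A tie ω k (S.mid A tie ω k) := rfl

/-- The randomness of the frames before `k`, and the delays, are the same. -/
def Agree (k : ℕ) (ω ω' : S.Sample P) : Prop :=
  ω.1 = ω'.1 ∧ ∀ i < k, (∀ e, ω.2.1 (i, e) = ω'.2.1 (i, e)) ∧ ω.2.2.1 i = ω'.2.2.1 i ∧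
    ω.2.2.2 i = ω'.2.2.2 i

theorem mainPhase_congr {ω ω' : S.Sample P} {k : ℕ} (h : ω.1 = ω'.1)
    (h' : ω.2.2.1 k = ω'.2.2.1 k) : S.mainPhase A ω k = S.mainPhase A ω' k := by
  unfold mainPhase unfailed
  rw [h, h']

theorem cleanPhase_congr {ω ω' : S.Sample P} {k : ℕ} (h : ∀ e, ω.2.1 (k, e) = ω'.2.1 (k, e))
    (h' : ω.2.2.2 k = ω'.2.2.2 k) : S.cleanPhase A tie ω k = S.cleanPhase A tie ω' k := by
  have h1 : S.selected A tie ω k = S.selected A tie ω' k := by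
    funext x
    ext p
    rw [mem_selected, mem_selected]
    simp only [h]
  unfold cleanPhase
  rw [h1, h']

/-- The process is adapted: this is what makes the coins and seeds of frame `k` fresh with respect
to its initial state. -/
theorem state_congr {ω ω' : S.Sample P} {k : ℕ} (h : S.Agree k ω ω') :
    S.state A tie ω k = S.state A tie ω' k := by
  induction k with
  | zero => rfl
  | succ k ih =>
    have h1 := ih ⟨h.1, fun i hi => h.2 i (by omega)⟩
    have h2 := h.2 k (by omega)
    simp only [state]
    rw [h1, S.mainPhase_congr A h.1 h2.2.1, S.cleanPhase_congr A tie h2.1 h2.2.2]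

theorem mid_congr {ω ω' : S.Sample P} {k : ℕ} (h : S.Agree k ω ω')
    (h' : ω.2.2.1 k = ω'.2.2.1 k) : S.mid A tie ω k = S.mid A tie ω' k := by
  unfold mid
  rw [S.state_congr A tie h, S.mainPhase_congr A h.1 h']

/-! ### Invariants of single packets and the virtual process without failures -/

section Invariants

variable (ω : S.Sample P) (k : ℕ) (p : P)

theorem state_of_le_time (h : k * S.T ≤ A.time p) :
    S.state A tie ω k p = { route := A.path p, failFrame := ⊤, clock := A.time p } ∧
    S.mid A tie ω k p = { route := A.path p, failFrame := ⊤, clock := A.time p } := by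
  have main : ∀ k, k * S.T ≤ A.time p → S.mid A tie ω k p = S.state A tie ω k p := by
    intro k hk
    rcases S.mainPhase_cases A ω k (S.state A tie ω k) p with h | h | h
    · exact h.2
    all_goals
      have := (S.mem_unfailed A ω k _ p).1 h.1
      have := (A.mem_injectedIn.1 this.1).2
      omega
  induction k with
  | zero => exact ⟨rfl, main 0 h⟩
  | succ k ih =>
    have hk : k * S.T ≤ A.time p := le_trans (Nat.mul_le_mul_right _ (Nat.le_succ k)) h
    suffices h1 : S.state A tie ω (k + 1) p = _ from ⟨h1, (main (k + 1) h).trans h1⟩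
    rw [← (ih hk).2, state_succ]
    rcases S.cleanPhase_cases A tie ω k (S.mid A tie ω k) p with h | h
    · exact h
    · have := (A.mem_injectedIn.1 h.1).2
      omega

variable (hT : 0 < S.T)

-- The coupling with the virtual process. An unfailed packet loses one link in every frame in which
-- it takes part, since not crossing means failing, and the clean-up phase does not touch it. So its
-- route is determined by its delay alone. Truncated subtraction covers the frames before it starts,
-- and `List.drop` those after its delivery.
include hT in
theorem route_of_failFrame_eq_top (h : (S.state A tie ω k p).failFrame = ⊤) :
    (S.state A tie ω k p).route = (A.path p).drop (k - (S.start A p + ω.1 p)) := by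
  induction k with
  | zero => simp [state]
  | succ k ih =>
    rw [state_succ] at h ⊢
    rw [failFrame_cleanPhase] at h
    have h1 : S.cleanPhase A tie ω k (S.mid A tie ω k) p = S.mid A tie ω k p := by
      rcases S.cleanPhase_cases A tie ω k (S.mid A tie ω k) p with h' | h'
      · exact h'
      · exact absurd h h'.2.1
    rw [h1]
    rcases S.mainPhase_cases A ω k (S.state A tie ω k) p with h' | ⟨h2, j, -, h'⟩ | h'
    · have h3 : S.mid A tie ω k p = S.state A tie ω k p := h'.2
      rw [h3] at h ⊢
      have h4 := h'.1
      rw [mem_unfailed] at h4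
      have ih := ih h
      by_cases hs : S.start A p + ω.1 p ≤ k
      · by_cases hi : p ∈ A.injectedIn 0 (k * S.T)
        · have hr : (S.state A tie ω k p).route = [] := by
            by_contra hr
            exact h4 ⟨hi, hs, hr, h⟩
          rw [hr] at ih ⊢
          rw [eq_comm, List.drop_eq_nil_iff] at ih ⊢
          omega
        · rw [A.mem_injectedIn] at hi
          have : k ≤ A.time p / S.T := (Nat.le_div_iff_mul_le hT).2 (by omega)
          unfold start at hs
          omega
      · rw [ih]
        congr 1
        omega
    · have h3 : S.mid A tie ω k p = _ := h'
      have h4 := (S.mem_unfailed A ω k _ p).1 h2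
      rw [h3]
      simp only [PacketState.cross]
      rw [ih h4.2.2.2, List.tail_drop]
      congr 1
      omega
    · have h3 : S.mid A tie ω k p = _ := h'.2.2
      rw [h3] at h
      simp at h

theorem failFrame_state : (S.state A tie ω k p).failFrame = ⊤ ∨
    (S.state A tie ω k p).failFrame < k := by
  induction k with
  | zero => left; rfl
  | succ k ih =>
    rw [state_succ, failFrame_cleanPhase]
    have hk : (k : ℕ∞) < (k + 1 : ℕ) := by exact_mod_cast Nat.lt_succ_self k
    rcases S.mainPhase_cases A ω k (S.state A tie ω k) p with h' | ⟨-, j, -, h'⟩ | h'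
    · have h3 : S.mid A tie ω k p = _ := h'.2
      rw [h3]
      exact ih.imp id fun h => h.trans hk
    · have h3 : S.mid A tie ω k p = _ := h'
      rw [h3]
      exact ih.imp id fun h => h.trans hk
    · have h3 : S.mid A tie ω k p = _ := h'.2.2
      rw [h3]
      exact Or.inr hk

theorem mid_of_failFrame_ne_top (h : (S.state A tie ω k p).failFrame ≠ ⊤) :
    S.mid A tie ω k p = S.state A tie ω k p := by
  rcases S.mainPhase_cases A ω k (S.state A tie ω k) p with h' | h' | h'
  · exact h'.2
  all_goals exact absurd ((S.mem_unfailed A ω k _ p).1 h'.1).2.2.2 h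

theorem mid_of_failsAt (h : S.FailsAt A tie p k ω) :
    p ∈ S.unfailed A ω k (S.state A tie ω k) ∧
    S.execute S.J (N.m * S.J) S.mainLength (S.state A tie ω k)
      (S.unfailed A ω k (S.state A tie ω k)) (ω.2.2.1 k) p = none ∧
    S.mid A tie ω k p = { S.state A tie ω k p with failFrame := k } := by
  rcases S.mainPhase_cases A ω k (S.state A tie ω k) p with h' | ⟨-, j, -, h'⟩ | h'
  · have h3 : S.mid A tie ω k p = _ := h'.2
    exact absurd (h3 ▸ h.1) h.2
  · have h3 : S.mid A tie ω k p = _ := h'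
    exact absurd (by rw [h3]; exact h.1) h.2
  · exact h'

theorem length_route_mid_le :
    (S.mid A tie ω k p).route.length ≤ (S.state A tie ω k p).route.length := by
  rcases S.mainPhase_cases A ω k (S.state A tie ω k) p with h' | ⟨-, j, -, h'⟩ | h'
  · exact (congrArg (fun y : PacketState E => y.route.length) h'.2).le
  · refine (congrArg (fun y : PacketState E => y.route.length) h').le.trans ?_
    simp [PacketState.cross]
  · exact (congrArg (fun y : PacketState E => y.route.length) h'.2.2).le

theorem length_route_succ_le :
    (S.state A tie ω (k + 1) p).route.length ≤ (S.mid A tie ω k p).route.length :=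
  S.length_route_cleanPhase_le A tie ω k (S.mid A tie ω k) p

theorem length_route_state_le :
    (S.state A tie ω k p).route.length ≤ (A.path p).length := by
  induction k with
  | zero => rfl
  | succ k ih =>
    exact (S.length_route_succ_le A tie ω k p).trans ((S.length_route_mid_le A tie ω k p).trans ih)

/-- Both phases fit into the frame, so every crossing is completed by its end. The second
alternative is needed for packets that have not moved: their clock shows an injection time that may
lie after frame `k`. -/
theorem clock_le (h1 : S.mainLength ≤ S.T) (h2 : ⌊S.mainLength⌋₊ + S.cleanLength ≤ S.T) :
    (S.state A tie ω k p).clock ≤ k * S.T ∨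
      (S.state A tie ω k p) = { route := A.path p, failFrame := ⊤, clock := A.time p } := by
  induction k with
  | zero => right; rfl
  | succ k ih =>
    rw [state_succ]
    have hk : k * S.T ≤ (k + 1) * S.T := Nat.mul_le_mul_right _ (Nat.le_succ k)
    have ih' : (S.mid A tie ω k p).clock ≤ (k + 1) * S.T ∨
        (S.mid A tie ω k p) = { route := A.path p, failFrame := ⊤, clock := A.time p } := by
      rcases S.mainPhase_cases A ω k (S.state A tie ω k) p with h' | ⟨-, j, hj, h'⟩ | h'
      · have h3 : S.mid A tie ω k p = _ := h'.2
        rw [h3]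
        exact ih.imp (fun h => h.trans hk) id
      · have h3 : S.mid A tie ω k p = _ := h'
        left
        rw [h3]
        have : j + 1 ≤ S.T := by exact_mod_cast hj.trans h1
        simp only [PacketState.cross]
        linarith
      · have h3 : S.mid A tie ω k p = _ := h'.2.2
        have h4 := (S.mem_unfailed A ω k _ p).1 h'.1
        have h5 := (A.mem_injectedIn.1 h4.1).2
        left
        rw [h3]
        rcases ih with h | h
        · exact h.trans hk
        · rw [h]
          exact h5.le.trans hk
    rcases S.cleanPhase_cases A tie ω k (S.mid A tie ω k) p with h | ⟨-, -, j, hj, h⟩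
    · rw [h]; exact ih'
    · left
      rw [h]
      have : ⌊S.mainLength⌋₊ + (j + 1) ≤ S.T := by
        have : (⌊S.mainLength⌋₊ : ℝ) + (j + 1) ≤ S.T := by linarith
        exact_mod_cast this
      simp only [PacketState.cross]
      linarith

/-- All delays are smaller than `maxDelay`. -/
def DelaysBounded (δ : P → ℕ) : Prop := ∀ p, δ p < S.maxDelay

-- A participating packet has waited fewer than δ_max frames and crossed fewer than D links since
-- its first possible frame, so it was injected within the last `span` frames.
include hT in
theorem mem_window_of_mem_unfailed (hpath : ∀ p, N.IsPath (A.path p)) (hδ : S.DelaysBounded ω.1)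
    (h : p ∈ S.unfailed A ω k (S.state A tie ω k)) :
    p ∈ S.window A k ∧ S.pos A p (ω.1 p) k = (S.state A tie ω k p).route.head? := by
  obtain ⟨h1, h2, h3, h4⟩ := (S.mem_unfailed A ω k _ p).1 h
  have h5 := S.route_of_failFrame_eq_top A tie ω k p hT h4
  have h6 : k - (S.start A p + ω.1 p) < (A.path p).length := by
    by_contra hlt
    exact h3 (by rw [h5, List.drop_eq_nil_iff]; omega)
  have h7 := (hpath p).2.1
  refine ⟨A.mem_injectedIn.2 ⟨?_, (A.mem_injectedIn.1 h1).2⟩, ?_⟩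
  · refine (Nat.le_div_iff_mul_le hT).1 ?_
    have := hδ p
    unfold start at h6 h2
    unfold span
    generalize A.time p / S.T = s at *
    omega
  · rw [h5, List.head?_drop, pos, if_pos h2]

theorem virtualCount_eq_sum (δ : P → ℕ) :
    S.virtualCount A δ k = ∑ e, S.virtualLoad A δ k e := by
  classical
  unfold virtualCount virtualLoad
  rw [← Finset.card_biUnion]
  · congr 1
    ext p
    simp only [Finset.mem_filter, Finset.mem_biUnion, Finset.mem_univ, true_and,
      Option.ne_none_iff_exists']
    constructor
    · rintro ⟨h, e, he⟩; exact ⟨e, h, he⟩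
    · rintro ⟨e, h, he⟩; exact ⟨h, e, he⟩
  · intro e _ e' _ hee
    rw [Function.onFun, Finset.disjoint_left]
    intro p hp hp'
    rw [Finset.mem_filter] at hp hp'
    exact hee (Option.some_injective _ (hp.2.symm.trans hp'.2))

end Invariants

/-! ### The remaining work of the failed packets and the rank of a packet -/

section Work

variable (ω : S.Sample P) (k : ℕ)

-- Only packets that fail in this very frame add to the work. They are counted by the virtual
-- process, and each brings a route of length at most D.
open Classical in
theorem work_mid_le (hT : 0 < S.T) (hpath : ∀ p, N.IsPath (A.path p))
    (hδ : S.DelaysBounded ω.1) :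
    work ⊤ (A.injectedIn 0 (k * S.T)) (S.mid A tie ω k) ≤
      work ⊤ (A.injectedIn 0 (k * S.T)) (S.state A tie ω k) +
        if S.Bad A tie k ω then N.D * S.virtualCount A ω.1 k else 0 := by
  set U := A.injectedIn 0 (k * S.T)
  have h1 : work ⊤ U (S.mid A tie ω k) ≤ work ⊤ U (S.state A tie ω k) +
      ∑ p ∈ U, if S.FailsAt A tie p k ω then N.D else 0 := by
    unfold work
    rw [← Finset.sum_add_distrib]
    refine Finset.sum_le_sum fun p _ => ?_
    simp only [lt_top_iff_ne_top]
    by_cases h : (S.state A tie ω k p).failFrame = ⊤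
    · by_cases h' : (S.mid A tie ω k p).failFrame = ⊤
      · simp [h']
      · simp only [ne_eq, h', not_false_eq_true, if_true, h, not_true_eq_false, if_false, zero_add]
        rw [if_pos ⟨h, h'⟩]
        exact (S.length_route_mid_le A tie ω k p).trans
          ((S.length_route_state_le A tie ω k p).trans (hpath p).2.1)
    · rw [S.mid_of_failFrame_ne_top A tie ω k p h]
      exact Nat.le_add_right _ _
  refine h1.trans (Nat.add_le_add_left ?_ _)
  split_ifs with hb
  · rw [← Finset.sum_filter, Finset.sum_const, smul_eq_mul, mul_comm]
    refine Nat.mul_le_mul_left _ (Finset.card_le_card fun p hp => ?_)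
    rw [Finset.mem_filter] at hp ⊢
    have h2 := (S.mid_of_failsAt A tie ω k p hp.2).1
    have h3 := S.mem_window_of_mem_unfailed A tie ω k p hT hpath hδ h2
    refine ⟨h3.1, ?_⟩
    rw [h3.2]
    simpa using ((S.mem_unfailed A ω k _ p).1 h2).2.2.1
  · refine (Finset.sum_eq_zero fun p hp => ?_).le
    exact if_neg fun h => hb ⟨p, hp, h⟩

theorem work_succ_eq (c : ℕ∞) :
    work c (A.injectedIn 0 ((k + 1) * S.T)) (S.state A tie ω (k + 1)) =
      work c (A.injectedIn 0 (k * S.T)) (S.state A tie ω (k + 1)) := by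
  unfold work
  refine (Finset.sum_subset (fun p hp => ?_) fun p _ hp => ?_).symm
  · rw [A.mem_injectedIn] at hp ⊢
    exact ⟨hp.1, hp.2.trans_le (Nat.mul_le_mul_right _ (Nat.le_succ k))⟩
  · have h : k * S.T ≤ A.time p := by
      by_contra h
      exact hp (A.mem_injectedIn.2 ⟨Nat.zero_le _, not_le.1 h⟩)
    rw [state_succ, failFrame_cleanPhase, (S.state_of_le_time A tie ω k p h).2]
    simp

theorem work_succ_le (c : ℕ∞) :
    work c (A.injectedIn 0 ((k + 1) * S.T)) (S.state A tie ω (k + 1)) ≤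
      work c (A.injectedIn 0 (k * S.T)) (S.mid A tie ω k) := by
  rw [work_succ_eq]
  refine Finset.sum_le_sum fun p _ => ?_
  rw [state_succ, failFrame_cleanPhase]
  split_ifs
  · exact S.length_route_cleanPhase_le A tie ω k _ p
  · exact le_rfl

/-- This is where serving the oldest failures pays: the packet that moves failed no later than `p`,
hence also before `c`, so a success lowers every truncated work that is not yet exhausted, and not
only the total. -/
theorem work_succ_add_one_le (c : ℕ∞) (h : S.Success A tie k ω) (p : P)
    (hp : p ∈ A.injectedIn 0 (k * S.T)) (hc : (S.mid A tie ω k p).failFrame < c)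
    (hr : (S.mid A tie ω k p).route ≠ []) :
    work c (A.injectedIn 0 ((k + 1) * S.T)) (S.state A tie ω (k + 1)) + 1 ≤
      work c (A.injectedIn 0 (k * S.T)) (S.mid A tie ω k) := by
  have hpt : (S.mid A tie ω k p).failFrame ≠ ⊤ := (hc.trans_le le_top).ne
  rcases h with h | ⟨q, hq, -, h2, h3⟩
  · rcases h p hp with h | h
    · exact absurd h hpt
    · exact absurd h hr
  rw [work_succ_eq, Nat.succ_le_iff]
  refine Finset.sum_lt_sum (fun p _ => ?_) ⟨q, hq, ?_⟩
  · rw [state_succ, failFrame_cleanPhase]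
    split_ifs
    · exact S.length_route_cleanPhase_le A tie ω k _ p
    · exact le_rfl
  · have hqc := (h2 p hp hpt hr).trans_lt hc
    have h4 : (S.state A tie ω (k + 1) q).failFrame = (S.mid A tie ω k q).failFrame :=
      S.failFrame_cleanPhase A tie ω k _ q
    rw [h4, if_pos hqc, if_pos hqc]
    exact h3

omit [Fintype E] in
theorem exists_of_work_ne_zero {c : ℕ∞} {U : Finset P} {x : P → PacketState E}
    (h : work c U x ≠ 0) : ∃ p ∈ U, (x p).failFrame < c ∧ (x p).route ≠ [] := by
  obtain ⟨p, hp, h'⟩ := Finset.exists_ne_zero_of_sum_ne_zero h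
  refine ⟨p, hp, ?_⟩
  split_ifs at h' with h1
  · exact ⟨h1, fun h2 => h' (by simp [h2])⟩
  · exact absurd rfl h'

open Classical in
/-- The total length of the routes of the failed packets decreases in every successful clean-up. -/
theorem work_succ_le_sub :
    work ⊤ (A.injectedIn 0 ((k + 1) * S.T)) (S.state A tie ω (k + 1)) ≤
      work ⊤ (A.injectedIn 0 (k * S.T)) (S.mid A tie ω k) -
        if S.Success A tie k ω then 1 else 0 := by
  split_ifs with h
  · by_cases h0 : work ⊤ (A.injectedIn 0 (k * S.T)) (S.mid A tie ω k) = 0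
    · have := S.work_succ_le A tie ω k ⊤
      omega
    · obtain ⟨p, hp, h1, h2⟩ := exists_of_work_ne_zero h0
      have := S.work_succ_add_one_le A tie ω k ⊤ h p hp h1 h2
      omega
  · exact S.work_succ_le A tie ω k ⊤

/-- The total remaining route lengths of the packets that failed no later than `p`, as long as `p`
has failed and is not delivered. -/
noncomputable def rank (p : P) (k : ℕ) (x : P → PacketState E) : ℕ :=
  open Classical in
  if (x p).failFrame ≠ ⊤ ∧ (x p).route ≠ [] then
    work ((x p).failFrame + 1) (A.injectedIn 0 (k * S.T)) x else 0

-- The rank can jump only when `p` itself fails, and then to at most the total failed work. Later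
-- failures are too young to be counted.
open Classical in
theorem rank_mid_le (p : P) :
    S.rank A p k (S.mid A tie ω k) ≤ S.rank A p k (S.state A tie ω k) +
      if S.FailsAt A tie p k ω then
        work ⊤ (A.injectedIn 0 (k * S.T)) (S.mid A tie ω k) else 0 := by
  have hle : S.rank A p k (S.mid A tie ω k) ≤
      work ⊤ (A.injectedIn 0 (k * S.T)) (S.mid A tie ω k) := by
    unfold rank
    split_ifs
    · refine Finset.sum_le_sum fun q _ => ?_
      split_ifs with h1 h2
      · exact le_rfl
      · exact absurd (h1.trans_le le_top) h2
      · exact Nat.zero_le _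
      · exact le_rfl
    · exact Nat.zero_le _
  by_cases h : S.FailsAt A tie p k ω
  · rw [if_pos h]
    exact hle.trans (Nat.le_add_left _ _)
  · rw [if_neg h, add_zero]
    by_cases h1 : (S.state A tie ω k p).failFrame = ⊤
    · have : (S.mid A tie ω k p).failFrame = ⊤ := by
        by_contra h2
        exact h ⟨h1, h2⟩
      simp [rank, this]
    · have h2 := S.mid_of_failFrame_ne_top A tie ω k p h1
      unfold rank
      rw [h2]
      split_ifs with h3
      · refine Finset.sum_le_sum fun q _ => ?_
        by_cases h4 : (S.state A tie ω k q).failFrame = ⊤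
        · by_cases h5 : (S.mid A tie ω k q).failFrame = ⊤
          · simp [h5]
          · have h6 := (S.mid_of_failsAt A tie ω k q ⟨h4, h5⟩).2.2
            have h7 : (S.state A tie ω k p).failFrame < k :=
              (S.failFrame_state A tie ω k p).resolve_left h1
            -- A packet failing now carries the mark `k`, whereas `p` failed strictly before frame
            -- `k`.
            rw [if_neg]
            · exact Nat.zero_le _
            · rw [h6]
              simp only [not_lt]
              exact Order.add_one_le_of_lt h7
        · rw [S.mid_of_failFrame_ne_top A tie ω k q h4]
      · exact le_rfl

theorem rank_mid_pos (p : P) (hp : p ∈ A.injectedIn 0 (k * S.T)) :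
    S.rank A p k (S.mid A tie ω k) ≠ 0 ↔
      (S.mid A tie ω k p).failFrame ≠ ⊤ ∧ (S.mid A tie ω k p).route ≠ [] := by
  unfold rank
  split_ifs with h
  · simp only [h, ne_eq, not_false_eq_true, and_self, iff_true]
    refine Nat.pos_iff_ne_zero.1 (Finset.sum_pos' (fun _ _ => Nat.zero_le _) ⟨p, hp, ?_⟩)
    rw [if_pos]
    · exact List.length_pos_of_ne_nil h.2
    · exact (ENat.lt_add_one_iff h.1).2 le_rfl
  · simp [h]

-- With `rank_mid_le`, this makes the rank a potential with negative drift as long as `p` waits in a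
-- buffer.
open Classical in
theorem rank_succ_add_le (p : P) :
    S.rank A p (k + 1) (S.state A tie ω (k + 1)) +
      (if S.rank A p k (S.mid A tie ω k) ≠ 0 ∧ S.Success A tie k ω then 1 else 0) ≤
      S.rank A p k (S.mid A tie ω k) := by
  by_cases hp : p ∈ A.injectedIn 0 (k * S.T)
  · by_cases h0 : S.rank A p k (S.mid A tie ω k) = 0
    · have h1 := mt (S.rank_mid_pos A tie ω k p hp).2 (not_not.2 h0)
      rw [if_neg (fun h => h.1 h0), h0, add_zero, Nat.le_zero]
      unfold rank
      rw [if_neg]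
      rintro ⟨h2, h3⟩
      rw [state_succ, failFrame_cleanPhase] at h2
      refine h1 ⟨h2, fun h4 => h3 ?_⟩
      have := S.length_route_succ_le A tie ω k p
      rw [h4] at this
      exact List.eq_nil_of_length_eq_zero (Nat.le_zero.1 this)
    · have h1 := (S.rank_mid_pos A tie ω k p hp).1 h0
      have h2 : (S.state A tie ω (k + 1) p).failFrame = (S.mid A tie ω k p).failFrame :=
        S.failFrame_cleanPhase A tie ω k _ p
      have h3 : S.rank A p k (S.mid A tie ω k) = work ((S.mid A tie ω k p).failFrame + 1)
          (A.injectedIn 0 (k * S.T)) (S.mid A tie ω k) := by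
        unfold rank; rw [if_pos h1]
      have h4 : S.rank A p (k + 1) (S.state A tie ω (k + 1)) ≤
          work ((S.mid A tie ω k p).failFrame + 1)
          (A.injectedIn 0 ((k + 1) * S.T)) (S.state A tie ω (k + 1)) := by
        unfold rank; rw [h2]; split_ifs
        · exact le_rfl
        · exact Nat.zero_le _
      rw [h3]
      split_ifs with h5
      · exact (Nat.add_le_add_right h4 1).trans (S.work_succ_add_one_le A tie ω k _ h5.2 p hp
          ((ENat.lt_add_one_iff h1.1).2 le_rfl) h1.2)
      · exact h4.trans (S.work_succ_le A tie ω k _)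
  · have h : k * S.T ≤ A.time p := by
      by_contra h
      exact hp (A.mem_injectedIn.2 ⟨Nat.zero_le _, not_le.1 h⟩)
    have h1 := (S.state_of_le_time A tie ω k p h).2
    have h2 : (S.state A tie ω (k + 1) p).failFrame = ⊤ := by
      rw [state_succ, failFrame_cleanPhase, h1]
    simp [rank, h1, h2]

end Work

end Protocol
end WirelessScheduling

/-! ### Measurability -/

namespace WirelessScheduling

instance PacketState.instMeasurableSpace {E : Type*} : MeasurableSpace (PacketState E) := ⊤

instance PacketState.instDiscreteMeasurableSpace {E : Type*} :
    DiscreteMeasurableSpace (PacketState E) := ⟨fun _ => trivial⟩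

instance PacketState.instCountable {E : Type*} [Countable E] : Countable (PacketState E) :=
  Function.Injective.countable (f := fun x : PacketState E => (x.route, x.failFrame, x.clock))
    (by rintro ⟨a, b, c⟩ ⟨a', b', c'⟩ h; simp_all)

/-- Each phase is a function of countable data (states, delays, coins) and of one seed. The seed
space is arbitrary, so joint measurability is obtained by fixing the countable argument. -/
theorem measurable_of_countable_of_measurable {Ω C X Y : Type*} [MeasurableSpace Ω]
    [MeasurableSpace C] [MeasurableSpace X] [MeasurableSpace Y] [Countable C]
    [MeasurableSingletonClass C] {c : Ω → C} {s : Ω → X} (G : C → X → Y) (hc : Measurable c)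
    (hs : Measurable s) (hG : ∀ a, Measurable (G a)) : Measurable fun ω => G (c ω) (s ω) :=
  (measurable_from_prod_countable_right (f := fun z : C × X => G z.1 z.2) hG).comp (hc.prodMk hs)

theorem measurable_iInf_enat {Ω : Type*} [MeasurableSpace Ω] {F : ℕ → Ω → ℕ∞}
    (hF : ∀ k, Measurable (F k)) : Measurable fun ω => ⨅ k, F k ω := by
  refine measurable_to_countable' fun n => ?_
  have : (fun ω => ⨅ k, F k ω) ⁻¹' {n} = (⋂ k, F k ⁻¹' Set.Ici n) ∩ ⋃ k, F k ⁻¹' {n} := by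
    ext ω
    simp only [Set.mem_preimage, Set.mem_singleton_iff, Set.mem_inter_iff, Set.mem_iInter,
      Set.mem_Ici, Set.mem_iUnion]
    constructor
    -- An infimum in `ℕ∞` is attained, by well-foundedness.
    · rintro rfl
      exact ⟨fun k => iInf_le _ k, ciInf_mem fun k => F k ω⟩
    · rintro ⟨h1, k, h2⟩
      exact le_antisymm (h2 ▸ iInf_le _ k) (le_iInf h1)
  rw [this]
  exact (MeasurableSet.iInter fun k => hF k .of_discrete).inter
    (MeasurableSet.iUnion fun k => hF k .of_discrete)

namespace Protocol

variable {V E : Type*} [Fintype E] {N : Network V E} (S : Protocol N) {P : Type}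
  (A : Injection E P) (tie : (U : Finset P) → U.Nonempty → {p // p ∈ U})

theorem measurable_execute (I n L : ℝ) (x : P → PacketState E) (U : Finset P) (p : P) :
    Measurable[_, ⊤] fun σ => S.execute I n L x U σ p := by
  classical
  let _ : MeasurableSpace (Option ℕ) := ⊤
  have _ : DiscreteMeasurableSpace (Option ℕ) := ⟨fun _ => trivial⟩
  unfold execute
  split_ifs with h
  · refine Measurable.comp (g := fun o : Option ℕ => o.filter fun j : ℕ => decide ((j : ℝ) + 1 ≤ L))
      (f := fun σ => S.alg.run I n _ σ (⟨p, h⟩ : {q // q ∈ U.filter (fun q => (x q).route ≠ [])})) (measurable_of_countable _)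
      (measurable_to_countable' fun o => ?_)
    exact S.alg.measurableSet_run I n _ _ o
  · exact measurable_const

theorem measurable_mainPhase_seed (δ : P → ℕ) (k : ℕ) (x : P → PacketState E) (p : P) :
    Measurable fun σ : S.alg.Seed =>
      S.mainPhase A (δ, fun _ => false, fun _ => σ, fun _ => σ) k x p := by
  classical
  let _ : MeasurableSpace (Option ℕ) := ⊤
  have _ : DiscreteMeasurableSpace (Option ℕ) := ⟨fun _ => trivial⟩
  have hun : ∀ σ : S.alg.Seed, S.unfailed A (δ, fun _ => false, fun _ => σ, fun _ => σ) k x =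
      (A.injectedIn 0 (k * S.T)).filter (fun p =>
        A.time p / S.T + 1 + δ p ≤ k ∧ (x p).route ≠ [] ∧ (x p).failFrame = ⊤) := fun σ => by
    ext p; simp [unfailed]
  unfold mainPhase
  simp only [hun]
  split_ifs
  · exact Measurable.comp (g := fun o : Option ℕ => match o with
        | some j => (x p).cross (k * S.T + j + 1)
        | none => { x p with failFrame := k }) (measurable_of_countable _)
      (S.measurable_execute _ _ _ _ _ _)
  · exact measurable_const

theorem measurable_cleanPhase_seed (c : E → Bool) (k : ℕ) (x : P → PacketState E) (p : P) :
    Measurable fun σ : S.alg.Seed =>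
      S.cleanPhase A tie (fun _ => 0, fun i => c i.2, fun _ => σ, fun _ => σ) k x p := by
  classical
  let _ : MeasurableSpace (Option ℕ) := ⊤
  have _ : DiscreteMeasurableSpace (Option ℕ) := ⟨fun _ => trivial⟩
  have hsel : ∀ σ : S.alg.Seed,
      S.selected A tie (fun _ => 0, fun i => c i.2, fun _ => σ, fun _ => σ) k x =
      (A.injectedIn 0 (k * S.T)).filter (fun p =>
        ∃ e, c e = true ∧ ∃ h : (S.oldest A k x e).Nonempty, p = (tie (S.oldest A k x e) h).1) :=
    fun σ => by ext p; simp [selected]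
  unfold cleanPhase
  simp only [hsel]
  exact Measurable.comp (g := fun o : Option ℕ => match o with
        | some j => (x p).cross (k * S.T + ⌊S.mainLength⌋₊ + j + 1)
        | none => x p) (measurable_of_countable _)
      (S.measurable_execute _ _ _ _ _ _)

/-- Completing the states of the packets in `U` by the initial states of the others. -/
noncomputable def extendState (U : Finset P) (y : U → PacketState E) (p : P) : PacketState E :=
  open Classical in
  if h : p ∈ U then y ⟨p, h⟩ else { route := A.path p, failFrame := ⊤, clock := A.time p }

theorem measurable_seeds (k : ℕ) : (Measurable fun ω : S.Sample P => ω.2.2.1 k) ∧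
    Measurable fun ω : S.Sample P => ω.2.2.2 k := by
  constructor <;> fun_prop

/-- Packets injected after the beginning of frame `k` are still in their initial state. So the phase
depends on the states and delays of a finite set of packets, which form a countable type. -/
theorem measurable_mid_of_state {k : ℕ} (h : ∀ p, Measurable fun ω => S.state A tie ω k p) (p : P) :
    Measurable fun ω => S.mid A tie ω k p := by
  classical
  set U := A.injectedIn 0 (k * S.T) with hU
  let G (c : (U → PacketState E) × (U → ℕ)) (σ : S.alg.Seed) : PacketState E :=
    S.mainPhase A (fun q => if h : q ∈ U then c.2 ⟨q, h⟩ else 0, fun _ => false,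
      fun _ => σ, fun _ => σ) k (extendState A U c.1) p
  have heq : (fun ω => S.mid A tie ω k p) = fun ω =>
      G (fun q => S.state A tie ω k q, fun q => ω.1 q) (ω.2.2.1 k) := by
    funext ω
    change _ = S.mainPhase A _ k (extendState A U fun q => S.state A tie ω k q) p
    have h1 : extendState A U (fun q => S.state A tie ω k q) = S.state A tie ω k := by
      funext q
      unfold extendState
      split_ifs with hq
      · rfl
      · refine ((S.state_of_le_time A tie ω k q ?_).1).symm
        by_contra hlt
        exact hq (A.mem_injectedIn.2 ⟨Nat.zero_le _, not_le.1 hlt⟩)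
    rw [h1]
    have h2 : ∀ ω' : S.Sample P, (∀ q ∈ U, ω'.1 q = ω.1 q) → ω'.2.2.1 k = ω.2.2.1 k →
        S.mainPhase A ω' k (S.state A tie ω k) = S.mainPhase A ω k (S.state A tie ω k) := by
      intro ω' h3 h4
      have h5 : S.unfailed A ω' k (S.state A tie ω k) = S.unfailed A ω k (S.state A tie ω k) := by
        ext q
        rw [mem_unfailed, mem_unfailed]
        refine and_congr_right fun hq => ?_
        rw [h3 q hq]
      unfold mainPhase
      rw [h4, h5]
    unfold mid
    refine (congrFun (h2 (fun q => if h : q ∈ U then ω.1 q else 0, fun _ => false,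
      fun _ => ω.2.2.1 k, fun _ => ω.2.2.1 k) (fun q hq => ?_) rfl) p).symm
    simp [hq]
  rw [heq]
  refine measurable_of_countable_of_measurable G (Measurable.prodMk ?_ ?_) (S.measurable_seeds k).1 fun c => ?_
  · exact measurable_pi_lambda _ fun q => h q
  · exact measurable_pi_lambda _ fun q => (measurable_pi_apply (q : P)).comp measurable_fst
  · exact S.measurable_mainPhase_seed A _ k _ p

theorem measurable_state (k : ℕ) : ∀ p, Measurable fun ω => S.state A tie ω k p := by
  classical
  induction k with
  | zero => exact fun p => measurable_const
  | succ k ih =>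
    intro p
    set U := A.injectedIn 0 (k * S.T) with hU
    let G (c : (U → PacketState E) × (E → Bool)) (σ : S.alg.Seed) : PacketState E :=
      S.cleanPhase A tie (fun _ => 0, fun i => c.2 i.2, fun _ => σ, fun _ => σ) k
        (extendState A U c.1) p
    have heq : (fun ω => S.state A tie ω (k + 1) p) = fun ω =>
        G (fun q => S.mid A tie ω k q, fun e => ω.2.1 (k, e)) (ω.2.2.2 k) := by
      funext ω
      change _ = S.cleanPhase A tie _ k (extendState A U fun q => S.mid A tie ω k q) p
      have h1 : extendState A U (fun q => S.mid A tie ω k q) = S.mid A tie ω k := by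
        funext q
        unfold extendState
        split_ifs with hq
        · rfl
        · refine ((S.state_of_le_time A tie ω k q ?_).2).symm
          by_contra hlt
          exact hq (A.mem_injectedIn.2 ⟨Nat.zero_le _, not_le.1 hlt⟩)
      rw [h1, state_succ]
      exact congrFun (congrFun (S.cleanPhase_congr A tie (fun e => rfl) rfl) _) p
    rw [heq]
    have hmid := S.measurable_mid_of_state A tie ih
    refine measurable_of_countable_of_measurable G (Measurable.prodMk ?_ ?_) (S.measurable_seeds k).2 fun c => ?_
    · exact measurable_pi_lambda _ fun q => hmid q
    · exact measurable_pi_lambda _ fun e =>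
        (measurable_pi_apply (k, e)).comp (measurable_fst.comp measurable_snd)
    · exact S.measurable_cleanPhase_seed A tie _ k _ p

theorem measurable_mid (k : ℕ) (p : P) : Measurable fun ω => S.mid A tie ω k p :=
  S.measurable_mid_of_state A tie (S.measurable_state A tie k) p

theorem measurable_work {Ω : Type*} [MeasurableSpace Ω] {x : Ω → P → PacketState E}
    (h : ∀ p, Measurable fun ω => x ω p) {c : Ω → ℕ∞} (hc : Measurable c) (U : Finset P) :
    Measurable fun ω => work (c ω) U (x ω) := by
  unfold work
  refine Finset.measurable_fun_sum _ fun p _ => ?_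
  exact Measurable.comp (g := fun z : PacketState E × ℕ∞ =>
    open Classical in if z.1.failFrame < z.2 then z.1.route.length else 0)
    (measurable_of_countable _) ((h p).prodMk hc)

theorem measurable_rank {Ω : Type*} [MeasurableSpace Ω] {x : Ω → P → PacketState E}
    (h : ∀ p, Measurable fun ω => x ω p) (p : P) (k : ℕ) :
    Measurable fun ω => S.rank A p k (x ω) := by
  classical
  unfold rank
  refine Measurable.ite ?_ (measurable_work h
    ((measurable_of_countable fun y : PacketState E => y.failFrame + 1).comp (h p)) _)
    measurable_const
  exact (h p) (MeasurableSet.of_discrete (s := {y : PacketState E | y.failFrame ≠ ⊤ ∧ y.route ≠ []}))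

theorem measurableSet_failsAt (p : P) (k : ℕ) : MeasurableSet {ω | S.FailsAt A tie p k ω} :=
  ((S.measurable_state A tie k p) (MeasurableSet.of_discrete (s := {y : PacketState E | y.failFrame = ⊤}))).inter
    ((S.measurable_mid A tie k p) (MeasurableSet.of_discrete (s := {y : PacketState E | y.failFrame ≠ ⊤})))

theorem measurableSet_bad (k : ℕ) : MeasurableSet {ω | S.Bad A tie k ω} := by
  have : {ω | S.Bad A tie k ω} =
      ⋃ p ∈ A.injectedIn 0 (k * S.T), {ω | S.FailsAt A tie p k ω} := by
    ext ω; simp [Bad]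
  rw [this]
  exact Finset.measurableSet_biUnion _ fun p _ => S.measurableSet_failsAt A tie p k

theorem measurableSet_success (k : ℕ) : MeasurableSet {ω | S.Success A tie k ω} := by
  set U := A.injectedIn 0 (k * S.T) with hU
  have hm : Measurable fun ω =>
      ((fun q => S.mid A tie ω k q, fun q => S.state A tie ω (k + 1) q) :
        (U → PacketState E) × (U → PacketState E)) :=
    (measurable_pi_lambda _ fun q : U => S.measurable_mid A tie k q).prodMk
      (measurable_pi_lambda _ fun q : U => S.measurable_state A tie (k + 1) q)
  have : {ω | S.Success A tie k ω} = (fun ω =>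
      ((fun q => S.mid A tie ω k q, fun q => S.state A tie ω (k + 1) q) :
        (U → PacketState E) × (U → PacketState E))) ⁻¹'
      {z | (∀ q, (z.1 q).failFrame = ⊤ ∨ (z.1 q).route = []) ∨
        ∃ q, (z.1 q).failFrame ≠ ⊤ ∧ (∀ q', (z.1 q').failFrame ≠ ⊤ → (z.1 q').route ≠ [] →
          (z.1 q).failFrame ≤ (z.1 q').failFrame) ∧
          (z.2 q).route.length < (z.1 q).route.length} := by
    ext ω
    simp only [Success, Set.mem_preimage, Set.mem_ofPred_eq, Subtype.forall, Subtype.exists,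
      exists_prop, hU]
  rw [this]
  exact hm (Set.to_countable _).measurableSet

theorem measurable_deliveryTime (p : P) : Measurable (S.deliveryTime A tie p) := by
  classical
  unfold deliveryTime
  refine measurable_iInf_enat fun k => ?_
  exact (measurable_of_countable fun y : PacketState E =>
    if y.route = [] then (y.clock : ℕ∞) else ⊤).comp (S.measurable_state A tie k p)

theorem measurable_latency (p : P) : Measurable (S.latency A tie p) := by
  unfold latency
  exact (measurable_of_countable fun n : ℕ∞ => ((n - A.time p : ℕ∞) : ℝ≥0∞)).comp
    (S.measurable_deliveryTime A tie p)

theorem queueLength_eq_sum (t : ℕ) (ω : S.Sample P) : S.queueLength A tie t ω =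
    ∑ p ∈ A.injectedIn 0 (t + 1), {ω | (t : ℕ∞) < S.deliveryTime A tie p ω}.indicator 1 ω := by
  classical
  unfold queueLength
  rw [Finset.card_filter, Nat.cast_sum]
  refine Finset.sum_congr rfl fun p _ => ?_
  simp only [Set.indicator, Set.mem_ofPred_eq, Pi.one_apply]
  split_ifs <;> simp

theorem measurable_queueLength (t : ℕ) : Measurable (S.queueLength A tie t) := by
  simp only [funext (S.queueLength_eq_sum A tie t)]
  refine Finset.measurable_fun_sum _ fun p _ => measurable_one.indicator ?_
  exact (S.measurable_deliveryTime A tie p)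
    (MeasurableSet.of_discrete (s := Set.Ioi (t : ℕ∞)))

end Protocol
end WirelessScheduling

/-! ### Interference, and consequences of the choice of the frame length -/

namespace WirelessScheduling

section Interference

variable {V E : Type*} [Fintype E] (N : Network V E)

theorem Network.interference_le_iff {R : E → ℕ} {I : ℝ} (hI : 0 ≤ I) :
    N.interference R ≤ I ↔ ∀ e, ∑ e', N.W e e' * R e' ≤ I := by
  unfold Network.interference
  rw [pi_norm_le_iff_of_nonneg hI]
  refine forall_congr' fun e => ?_
  rw [Real.norm_of_nonneg]
  · rfl
  · exact Finset.sum_nonneg fun e' _ => mul_nonneg (N.W_nonneg e e') (Nat.cast_nonneg _)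

theorem Network.sum_le_interference (R : E → ℕ) (e : E) :
    ∑ e', N.W e e' * R e' ≤ N.interference R :=
  (N.interference_le_iff (norm_nonneg _)).1 le_rfl e

/-- The number of requests on a link is at most the interference at this link. -/
theorem Network.le_sum_W_mul (R : E → ℕ) (e : E) : (R e : ℝ) ≤ ∑ e', N.W e e' * R e' := by
  have h := Finset.single_le_sum (f := fun e' => N.W e e' * R e')
    (fun e' _ => mul_nonneg (N.W_nonneg e e') (Nat.cast_nonneg _)) (Finset.mem_univ e)
  simpa [N.W_diag e] using h

end Interference

namespace Protocol

variable {V E : Type*} [Fintype E] {N : Network V E}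

/-- The assumptions on the network, the static algorithm and the parameters. -/
structure Valid (S : Protocol N) : Prop where
  nonempty : Nonempty E
  D_pos : 0 < N.D
  f_pos : 0 < S.f N.m
  mono : MonotoneOn (S.g N.m) (Set.Ici 1)
  isLittleO : Asymptotics.IsLittleO Filter.atTop (S.g N.m) (fun n : ℝ => n)
  sched : S.alg.HasScheduleLength S.f S.g
  ε_pos : 0 < S.ε
  ε_lt : S.ε < 1
  w_pos : 0 < S.w
  long : S.FrameLongEnough

/-- `λ' T`, an upper bound on the expected interference in a frame. -/
noncomputable def frameLoad (S : Protocol N) : ℝ := S.rate' * S.T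

/-- The bound `m J` on the number of requests. -/
noncomputable def size (S : Protocol N) : ℝ := N.m * S.J

namespace Valid

variable {S : Protocol N} (hS : S.Valid)

include hS

theorem m_pos : 0 < N.m := by
  have := hS.nonempty
  exact lt_of_lt_of_le Fintype.card_pos (le_max_left _ _)

theorem one_le_m : (1 : ℝ) ≤ N.m := by exact_mod_cast hS.m_pos

/-- Serving `n` requests on one link takes `n` slots. -/
theorem le_schedule (n : ℕ) (hn : 1 ≤ n) : (n : ℝ) ≤ S.f N.m * n + S.g N.m n := by
  classical
  obtain ⟨e⟩ := hS.nonempty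
  have hn' : (1 : ℝ) ≤ n := by exact_mod_cast hn
  have h := hS.sched n n hn' (Fin n) (fun _ => e) (by simp) (by
    rw [N.interference_le_iff (Nat.cast_nonneg _)]
    intro e'
    rw [Finset.sum_eq_single e]
    · simp only [Finset.filter_true, Finset.card_univ, Fintype.card_fin]
      exact mul_le_of_le_one_left (Nat.cast_nonneg _) (N.W_le_one _ _)
    · intro b _ hb
      simp [Ne.symm hb]
    · simp)
  -- The success probability is positive, so at least one seed produces a complete schedule.
  have hpos : 0 < 1 - 1 / (2 * (n : ℝ) ^ 4) := by
    have h1 : (1 : ℝ) ≤ (n : ℝ) ^ 4 := one_le_pow₀ hn'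
    rw [sub_pos, div_lt_one (by positivity)]
    linarith
  have hne : {σ | ∀ q : Fin n, ∃ j : ℕ, S.alg.run n n (fun _ => e) σ q = some j ∧
        (j : ℝ) + 1 ≤ S.f N.m * n + S.g N.m n}.Nonempty := by
    by_contra hemp
    rw [Set.not_nonempty_iff_eq_empty] at hemp
    rw [hemp] at h
    simp only [measureReal_empty] at h
    linarith
  obtain ⟨σ, hσ⟩ := hne
  choose j hj hj' using hσ
  have hinj : Function.Injective j := fun q q' hq =>
    S.alg.one_per_link n n (fun _ => e) σ q q' (j q) (hj q) (hq ▸ hj q') rfl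
  -- The `n` requests share a link and occupy distinct slots, so some slot has index at least `n -
  -- 1`.
  have h1 : ∃ q, n ≤ j q + 1 := by
    by_contra hall
    push Not at hall
    have h2 : Finset.univ.image j ⊆ Finset.range (n - 1) := by
      intro i hi
      obtain ⟨q, -, rfl⟩ := Finset.mem_image.1 hi
      have := hall q
      rw [Finset.mem_range]; omega
    have h3 := Finset.card_le_card h2
    rw [Finset.card_image_of_injective _ hinj, Finset.card_univ, Fintype.card_fin,
      Finset.card_range] at h3
    omega
  obtain ⟨q, hq⟩ := h1
  exact le_trans (by exact_mod_cast hq) (hj' q)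

/-- From n ≤ f(m) n + g(m, n) and g(m, n) = o(n), dividing by n. The bound is not an assumption of
the theorem. -/
theorem one_le_f : 1 ≤ S.f N.m := by
  refine le_of_forall_pos_le_add fun η hη => ?_
  have h := (hS.isLittleO.def hη).and (Filter.eventually_ge_atTop 1)
  obtain ⟨n, hn, hn1⟩ := (tendsto_natCast_atTop_atTop.eventually h).exists
  have hn1' : 1 ≤ n := by exact_mod_cast hn1
  have h1 := hS.le_schedule n hn1'
  have h2 : S.g N.m n ≤ η * n := by
    rw [Real.norm_eq_abs, Real.norm_of_nonneg (by positivity)] at hn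
    exact (le_abs_self _).trans hn
  have h3 : 1 * (n : ℝ) ≤ (S.f N.m + η) * n := by linarith
  exact le_of_mul_le_mul_right h3 (by linarith)

theorem log_m_nonneg : 0 ≤ Real.log N.m := Real.log_nonneg hS.one_le_m

theorem frameLoad_ge : 50 / (S.ε / 2) ^ 3 + 24 * Real.log N.m / (S.ε / 2) ^ 2 ≤ S.frameLoad := by
  have h1 := hS.long.1
  have hf := hS.f_pos
  have he := hS.ε_pos
  have he1 := hS.ε_lt
  have hl := hS.log_m_nonneg
  have h2 : S.frameLoad = (1 - S.ε / 2) * (S.T / S.f N.m) := by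
    unfold frameLoad rate'; ring
  have h3 : 100 / (S.ε / 2) ^ 3 + 48 * Real.log N.m / (S.ε / 2) ^ 2 ≤ S.T / S.f N.m := by
    rw [le_div_iff₀ hf]
    calc _ = _ := by ring
      _ ≤ _ := h1
  rw [h2]
  have h4 : 0 ≤ 100 / (S.ε / 2) ^ 3 + 48 * Real.log N.m / (S.ε / 2) ^ 2 := by positivity
  calc 50 / (S.ε / 2) ^ 3 + 24 * Real.log N.m / (S.ε / 2) ^ 2
      = (1 / 2) * (100 / (S.ε / 2) ^ 3 + 48 * Real.log N.m / (S.ε / 2) ^ 2) := by ring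
    _ ≤ (1 - S.ε / 2) * (100 / (S.ε / 2) ^ 3 + 48 * Real.log N.m / (S.ε / 2) ^ 2) := by
        gcongr; linarith
    _ ≤ _ := by
        refine mul_le_mul_of_nonneg_left h3 (by linarith)

theorem frameLoad_ge_cube : 50 / (S.ε / 2) ^ 3 ≤ S.frameLoad := by
  have := hS.frameLoad_ge
  have := hS.log_m_nonneg
  have : 0 ≤ 24 * Real.log N.m / (S.ε / 2) ^ 2 := by positivity
  linarith

theorem le_frameLoad : 400 ≤ S.frameLoad := by
  refine le_trans ?_ hS.frameLoad_ge_cube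
  have he := hS.ε_pos
  rw [le_div_iff₀ (by positivity)]
  have : (S.ε / 2) ^ 3 ≤ (1 / 2) ^ 3 := by
    gcongr; exact hS.ε_lt.le
  linarith

theorem J_eq : S.J = (1 + S.ε / 2) * S.frameLoad := by
  unfold J frameLoad; ring

theorem le_J : 400 ≤ S.J := by
  rw [hS.J_eq]
  nlinarith [hS.le_frameLoad, hS.ε_pos]

theorem le_size : 400 ≤ S.size := by
  unfold size
  nlinarith [hS.le_J, hS.one_le_m]

theorem T_pos : 0 < S.T := by
  rcases Nat.eq_zero_or_pos S.T with h | h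
  · have := hS.le_frameLoad
    unfold frameLoad at this
    rw [h] at this
    norm_num at this
  · exact h

theorem f_mul_J : S.f N.m * S.J = (1 - (S.ε / 2) ^ 2) * S.T := by
  have hf := hS.f_pos
  unfold J rate'
  field_simp
  ring

/-- As f(m) J ≤ T, the argument mJ is at most (m / f(m)) T, so monotonicity of g and the second
condition on T apply. The spare factor 1 / f(m) is dropped by f(m) ≥ 1. -/
theorem g_size_le : S.g N.m S.size ≤ (S.ε / 2) ^ 2 * S.T / 4 := by
  have hf := hS.f_pos
  have he := hS.ε_pos
  have hT : (0 : ℝ) < S.T := by exact_mod_cast hS.T_pos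
  have hle : S.size ≤ N.m / S.f N.m * S.T := by
    unfold size
    rw [div_mul_eq_mul_div, le_div_iff₀ hf, mul_assoc, mul_comm S.J, hS.f_mul_J]
    refine mul_le_mul_of_nonneg_left ?_ (Nat.cast_nonneg _)
    nlinarith [sq_nonneg (S.ε / 2)]
  have h1 : S.g N.m S.size ≤ S.g N.m (N.m / S.f N.m * S.T) :=
    hS.mono (by rw [Set.mem_Ici]; linarith [hS.le_size])
      (by rw [Set.mem_Ici]; linarith [hS.le_size]) hle
  have h2 := hS.long.2
  refine h1.trans ?_
  have h3 : S.g N.m (N.m / S.f N.m * S.T) ≤ (S.ε / 2) ^ 2 * S.T / (4 * S.f N.m) := by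
    rw [le_div_iff₀ (by positivity)]
    have h4 := mul_le_mul_of_nonneg_left h2 (sq_nonneg (S.ε / 2))
    calc _ = (S.ε / 2) ^ 2 * (4 * S.f N.m / (S.ε / 2) ^ 2 * S.g N.m (N.m / S.f N.m * S.T)) := by
          field_simp
      _ ≤ _ := h4
  refine h3.trans ?_
  rw [div_le_div_iff₀ (by positivity) (by norm_num)]
  have := hS.one_le_f
  have h5 : 0 ≤ (S.ε / 2) ^ 2 * S.T := by positivity
  nlinarith

theorem f_le : S.f N.m ≤ (S.ε / 2) ^ 2 * S.T / 4 := by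
  have h1 := hS.long.1
  have hf := hS.f_pos
  have he := hS.ε_pos
  have hl := hS.log_m_nonneg
  have h2 : 0 ≤ 48 * S.f N.m * Real.log N.m / (S.ε / 2) ^ 2 := by positivity
  have h3 : 100 * S.f N.m / (S.ε / 2) ^ 3 ≤ S.T := by linarith
  rw [div_le_iff₀ (by positivity)] at h3
  have h4 : (S.ε / 2) ^ 3 ≤ (S.ε / 2) ^ 2 :=
    pow_le_pow_of_le_one (by positivity) (by linarith [hS.ε_lt]) (by norm_num)
  have h5 : (S.T : ℝ) * (S.ε / 2) ^ 3 ≤ S.T * (S.ε / 2) ^ 2 := by gcongr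
  nlinarith

theorem mainLength_eq : S.mainLength = (1 - (S.ε / 2) ^ 2) * S.T + S.g N.m S.size := by
  unfold mainLength size
  rw [hS.f_mul_J]

theorem mainLength_le : S.mainLength ≤ S.T := by
  rw [hS.mainLength_eq]
  have := hS.g_size_le
  have h5 : 0 ≤ (S.ε / 2) ^ 2 * S.T := by positivity
  nlinarith

/-- The term f(m) J leaves ε'²T slots of the frame free. The two occurrences of g(m, mJ) and the
term f(m) of the clean-up take at most a quarter of them each. -/
theorem phases_le : ⌊S.mainLength⌋₊ + S.cleanLength ≤ S.T := by
  have h1 := hS.g_size_le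
  have h2 := hS.f_le
  have h5 : 0 ≤ (S.ε / 2) ^ 2 * S.T := by positivity
  have h6 : (S.ε / 2) ^ 2 * S.T ≤ 1 * S.T := by
    gcongr
    have := hS.ε_lt
    have := hS.ε_pos
    nlinarith
  have h3 : S.cleanLength = S.f N.m + S.g N.m S.size := by
    unfold cleanLength size; ring
  rcases le_total 0 S.mainLength with h | h
  · have h4 := Nat.floor_le h
    have h7 := hS.mainLength_eq
    linarith
  -- Nothing is assumed about the sign of g, so a negative length has to be excluded separately;
  -- there the floor is `0`.
  · rw [Nat.floor_of_nonpos h, h3]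
    simp only [Nat.cast_zero, zero_add]
    linarith

theorem le_maxDelay : 2 * ((N.D : ℝ) + S.w) / S.ε ≤ S.maxDelay := Nat.le_ceil _

theorem maxDelay_pos : 0 < S.maxDelay := by
  have := hS.le_maxDelay
  have hw : (0 : ℝ) < S.w := by exact_mod_cast hS.w_pos
  have he := hS.ε_pos
  have : (0 : ℝ) < S.maxDelay := lt_of_lt_of_le (by positivity) this
  exact_mod_cast this

theorem maxDelay_le : (S.maxDelay : ℝ) ≤ 2 * ((N.D : ℝ) + S.w) / S.ε + 1 := by
  have he := hS.ε_pos
  exact (Nat.ceil_lt_add_one (by positivity)).le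

/-- The span is `O(D w / ε)` frames. -/
theorem span_le : (S.span : ℝ) + 1 ≤ 7 * (N.D * S.w / S.ε) := by
  have h1 := hS.maxDelay_le
  have hw : (1 : ℝ) ≤ S.w := by exact_mod_cast hS.w_pos
  have hD : (1 : ℝ) ≤ N.D := by exact_mod_cast hS.D_pos
  have he := hS.ε_pos
  have h2 : (N.D : ℝ) + S.w ≤ 2 * (N.D * S.w) := by nlinarith
  have h3 : (N.D : ℝ) ≤ N.D * S.w := by nlinarith
  have h4 : (1 : ℝ) ≤ N.D * S.w := by nlinarith
  have h5 : ∀ x : ℝ, 0 ≤ x → x ≤ x / S.ε := fun x hx => by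
    rw [le_div_iff₀ he]; nlinarith [hS.ε_lt]
  have h6 := h5 (N.D * S.w) (by positivity)
  have h7 : 2 * ((N.D : ℝ) + S.w) / S.ε ≤ 4 * (N.D * S.w / S.ε) := by
    rw [mul_div_assoc', div_le_div_iff_of_pos_right he]
    linarith
  unfold span
  push_cast
  linarith

end Valid

end Protocol
end WirelessScheduling

/-! ### The conditional probability of a failure, given the delays -/

namespace WirelessScheduling

theorem one_sub_inv_pow_ge {m : ℕ} (hm : 1 ≤ m) {k : ℕ} (hk : k ≤ m - 1) :
    Real.exp (-1) ≤ (1 - (m : ℝ)⁻¹) ^ k := by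
  rcases Nat.lt_or_ge 1 m with h | h
  · have hm' : (1 : ℝ) < m := by exact_mod_cast h
    have h0 : 0 < (m : ℝ) - 1 := by linarith
    -- The inverse of 1 - 1/m is 1 + 1/(m - 1), which is at most exp(1/(m - 1)).
    have h1 : Real.exp (-(1 / ((m : ℝ) - 1))) ≤ 1 - (m : ℝ)⁻¹ := by
      rw [Real.exp_neg, inv_le_comm₀ (Real.exp_pos _)
        (by rw [sub_pos]; exact inv_lt_one_of_one_lt₀ hm')]
      have h2 := Real.add_one_le_exp (1 / ((m : ℝ) - 1))
      refine le_trans (le_of_eq ?_) h2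
      field_simp
      ring
    have h4 : Real.exp (-1) ≤ Real.exp (-(1 / ((m : ℝ) - 1))) ^ k := by
      rw [← Real.exp_nat_mul, Real.exp_le_exp]
      have h5 : (k : ℝ) ≤ (m : ℝ) - 1 := by
        have : (k : ℝ) ≤ ((m - 1 : ℕ) : ℝ) := by exact_mod_cast hk
        rwa [Nat.cast_sub hm, Nat.cast_one] at this
      have h6 : (k : ℝ) * (1 / ((m : ℝ) - 1)) ≤ 1 := by
        rw [mul_one_div, div_le_one h0]; exact h5
      linarith
    exact h4.trans (pow_le_pow_left₀ (Real.exp_pos _).le h1 k)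
  · have : k = 0 := by omega
    subst this
    simp only [pow_zero]
    exact Real.exp_le_one_iff.2 (by norm_num)

namespace Protocol

variable {V E : Type*} [Fintype E] {N : Network V E} (S : Protocol N) {P : Type}
  (A : Injection E P) (tie : (U : Finset P) → U.Nonempty → {p // p ∈ U})

instance : IsProbabilityMeasure N.coinLaw := by
  unfold Network.coinLaw; infer_instance

instance : IsProbabilityMeasure S.delayLaw := by
  unfold delayLaw; infer_instance

/-- All random choices but the delays. -/
abbrev Rest : Type _ := (ℕ × E → Bool) × (ℕ → S.alg.Seed) × (ℕ → S.alg.Seed)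

/-- The law of all random choices but the delays. -/
noncomputable def restLaw : Measure S.Rest :=
  (Measure.infinitePi (fun _ : ℕ × E => N.coinLaw)).prod
    ((Measure.infinitePi (fun _ : ℕ => S.alg.law)).prod
      (Measure.infinitePi (fun _ : ℕ => S.alg.law)))

instance : IsProbabilityMeasure S.restLaw := by
  unfold restLaw; infer_instance

theorem prob_eq : S.prob P = (Measure.infinitePi (fun _ : P => S.delayLaw)).prod S.restLaw := rfl

/-- Drawing the randomness of the first phase of frame `k` anew. -/
noncomputable def mainMix (k : ℕ) (z : S.Rest × S.Rest) : S.Rest :=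
  (z.1.1, mix {k} (z.1.2.1, z.2.2.1), z.1.2.2)

/-- Drawing the randomness of the clean-up phase of frame `k` anew. -/
noncomputable def cleanMix (k : ℕ) (z : S.Rest × S.Rest) : S.Rest :=
  (mix {i : ℕ × E | i.1 = k} (z.1.1, z.2.1), z.1.2.1, mix {k} (z.1.2.2, z.2.2.2))

theorem measurePreserving_mainMix (k : ℕ) :
    MeasurePreserving (S.mainMix k) (S.restLaw.prod S.restLaw) S.restLaw :=
  MeasurePreserving.prod_prod measurePreserving_fst
    (MeasurePreserving.prod_prod (measurePreserving_mix _ {k}) measurePreserving_fst)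

theorem measurePreserving_cleanMix (k : ℕ) :
    MeasurePreserving (S.cleanMix k) (S.restLaw.prod S.restLaw) S.restLaw :=
  MeasurePreserving.prod_prod (measurePreserving_mix _ {i : ℕ × E | i.1 = k})
    (MeasurePreserving.prod_prod measurePreserving_fst (measurePreserving_mix _ {k}))

theorem agree_mainMix (δ : P → ℕ) (k : ℕ) (z : S.Rest × S.Rest) :
    S.Agree k (δ, S.mainMix k z) (δ, z.1) :=
  ⟨rfl, fun i hi => ⟨fun _ => rfl,
    mix_of_notMem (by simpa using hi.ne), rfl⟩⟩

theorem agree_cleanMix (δ : P → ℕ) (k : ℕ) (z : S.Rest × S.Rest) :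
    S.Agree k (δ, S.cleanMix k z) (δ, z.1) :=
  ⟨rfl, fun i hi => ⟨fun _ => mix_of_notMem (by simpa using hi.ne), rfl,
    mix_of_notMem (by simpa using hi.ne)⟩⟩

theorem mid_cleanMix (δ : P → ℕ) (k : ℕ) (z : S.Rest × S.Rest) :
    S.mid A tie (δ, S.cleanMix k z) k = S.mid A tie (δ, z.1) k :=
  S.mid_congr A tie (S.agree_cleanMix δ k z) rfl

section Execute

open Classical in
/-- The guarantee of the static algorithm for the execution on the next links of the packets. -/
theorem law_execute_eq_none_le (h : S.alg.HasScheduleLength S.f S.g) {I n L : ℝ} (hn : 1 ≤ n)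
    (x : P → PacketState E) (U : Finset P)
    (hcard : ((U.filter (fun q => (x q).route ≠ [])).card : ℝ) ≤ n)
    (hint : N.interference (fun e => (U.filter fun q => (x q).route.head? = some e).card) ≤ I)
    (hL : L = S.f N.m * I + S.g N.m n) :
    S.alg.law {σ | ∃ p ∈ U, (x p).route ≠ [] ∧ S.execute I n L x U σ p = none} ≤
      ENNReal.ofReal (1 / (2 * n ^ 4)) := by
  set U' := U.filter (fun q => (x q).route ≠ []) with hU'
  set link : {q // q ∈ U'} → E := fun q => (x q).route.head (Finset.mem_filter.1 q.2).2 with hlink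
  have hcount : ∀ e, (Finset.univ.filter (fun q => link q = e)).card =
      (U.filter fun q => (x q).route.head? = some e).card := by
    intro e
    refine Finset.card_bij (fun q _ => q.1) ?_ ?_ ?_
    · intro q hq
      have hq2 := Finset.mem_filter.1 q.2
      rw [Finset.mem_filter] at hq ⊢
      refine ⟨hq2.1, ?_⟩
      rw [← hq.2, List.head?_eq_some_head hq2.2]
    · intro q _ q' _ hqq
      exact Subtype.ext hqq
    · intro q hq
      rw [Finset.mem_filter] at hq
      have hne : (x q).route ≠ [] := by
        intro h0; rw [h0] at hq; simp at hq
      refine ⟨⟨q, Finset.mem_filter.2 ⟨hq.1, hne⟩⟩, ?_, rfl⟩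
      rw [Finset.mem_filter]
      refine ⟨Finset.mem_univ _, ?_⟩
      have h2 := hq.2
      rw [List.head?_eq_some_head hne] at h2
      exact Option.some_injective _ h2
  have hs := h I n hn {q // q ∈ U'} link (by simpa using hcard) (by
    simp only [hcount]; exact hint)
  set G : Set S.alg.Seed := {σ | ∀ q, ∃ j : ℕ, S.alg.run I n link σ q = some j ∧
        (j : ℝ) + 1 ≤ S.f N.m * I + S.g N.m n} with hG
  have hGm : MeasurableSet G := by
    have : G = ⋂ q, ⋃ j : ℕ, {σ | S.alg.run I n link σ q = some j ∧
        (j : ℝ) + 1 ≤ S.f N.m * I + S.g N.m n} := by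
      ext σ; simp [hG]
    rw [this]
    refine MeasurableSet.iInter fun q => MeasurableSet.iUnion fun j => ?_
    exact (S.alg.measurableSet_run I n link q (some j)).inter (MeasurableSet.const _)
  -- Cutting the execution off after `L` slots does no harm, since `L` is exactly the guaranteed
  -- schedule length.
  have hsub : {σ | ∃ p ∈ U, (x p).route ≠ [] ∧ S.execute I n L x U σ p = none} ⊆ Gᶜ := by
    rintro σ ⟨p, hp, hr, he⟩ hσ
    have hp' : p ∈ U' := Finset.mem_filter.2 ⟨hp, hr⟩
    obtain ⟨j, hj, hjL⟩ := hσ ⟨p, hp'⟩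
    unfold execute at he
    rw [dif_pos hp', hj] at he
    rw [← hL] at hjL
    simp only [Option.filter_some, decide_eq_true hjL, if_true] at he
    exact absurd he (by simp)
  refine (measure_mono hsub).trans ?_
  rw [prob_compl_eq_one_sub hGm]
  rw [tsub_le_iff_right]
  have h2 : ENNReal.ofReal (1 - 1 / (2 * n ^ 4)) ≤ S.alg.law G := by
    rw [ENNReal.ofReal_le_iff_le_toReal (measure_ne_top _ _)]
    exact hs
  have h3 : (1 : ℝ≥0∞) = ENNReal.ofReal (1 / (2 * n ^ 4)) +
      ENNReal.ofReal (1 - 1 / (2 * n ^ 4)) := by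
    have h4 : (1 : ℝ) ≤ n ^ 4 := one_le_pow₀ hn
    rw [← ENNReal.ofReal_add (by positivity)
      (by rw [sub_nonneg, div_le_one (by positivity)]; linarith)]
    simp
  rw [h3]
  gcongr

end Execute

/-- If no packet ever fails, the interference in frame `k` exceeds `J`. -/
def Overload (δ : P → ℕ) (k : ℕ) : Prop :=
  ∃ e, S.J < ∑ e', N.W e e' * S.virtualLoad A δ k e'

open Classical in
/-- A bound on the conditional probability that a packet fails in frame `k`. -/
noncomputable def failBound (δ : P → ℕ) (k : ℕ) : ℝ≥0∞ :=
  (if S.Overload A δ k then 1 else 0) + ENNReal.ofReal (1 / (2 * S.size ^ 4))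

section Conditional

variable {S} (hS : S.Valid) (hpath : ∀ p, N.IsPath (A.path p))

include hS

theorem Valid.virtualCount_le {δ : P → ℕ} {k : ℕ} (h : ¬ S.Overload A δ k) :
    (S.virtualCount A δ k : ℝ) ≤ S.size := by
  unfold Overload at h
  push Not at h
  rw [S.virtualCount_eq_sum A k δ, Nat.cast_sum]
  calc ∑ e, (S.virtualLoad A δ k e : ℝ) ≤ ∑ e : E, S.J :=
        Finset.sum_le_sum fun e _ => (N.le_sum_W_mul _ e).trans (h e)
    _ = Fintype.card E * S.J := by simp
    _ ≤ N.m * S.J := by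
        have : (Fintype.card E : ℝ) ≤ N.m := by exact_mod_cast le_max_left _ _
        have := hS.le_J
        gcongr
    _ = S.size := rfl

include hpath

/-- Redrawing the seed of the first phase keeps the state before it, and thus the set of requests.
This set is dominated by the virtual process, so without an overload it satisfies both input
conditions of 𝒜(J, mJ). -/
theorem Valid.law_bad_le {δ : P → ℕ} (hδ : S.DelaysBounded δ) (k : ℕ)
    (h : ¬ S.Overload A δ k) (ρ : S.Rest) :
    S.restLaw {ρ' | S.Bad A tie k (δ, S.mainMix k (ρ, ρ'))} ≤
      ENNReal.ofReal (1 / (2 * S.size ^ 4)) := by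
  classical
  set x := S.state A tie (δ, ρ) k with hx
  set U := S.unfailed A (δ, ρ) k x with hU
  have hwin := fun p hp => S.mem_window_of_mem_unfailed A tie (δ, ρ) k p hS.T_pos hpath hδ hp
  have hexec := S.law_execute_eq_none_le (I := S.J) (n := S.size) (L := S.mainLength) hS.sched
    (by linarith [hS.le_size]) x U (by
      refine le_trans ?_ (hS.virtualCount_le A h)
      refine Nat.cast_le.2 (Finset.card_le_card fun p hp => ?_)
      rw [Finset.mem_filter] at hp ⊢
      refine ⟨(hwin p hp.1).1, ?_⟩
      rw [(hwin p hp.1).2]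
      simpa using hp.2) (by
      rw [N.interference_le_iff (by linarith [hS.le_J])]
      intro e
      unfold Overload at h
      push Not at h
      refine le_trans (Finset.sum_le_sum fun e' _ => ?_) (h e)
      refine mul_le_mul_of_nonneg_left ?_ (N.W_nonneg _ _)
      refine Nat.cast_le.2 (Finset.card_le_card fun p hp => ?_)
      rw [Finset.mem_filter] at hp ⊢
      refine ⟨(hwin p hp.1).1, ?_⟩
      rw [(hwin p hp.1).2]
      exact hp.2) rfl
  refine le_trans ?_ hexec
  have hmp : MeasurePreserving (fun ρ' : S.Rest => ρ'.2.1 k) S.restLaw S.alg.law :=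
    ((measurePreserving_eval_infinitePi _ k).comp measurePreserving_fst).comp measurePreserving_snd
  have hms : MeasurableSet {σ | ∃ p ∈ U, (x p).route ≠ [] ∧
      S.execute S.J S.size S.mainLength x U σ p = none} := by
    have : {σ | ∃ p ∈ U, (x p).route ≠ [] ∧
      S.execute S.J S.size S.mainLength x U σ p = none} = ⋃ p ∈ U, {σ | (x p).route ≠ [] ∧
        S.execute S.J S.size S.mainLength x U σ p = none} := by
      ext σ; simp only [Set.mem_ofPred_eq, Set.mem_iUnion, exists_prop]
    rw [this]
    refine Finset.measurableSet_biUnion _ fun p _ => (MeasurableSet.const _).inter ?_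
    exact (S.measurable_execute S.J S.size S.mainLength x U p) (t := {none}) trivial
  rw [← hmp.measure_preimage hms.nullMeasurableSet]
  refine measure_mono ?_
  rintro ρ' ⟨p, hp, hf⟩
  have h1 := S.mid_of_failsAt A tie _ k p hf
  have h2 : S.state A tie (δ, S.mainMix k (ρ, ρ')) k = x :=
    S.state_congr A tie (S.agree_mainMix δ k (ρ, ρ'))
  rw [h2] at h1
  have h3 : S.unfailed A (δ, S.mainMix k (ρ, ρ')) k x = U := rfl
  rw [h3] at h1
  have h4 : (S.mainMix k (ρ, ρ')).2.1 k = ρ'.2.1 k := mix_of_mem rfl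
  refine ⟨p, h1.1, ((S.mem_unfailed A _ k x p).1 h1.1).2.2.1, ?_⟩
  change S.execute S.J S.size S.mainLength x U (ρ'.2.1 k) p = none
  rw [← h4]
  exact h1.2.1

/-- The form in which the failure probability is used: `F` may be any quantity that does not depend
on the seed of the first phase of frame `k`, such as the queue at the beginning of this frame. In an
overloaded frame the bound is trivial. -/
theorem Valid.lintegral_mul_bad_le {δ : P → ℕ} (hδ : S.DelaysBounded δ) (k : ℕ)
    {F : S.Rest → ℝ≥0∞} (hF : Measurable F) (hFk : ∀ z, F (S.mainMix k z) = F z.1) :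
    ∫⁻ ρ, F ρ * {ρ | S.Bad A tie k (δ, ρ)}.indicator 1 ρ ∂S.restLaw ≤
      S.failBound A δ k * ∫⁻ ρ, F ρ ∂S.restLaw := by
  classical
  unfold failBound
  by_cases h : S.Overload A δ k
  · rw [if_pos h]
    calc _ ≤ ∫⁻ ρ, F ρ ∂S.restLaw := by
          refine lintegral_mono fun ρ => ?_
          refine mul_le_of_le_one_right zero_le ?_
          exact Set.indicator_le_self' (fun _ _ => zero_le_one) _
      _ = 1 * ∫⁻ ρ, F ρ ∂S.restLaw := (one_mul _).symm
      _ ≤ _ := by gcongr; exact le_self_add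
  · rw [if_neg h, zero_add]
    exact lintegral_mul_indicator_le (S.measurePreserving_mainMix k) hF
      (measurable_prodMk_left (S.measurableSet_bad A tie k)) hFk
      (hS.law_bad_le A tie hpath hδ k h)

end Conditional

end Protocol
end WirelessScheduling

/-! ### The conditional probability of a successful clean-up -/

namespace WirelessScheduling
namespace Protocol

variable {V E : Type*} [Fintype E] {N : Network V E} {S : Protocol N} {P : Type}
  (A : Injection E P) (tie : (U : Finset P) → U.Nonempty → {p // p ∈ U})

theorem coinLaw_true : N.coinLaw {true} = ENNReal.ofReal ((N.m : ℝ)⁻¹) := by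
  classical
  rw [Network.coinLaw, ProbabilityTheory.bernoulliMeasure_apply _ (measurableSet_singleton _)]
  simp [ENNReal.ofReal, Real.toNNReal]
  rfl

theorem coinLaw_false : N.coinLaw {false} = ENNReal.ofReal (1 - (N.m : ℝ)⁻¹) := by
  have h : ({false} : Set Bool) = {true}ᶜ := by ext b; cases b <;> simp
  rw [h, prob_compl_eq_one_sub (measurableSet_singleton _), coinLaw_true,
    ENNReal.ofReal_sub _ (by positivity), ENNReal.ofReal_one]

section

variable (hS : S.Valid)

include hS

/-- With probability at least `1 / (e m)`, the coin of `e` is the only one in frame `k` that shows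
`true`. -/
theorem Valid.le_law_coins (k : ℕ) (e : E) :
    ENNReal.ofReal ((N.m : ℝ)⁻¹ * Real.exp (-1)) ≤
      Measure.infinitePi (fun _ : ℕ × E => N.coinLaw)
        {c | c (k, e) = true ∧ ∀ e', e' ≠ e → c (k, e') = false} := by
  classical
  set t : ℕ × E → Set Bool := fun i => if i.2 = e then {true} else {false} with ht
  set s : Finset (ℕ × E) := Finset.univ.image (fun e' => (k, e')) with hs
  have hset : {c : ℕ × E → Bool | c (k, e) = true ∧ ∀ e', e' ≠ e → c (k, e') = false} =
      Set.pi s t := by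
    ext c
    simp only [Set.mem_ofPred_eq, Set.mem_pi, hs, ht, Finset.coe_image, Finset.coe_univ,
      Set.image_univ, Set.mem_range, forall_exists_index, forall_apply_eq_imp_iff]
    constructor
    · rintro ⟨h1, h2⟩ e'
      by_cases he : e' = e
      · subst he; simpa using h1
      · simpa [he] using h2 e' he
    · intro h
      refine ⟨by simpa using h e, fun e' he => by simpa [he] using h e'⟩
  rw [hset, Measure.infinitePi_pi _ fun i _ => (Set.to_countable _).measurableSet, hs,
    Finset.prod_image (by intro a _ b _ hab; simpa using hab),
    ← Finset.mul_prod_erase _ _ (Finset.mem_univ e)]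
  have h1 : ∀ e' ∈ Finset.univ.erase e, N.coinLaw (t (k, e')) =
      ENNReal.ofReal (1 - (N.m : ℝ)⁻¹) := by
    intro e' he'
    simp only [ht, Finset.ne_of_mem_erase he', if_false, coinLaw_false]
  rw [Finset.prod_congr rfl h1, Finset.prod_const]
  simp only [ht, if_true, coinLaw_true]
  have h0 : 0 ≤ 1 - (N.m : ℝ)⁻¹ := sub_nonneg.2 (inv_le_one_of_one_le₀ hS.one_le_m)
  rw [← ENNReal.ofReal_pow h0, ← ENNReal.ofReal_mul (by positivity)]
  refine ENNReal.ofReal_le_ofReal (mul_le_mul_of_nonneg_left ?_ (by positivity))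
  refine one_sub_inv_pow_ge hS.m_pos ?_
  rw [Finset.card_erase_of_mem (Finset.mem_univ _), Finset.card_univ]
  exact Nat.sub_le_sub_right (le_max_left _ _) 1

theorem Valid.one_sub_ge : (99 / 100 : ℝ) ≤ 1 - 1 / (2 * S.size ^ 4) := by
  have h1 := hS.le_size
  have h2 : (400 : ℝ) ^ 4 ≤ S.size ^ 4 := by gcongr
  have h3 : 1 / (2 * S.size ^ 4) ≤ 1 / (2 * 400 ^ 4) := by
    gcongr
  norm_num at h3 ⊢
  linarith

/-- Let `e` be the next link of a failed packet `p` whose failure is longest ago among all links. If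
only the coin of `e` shows `true`, the sole request is a packet `u` of this buffer that failed as
early as `p`. One request has interference at most 1 because the entries of W are at most 1, so 𝒜(1,
mJ) serves it up to its error probability. -/
theorem Valid.le_law_success (δ : P → ℕ) (k : ℕ) (ρ : S.Rest) :
    ENNReal.ofReal (1 / (4 * N.m)) ≤
      S.restLaw {ρ' | S.Success A tie k (δ, S.cleanMix k (ρ, ρ'))} := by
  classical
  set U := A.injectedIn 0 (k * S.T) with hU
  set x := S.mid A tie (δ, ρ) k with hx
  have hm := hS.one_le_m
  have hmid : ∀ ρ', S.mid A tie (δ, S.cleanMix k (ρ, ρ')) k = x :=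
    fun ρ' => S.mid_cleanMix A tie δ k (ρ, ρ')
  by_cases h : ∀ q ∈ U, (x q).failFrame = ⊤ ∨ (x q).route = []
  · have : {ρ' | S.Success A tie k (δ, S.cleanMix k (ρ, ρ'))} = Set.univ := by
      refine Set.eq_univ_of_forall fun ρ' => Or.inl ?_
      rw [hmid]
      exact h
    rw [this, measure_univ, ← ENNReal.ofReal_one]
    refine ENNReal.ofReal_le_ofReal ?_
    rw [div_le_one (by positivity)]
    linarith
  push Not at h
  obtain ⟨q, hq, hq1, hq2⟩ := h
  obtain ⟨p, hp, hmin⟩ := Finset.exists_min_image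
    (U.filter fun q => (x q).failFrame ≠ ⊤ ∧ (x q).route ≠ []) (fun q => (x q).failFrame)
    ⟨q, Finset.mem_filter.2 ⟨hq, hq1, hq2⟩⟩
  rw [Finset.mem_filter] at hp
  obtain ⟨hpU, hp1, hp2⟩ := hp
  set e := (x p).route.head hp2 with he
  have hpb : p ∈ S.buffer A k x e :=
    (S.mem_buffer A k x p e).2 ⟨hpU, hp1, List.head?_eq_some_head hp2⟩
  have hbmin : ∀ q ∈ S.buffer A k x e, (x p).failFrame ≤ (x q).failFrame := by
    intro q hq
    rw [mem_buffer] at hq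
    refine hmin q (Finset.mem_filter.2 ⟨hq.1, hq.2.1, fun h0 => ?_⟩)
    rw [h0] at hq
    simp at hq
  have hne : (S.oldest A k x e).Nonempty := ⟨p, (S.mem_oldest A k x p e).2 ⟨hpb, hbmin⟩⟩
  set u : P := (tie (S.oldest A k x e) hne).1 with hu
  have hu1 : u ∈ S.oldest A k x e := (tie (S.oldest A k x e) hne).2
  rw [mem_oldest] at hu1
  have hu2 := (S.mem_buffer A k x u e).1 hu1.1
  have hur : (x u).route ≠ [] := by
    intro h0
    have := hu2.2.2
    rw [h0] at this
    simp at this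
  have hexec := S.law_execute_eq_none_le (I := 1) (n := S.size) (L := S.cleanLength) hS.sched
    (by linarith [hS.le_size]) x {u} (by
      refine le_trans (Nat.cast_le.2 (Finset.card_filter_le _ _)) ?_
      simp only [Finset.card_singleton, Nat.cast_one]
      linarith [hS.le_size]) (by
      rw [N.interference_le_iff zero_le_one]
      intro e'
      have hcnt : ∀ e'', (({u} : Finset P).filter fun q => (x q).route.head? = some e'').card =
          if e'' = e then 1 else 0 := by
        intro e''
        rw [Finset.filter_singleton, hu2.2.2]
        by_cases hee : e'' = e
        · simp [hee]
        · simp [hee, Ne.symm hee]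
      simp only [hcnt]
      simp only [Nat.cast_ite, Nat.cast_one, Nat.cast_zero, mul_ite, mul_one, mul_zero,
        Finset.sum_ite_eq', Finset.mem_univ, if_true]
      exact N.W_le_one _ _) rfl
  set G : Set S.alg.Seed := {σ | ∃ p ∈ ({u} : Finset P), (x p).route ≠ [] ∧
    S.execute 1 S.size S.cleanLength x {u} σ p = none} with hG
  have hGeq : G = {σ | S.execute 1 S.size S.cleanLength x {u} σ u = none} := by
    ext σ; simp [hG, hur]
  have hGm : MeasurableSet G := by
    rw [hGeq]
    exact (S.measurable_execute 1 S.size S.cleanLength x {u} u) (t := {none}) trivial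
  set C : Set (ℕ × E → Bool) :=
    {c | c (k, e) = true ∧ ∀ e', e' ≠ e → c (k, e') = false} with hC
  have hsub : C ×ˢ (Set.univ ×ˢ {s : ℕ → S.alg.Seed | s k ∈ Gᶜ}) ⊆
      {ρ' | S.Success A tie k (δ, S.cleanMix k (ρ, ρ'))} := by
    rintro ρ' ⟨⟨hc1, hc2⟩, -, hs⟩
    right
    rw [hmid]
    refine ⟨u, hu2.1, hu2.2.1, ?_, ?_⟩
    · intro q' hq' h1 h2
      exact (hu1.2 p hpb).trans (hmin q' (Finset.mem_filter.2 ⟨hq', h1, h2⟩))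
    · rw [state_succ, hmid]
      have hsel : S.selected A tie (δ, S.cleanMix k (ρ, ρ')) k x = {u} := by
        ext q
        have hcoin : ∀ e', (S.cleanMix k (ρ, ρ')).1 (k, e') = ρ'.1 (k, e') :=
          fun e' => mix_of_mem rfl
        rw [mem_selected, Finset.mem_singleton]
        simp only [hcoin]
        constructor
        · rintro ⟨e', he', hne', rfl⟩
          by_cases hee : e' = e
          · subst hee; rfl
          · rw [hc2 e' hee] at he'
            exact absurd he' (by simp)
        · intro hq
          exact ⟨e, hc1, hne, hq⟩
      have hseed : (S.cleanMix k (ρ, ρ')).2.2 k = ρ'.2.2 k := mix_of_mem rfl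
      have hs' : S.execute 1 S.size S.cleanLength x {u} (ρ'.2.2 k) u ≠ none := by
        have : ρ'.2.2 k ∉ G := hs
        rwa [hGeq] at this
      obtain ⟨j, hj⟩ := Option.ne_none_iff_exists'.1 hs'
      have hj' : S.execute 1 (N.m * S.J) S.cleanLength x
          (S.selected A tie (δ, S.cleanMix k (ρ, ρ')) k x)
          ((δ, S.cleanMix k (ρ, ρ')).2.2.2 k) u = some j := by
        rw [hsel]
        change S.execute 1 S.size S.cleanLength x {u} ((S.cleanMix k (ρ, ρ')).2.2 k) u = some j
        rw [hseed]
        exact hj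
      unfold cleanPhase
      rw [hj']
      simp only [PacketState.cross, List.length_tail]
      have := List.length_pos_of_ne_nil hur
      omega
  refine le_trans ?_ (measure_mono hsub)
  rw [restLaw, Measure.prod_prod, Measure.prod_prod, measure_univ, one_mul]
  have hseedlaw : ENNReal.ofReal (99 / 100) ≤
      Measure.infinitePi (fun _ : ℕ => S.alg.law) {s : ℕ → S.alg.Seed | s k ∈ Gᶜ} := by
    have h1 := (measurePreserving_eval_infinitePi (fun _ : ℕ => S.alg.law) k).measure_preimage
      hGm.compl.nullMeasurableSet
    have h2 : {s : ℕ → S.alg.Seed | s k ∈ Gᶜ} = Function.eval k ⁻¹' Gᶜ := rfl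
    rw [h2, h1, prob_compl_eq_one_sub hGm]
    refine le_trans ?_ (tsub_le_tsub_left hexec 1)
    rw [← ENNReal.ofReal_one, ← ENNReal.ofReal_sub _ (by positivity)]
    exact ENNReal.ofReal_le_ofReal hS.one_sub_ge
  refine le_trans ?_ (mul_le_mul' (hS.le_law_coins k e) hseedlaw)
  rw [← ENNReal.ofReal_mul (by positivity)]
  refine ENNReal.ofReal_le_ofReal ?_
  -- The constant 1/4 leaves room, as 0.36 · 0.99 > 1/4.
  have hexp : (0.36 : ℝ) ≤ Real.exp (-1) := by
    have := Real.exp_neg_one_gt_d9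
    linarith
  rw [one_div, mul_inv, mul_comm (4 : ℝ)⁻¹, mul_assoc]
  refine mul_le_mul_of_nonneg_left ?_ (by positivity)
  nlinarith

variable {F : S.Rest → ℝ≥0∞} (hF : Measurable F)

include hF

theorem Valid.le_lintegral_mul_success (δ : P → ℕ) (k : ℕ)
    (hFk : ∀ z, F (S.cleanMix k z) = F z.1) :
    ENNReal.ofReal (1 / (4 * N.m)) * ∫⁻ ρ, F ρ ∂S.restLaw ≤
      ∫⁻ ρ, F ρ * {ρ | S.Success A tie k (δ, ρ)}.indicator 1 ρ ∂S.restLaw :=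
  le_lintegral_mul_indicator (S.measurePreserving_cleanMix k) hF
    (measurable_prodMk_left (S.measurableSet_success A tie k)) hFk
    (hS.le_law_success A tie δ k)

theorem Valid.lintegral_mul_not_success_le (δ : P → ℕ) (k : ℕ)
    (hFk : ∀ z, F (S.cleanMix k z) = F z.1) :
    ∫⁻ ρ, F ρ * {ρ | S.Success A tie k (δ, ρ)}ᶜ.indicator 1 ρ ∂S.restLaw ≤
      ENNReal.ofReal (1 - 1 / (4 * N.m)) * ∫⁻ ρ, F ρ ∂S.restLaw := by
  have hms : MeasurableSet {ρ | S.Success A tie k (δ, ρ)} :=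
    measurable_prodMk_left (S.measurableSet_success A tie k)
  refine lintegral_mul_indicator_le (S.measurePreserving_cleanMix k) hF hms.compl hFk fun ρ => ?_
  change S.restLaw ({ρ' | S.Success A tie k (δ, S.cleanMix k (ρ, ρ'))}ᶜ) ≤ _
  have h2 : MeasurableSet {ρ' | S.Success A tie k (δ, S.cleanMix k (ρ, ρ'))} :=
    ((S.measurePreserving_cleanMix k).measurable.comp measurable_prodMk_left) hms
  rw [prob_compl_eq_one_sub h2, ENNReal.ofReal_sub _ (by positivity), ENNReal.ofReal_one]
  exact tsub_le_tsub_left (hS.le_law_success A tie δ k ρ) 1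

end

end Protocol
end WirelessScheduling

/-! ### Reflected processes and the queue of failed packets, given the delays -/

namespace WirelessScheduling

section Reflection

/-- The solution of `u (k + 1) = u k * a k + b k`, `u 0 = 0`. -/
noncomputable def affineRec (a b : ℕ → ℝ≥0∞) : ℕ → ℝ≥0∞
  | 0 => 0
  | k + 1 => affineRec a b k * a k + b k

theorem affineRec_mono {a b a' b' : ℕ → ℝ≥0∞} (ha : ∀ k, a k ≤ a' k) (hb : ∀ k, b k ≤ b' k)
    (k : ℕ) : affineRec a b k ≤ affineRec a' b' k := by
  induction k with
  | zero => exact le_rfl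
  | succ k ih => exact add_le_add (mul_le_mul' ih (ha k)) (hb k)

theorem affineRec_congr {a b a' b' : ℕ → ℝ≥0∞} {k : ℕ} (h : ∀ j < k, a j = a' j ∧ b j = b' j) :
    affineRec a b k = affineRec a' b' k := by
  induction k with
  | zero => rfl
  | succ k ih =>
    simp only [affineRec]
    rw [ih fun j hj => h j (by omega), (h k (by omega)).1, (h k (by omega)).2]

theorem measurable_affineRec {Ω : Type*} [MeasurableSpace Ω] {a b : ℕ → Ω → ℝ≥0∞}
    (ha : ∀ k, Measurable (a k)) (hb : ∀ k, Measurable (b k)) (k : ℕ) :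
    Measurable fun ω => affineRec (fun j => a j ω) (fun j => b j ω) k := by
  induction k with
  | zero => exact measurable_const
  | succ k ih => exact (ih.mul (ha k)).add (hb k)

/-- The process with increments `y`, reflected at `0`. -/
noncomputable def reflected (y : ℕ → ℝ) : ℕ → ℝ
  | 0 => 0
  | k + 1 => max 0 (reflected y k + y k)

theorem reflected_nonneg (y : ℕ → ℝ) (k : ℕ) : 0 ≤ reflected y k := by
  cases k
  · exact le_rfl
  · exact le_max_left _ _

theorem add_le_reflected_succ (y : ℕ → ℝ) (k : ℕ) : reflected y k + y k ≤ reflected y (k + 1) :=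
  le_max_right _ _

/-- Without reflection this is e^{θ(x+y)} - 1 = (e^{θx} - 1) e^{θy} + (e^{θy} - 1). Subtracting 1
matters: the additive term, whose negative part `ENNReal.ofReal` removes, vanishes for nonpositive
increments. So for the arrivals only frames with a failure contribute to it. -/
theorem exp_reflected_le {θ : ℝ} (hθ : 0 ≤ θ) (y : ℕ → ℝ) (k : ℕ) :
    ENNReal.ofReal (Real.exp (θ * reflected y k) - 1) ≤
      affineRec (fun j => ENNReal.ofReal (Real.exp (θ * y j)))
        (fun j => ENNReal.ofReal (Real.exp (θ * y j) - 1)) k := by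
  induction k with
  | zero => simp [reflected, affineRec]
  | succ k ih =>
    simp only [affineRec, reflected]
    set x := reflected y k with hx
    have hx0 : 0 ≤ x := reflected_nonneg y k
    rcases le_total 0 (x + y k) with h | h
    · rw [max_eq_right h]
      have h1 : Real.exp (θ * (x + y k)) - 1 =
          (Real.exp (θ * x) - 1) * Real.exp (θ * y k) + (Real.exp (θ * y k) - 1) := by
        rw [mul_add, Real.exp_add]; ring
      rw [h1]
      refine ENNReal.ofReal_add_le.trans ?_
      rw [ENNReal.ofReal_mul (sub_nonneg.2 (Real.one_le_exp (by positivity)))]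
      gcongr
    · rw [max_eq_left h]
      simp

/-- A queue with arrivals `X` and services `s` is bounded by the sum of a reflected process for the
services and of reflected processes for the arrivals in each residue class of times. -/
theorem queue_le_reflected {φ X s : ℕ → ℕ} (h0 : φ 0 = 0) (h : ∀ k, φ (k + 1) ≤ φ k + X k - s k)
    {c : ℝ} {L : ℕ} (hL : 0 < L) (k : ℕ) :
    (φ k : ℝ) ≤ reflected (fun j => c - s j) k +
      ∑ r ∈ Finset.range L, reflected (fun j => if j % L = r then (X j : ℝ) - c else 0) k := by
  induction k with
  | zero => simp [h0, reflected]
  | succ k ih =>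
    -- If the service does not exceed the available work, one step of the services adds `c - s k`,
    -- the class of `k` adds `X k - c`, and the other classes stand still. Otherwise truncated
    -- subtraction empties the queue.
    by_cases hs : s k ≤ φ k + X k
    · have h1 : (φ (k + 1) : ℝ) ≤ φ k + X k - s k := by
        have : φ (k + 1) + s k ≤ φ k + X k := by have := h k; omega
        have : (φ (k + 1) : ℝ) + s k ≤ φ k + X k := by exact_mod_cast this
        linarith
      have h2 := add_le_reflected_succ (fun j => c - s j) k
      have h3 := Finset.sum_le_sum fun r (_ : r ∈ Finset.range L) =>
        add_le_reflected_succ (fun j => if j % L = r then (X j : ℝ) - c else 0) k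
      rw [Finset.sum_add_distrib, Finset.sum_ite_eq,
        if_pos (Finset.mem_range.2 (Nat.mod_lt k hL))] at h3
      linarith
    · have h1 : φ (k + 1) = 0 := by have := h k; omega
      rw [h1, Nat.cast_zero]
      exact add_nonneg (reflected_nonneg _ _) (Finset.sum_nonneg fun r _ => reflected_nonneg _ _)

/-- Passes from exponential to first moments by θx ≤ e^{θx} - 1. -/
theorem ofReal_reflected_le {θ : ℝ} (hθ : 0 < θ) {y : ℕ → ℝ} {k : ℕ} {a b : ℕ → ℝ≥0∞}
    (ha : ∀ j, ENNReal.ofReal (Real.exp (θ * y j)) ≤ a j)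
    (hb : ∀ j, ENNReal.ofReal (Real.exp (θ * y j) - 1) ≤ b j) :
    ENNReal.ofReal (reflected y k) ≤ ENNReal.ofReal (1 / θ) * affineRec a b k := by
  have h1 : reflected y k ≤ 1 / θ * (Real.exp (θ * reflected y k) - 1) := by
    have := Real.add_one_le_exp (θ * reflected y k)
    rw [one_div, ← div_eq_inv_mul, le_div_iff₀ hθ]
    linarith
  refine (ENNReal.ofReal_le_ofReal h1).trans ?_
  rw [ENNReal.ofReal_mul (by positivity)]
  gcongr
  exact (exp_reflected_le hθ.le y k).trans (affineRec_mono ha hb k)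

end Reflection

namespace Protocol

variable {V E : Type*} [Fintype E] {N : Network V E} (S : Protocol N) {P : Type}
  (A : Injection E P) (tie : (U : Finset P) → U.Nonempty → {p // p ∈ U})

theorem Agree.mono {S : Protocol N} {j k : ℕ} {ω ω' : S.Sample P} (h : S.Agree k ω ω')
    (hj : j ≤ k) : S.Agree j ω ω' := ⟨h.1, fun i hi => h.2 i (by omega)⟩

theorem bad_congr {j k : ℕ} {ω ω' : S.Sample P} (h : S.Agree k ω ω') (hj : j < k) :
    S.Bad A tie j ω ↔ S.Bad A tie j ω' := by
  unfold Bad FailsAt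
  rw [S.state_congr A tie (h.mono hj.le), S.mid_congr A tie (h.mono hj.le) (h.2 j hj).2.1]

theorem success_congr {j k : ℕ} {ω ω' : S.Sample P} (h : S.Agree k ω ω') (hj : j < k) :
    S.Success A tie j ω ↔ S.Success A tie j ω' := by
  unfold Success
  rw [S.state_congr A tie (h.mono (Nat.succ_le_of_lt hj)),
    S.mid_congr A tie (h.mono hj.le) (h.2 j hj).2.1]

/-- Half of the probability with which a clean-up is successful. -/
noncomputable def drift : ℝ := 1 / (8 * N.m)

/-- The exponent used for the exponential moments of the queue of failed packets. -/
noncomputable def tilt : ℝ := 1 / (2 * N.m * S.size)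

/-- The exponential of the work of the packets that can fail in frame `k`. -/
noncomputable def jump (δ : P → ℕ) (k : ℕ) : ℝ≥0∞ :=
  ENNReal.ofReal (Real.exp (S.tilt * (N.D * S.virtualCount A δ k)))

/-- Dominates the part of the queue that is due to unsuccessful clean-ups. -/
noncomputable def serviceRec (ω : S.Sample P) : ℕ → ℝ≥0∞ :=
  affineRec (fun j => ENNReal.ofReal (Real.exp (drift (N := N) - 1)) +
      ENNReal.ofReal (Real.exp (drift (N := N)) - Real.exp (drift (N := N) - 1)) *
        {ω | S.Success A tie j ω}ᶜ.indicator 1 ω)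
    (fun _ => ENNReal.ofReal (Real.exp (drift (N := N)) - 1))

/-- Dominates the part of the queue that is due to failures in the frames congruent to `r`. -/
noncomputable def arrivalRec (r : ℕ) (ω : S.Sample P) : ℕ → ℝ≥0∞ :=
  affineRec (fun j => if j % S.span = r then ENNReal.ofReal (Real.exp (-(S.tilt * drift (N := N)))) +
      S.jump A ω.1 j * {ω | S.Bad A tie j ω}.indicator 1 ω else 1)
    (fun j => if j % S.span = r then S.jump A ω.1 j * {ω | S.Bad A tie j ω}.indicator 1 ω else 0)

/-- The conditional expectation of `arrivalRec`, given the delays, is at most `delayRec`. -/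
noncomputable def delayRec (r : ℕ) (δ : P → ℕ) : ℕ → ℝ≥0∞ :=
  affineRec (fun j => if j % S.span = r then ENNReal.ofReal (Real.exp (-(S.tilt * drift (N := N)))) +
      S.jump A δ j * S.failBound A δ j else 1)
    (fun j => if j % S.span = r then S.jump A δ j * S.failBound A δ j else 0)

/-- The queue of failed packets at the beginning of frame `k`. -/
noncomputable def backlog (k : ℕ) (ω : S.Sample P) : ℕ :=
  work ⊤ (A.injectedIn 0 (k * S.T)) (S.state A tie ω k)

/-- The queue of failed packets after the first phase of frame `k`. -/
noncomputable def midBacklog (k : ℕ) (ω : S.Sample P) : ℕ :=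
  work ⊤ (A.injectedIn 0 (k * S.T)) (S.mid A tie ω k)

section

variable {S} (hS : S.Valid)

include hS

theorem Valid.tilt_pos : 0 < S.tilt := by
  have := hS.one_le_m
  have := hS.le_size
  unfold tilt
  positivity

theorem Valid.span_pos : 0 < S.span := Nat.add_pos_left hS.D_pos _

theorem Valid.drift_pos : 0 < drift (N := N) := by
  have := hS.one_le_m
  unfold drift
  positivity

theorem Valid.drift_le : drift (N := N) ≤ 1 / 8 := by
  have := hS.one_le_m
  unfold drift
  rw [div_le_div_iff_of_pos_left] <;> linarith

variable (hpath : ∀ p, N.IsPath (A.path p))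

include hpath

theorem Valid.backlog_le {ω : S.Sample P} (hδ : S.DelaysBounded ω.1) (k : ℕ) :
    (S.backlog A tie k ω : ℝ≥0∞) ≤ S.serviceRec A tie ω k +
      ENNReal.ofReal (1 / S.tilt) * ∑ r ∈ Finset.range S.span, S.arrivalRec A tie r ω k := by
  classical
  set X : ℕ → ℕ := fun j => if S.Bad A tie j ω then N.D * S.virtualCount A ω.1 j else 0 with hX
  set s : ℕ → ℕ := fun j => if S.Success A tie j ω then 1 else 0 with hs
  have hrec : ∀ j, S.backlog A tie (j + 1) ω ≤ S.backlog A tie j ω + X j - s j := fun j =>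
    (S.work_succ_le_sub A tie ω j).trans
      (Nat.sub_le_sub_right (S.work_mid_le A tie ω j hS.T_pos hpath hδ) _)
  have h0 : S.backlog A tie 0 ω = 0 := by
    unfold backlog work
    simp [state]
  have h1 := queue_le_reflected (φ := fun j => S.backlog A tie j ω) h0 hrec
    (c := drift (N := N)) hS.span_pos k
  have h2 : (S.backlog A tie k ω : ℝ≥0∞) ≤
      ENNReal.ofReal (reflected (fun j => drift (N := N) - s j) k) +
      ∑ r ∈ Finset.range S.span, ENNReal.ofReal
        (reflected (fun j => if j % S.span = r then (X j : ℝ) - drift (N := N) else 0) k) := by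
    rw [← ENNReal.ofReal_natCast,
      ← ENNReal.ofReal_sum_of_nonneg fun r _ => reflected_nonneg _ _,
      ← ENNReal.ofReal_add (reflected_nonneg _ _)
        (Finset.sum_nonneg fun r _ => reflected_nonneg _ _)]
    exact ENNReal.ofReal_le_ofReal h1
  refine h2.trans (add_le_add ?_ ?_)
  · have hc := hS.drift_pos
    rw [← one_mul (S.serviceRec A tie ω k), ← ENNReal.ofReal_one]
    -- The increments of the services are bounded by 1 in absolute value, so the exponent 1
    -- suffices; the small exponent `tilt` is reserved for the arrivals.
    have h3 := ofReal_reflected_le one_pos (y := fun j => drift (N := N) - s j) (k := k)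
      (a := fun j => ENNReal.ofReal (Real.exp (drift (N := N) - 1)) +
        ENNReal.ofReal (Real.exp (drift (N := N)) - Real.exp (drift (N := N) - 1)) *
        {ω | S.Success A tie j ω}ᶜ.indicator 1 ω)
      (b := fun _ => ENNReal.ofReal (Real.exp (drift (N := N)) - 1)) ?_ ?_
    · rw [div_one] at h3; exact h3
    · intro j
      rw [one_mul]
      by_cases hj : S.Success A tie j ω
      · simp [hs, hj]
      · simp only [hs, hj, if_false, Nat.cast_zero, sub_zero, Set.indicator, Set.mem_compl_iff,
          Set.mem_ofPred_eq, not_false_eq_true, if_true, Pi.one_apply, mul_one]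
        rw [← ENNReal.ofReal_add (Real.exp_pos _).le
          (sub_nonneg.2 (Real.exp_le_exp.2 (by linarith)))]
        simp
    · intro j
      rw [one_mul]
      refine ENNReal.ofReal_le_ofReal (sub_le_sub_right (Real.exp_le_exp.2 ?_) _)
      linarith [(Nat.cast_nonneg (s j) : (0 : ℝ) ≤ s j)]
  · rw [Finset.mul_sum]
    have hθ := hS.tilt_pos
    have hc := hS.drift_pos
    -- In its own class a frame contributes the factor e^{-θc} if nothing fails and at most `jump`
    -- otherwise; the sum of both bounds is used.
    refine Finset.sum_le_sum fun r _ => ofReal_reflected_le hθ (fun j => ?_) fun j => ?_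
    · by_cases hr : j % S.span = r
      · simp only [hr, if_true]
        by_cases hj : S.Bad A tie j ω
        · refine le_trans ?_ le_add_self
          simp only [hX, hj, if_true, Set.indicator, Set.mem_ofPred_eq, Pi.one_apply, mul_one, jump]
          refine ENNReal.ofReal_le_ofReal (Real.exp_le_exp.2 (mul_le_mul_of_nonneg_left ?_ hθ.le))
          push_cast
          linarith
        · simp [hX, hj]
      · simp [hr]
    · by_cases hr : j % S.span = r
      · simp only [hr, if_true]
        by_cases hj : S.Bad A tie j ω
        · simp only [hX, hj, if_true, Set.indicator, Set.mem_ofPred_eq, Pi.one_apply, mul_one, jump]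
          refine ENNReal.ofReal_le_ofReal ((sub_le_self _ zero_le_one).trans
            (Real.exp_le_exp.2 (mul_le_mul_of_nonneg_left ?_ hθ.le)))
          push_cast
          linarith
        · have : Real.exp (-(S.tilt * drift (N := N))) - 1 ≤ 0 :=
            sub_nonpos.2 (Real.exp_le_one_iff.2 (by nlinarith))
          simp [hX, hj, ENNReal.ofReal_of_nonpos this]
      · simp [hr]

omit hpath

/-- The mean factor of the service recursion. With c the drift and failure probability at most 1 -
2c it is e^c (1 - 2c(1 - 1/e)), roughly 1 - 0.26c, since a success is twice as likely as the drift
requires. -/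
theorem Valid.exp_drift_mul_le : Real.exp (drift (N := N) - 1) +
    (Real.exp (drift (N := N)) - Real.exp (drift (N := N) - 1)) * (1 - 1 / (4 * N.m)) ≤
      1 - drift (N := N) / 5 := by
  have hc := hS.drift_pos
  have hc1 := hS.drift_le
  have hm := hS.one_le_m
  set c := drift (N := N) with hcdef
  have h4 : (1 : ℝ) / (4 * N.m) = 2 * c := by
    rw [hcdef]; unfold drift; field_simp; norm_num
  rw [h4, sub_eq_add_neg c 1, Real.exp_add]
  have he := Real.exp_neg_one_lt_d9
  have hec : Real.exp c ≤ 1 + c + c ^ 2 := by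
    have := Real.abs_exp_sub_one_sub_id_le (x := c) (by rw [abs_of_pos hc]; linarith)
    have := (abs_le.1 this).2
    linarith
  have h5 : Real.exp c * Real.exp (-1) + (Real.exp c - Real.exp c * Real.exp (-1)) * (1 - 2 * c) =
      Real.exp c * (1 - 2 * c * (1 - Real.exp (-1))) := by ring
  rw [h5]
  have h6 : 1 - 2 * c * (1 - Real.exp (-1)) ≤ 1 - 2 * c * 0.63 := by nlinarith
  have h7 : (0 : ℝ) ≤ 1 - 2 * c * 0.63 := by nlinarith
  calc _ ≤ Real.exp c * (1 - 2 * c * 0.63) := mul_le_mul_of_nonneg_left h6 (Real.exp_pos c).le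
    _ ≤ (1 + c + c ^ 2) * (1 - 2 * c * 0.63) := mul_le_mul_of_nonneg_right hec h7
    _ ≤ _ := by nlinarith [mul_pos hc hc, mul_pos (mul_pos hc hc) hc]

theorem Valid.exp_drift_sub_one_le : Real.exp (drift (N := N)) - 1 ≤ 6 / 5 * drift (N := N) := by
  have hc := hS.drift_pos
  have hc1 := hS.drift_le
  have := Real.abs_exp_sub_one_sub_id_le (x := drift (N := N)) (by rw [abs_of_pos hc]; linarith)
  have := (abs_le.1 this).2
  nlinarith

omit hS in
theorem measurable_serviceRec (k : ℕ) : Measurable fun ω => S.serviceRec A tie ω k :=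
  measurable_affineRec (a := fun j ω => ENNReal.ofReal (Real.exp (drift (N := N) - 1)) +
      ENNReal.ofReal (Real.exp (drift (N := N)) - Real.exp (drift (N := N) - 1)) *
        {ω | S.Success A tie j ω}ᶜ.indicator 1 ω)
    (b := fun _ _ => ENNReal.ofReal (Real.exp (drift (N := N)) - 1))
    (fun j => ((measurable_one.indicator (S.measurableSet_success A tie j).compl).const_mul
      _).const_add _)
    (fun _ => measurable_const) k

omit hS in
theorem serviceRec_congr {k : ℕ} {ω ω' : S.Sample P} (h : S.Agree k ω ω') :
    S.serviceRec A tie ω k = S.serviceRec A tie ω' k := by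
  refine affineRec_congr fun j hj => ⟨?_, rfl⟩
  have := S.success_congr A tie h hj
  by_cases hs : S.Success A tie j ω'
  · simp [hs, this.2 hs]
  · simp [hs, mt this.1 hs]

/-- The number 6 is a fixed point of the bound: each step multiplies by at most 1 - c/5 and adds at
most 6c/5. -/
theorem Valid.lintegral_serviceRec_le (δ : P → ℕ) (k : ℕ) :
    ∫⁻ ρ, S.serviceRec A tie (δ, ρ) k ∂S.restLaw ≤ 6 := by
  induction k with
  | zero => simp [serviceRec, affineRec]
  | succ k ih =>
    have hm : Measurable fun ρ => S.serviceRec A tie (δ, ρ) k :=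
      (measurable_serviceRec A tie k).comp measurable_prodMk_left
    have h1 := hS.lintegral_mul_not_success_le A tie hm δ k fun z =>
      serviceRec_congr A tie (S.agree_cleanMix δ k z)
    have hms : MeasurableSet {ρ | S.Success A tie k (δ, ρ)}ᶜ :=
      (measurable_prodMk_left (S.measurableSet_success A tie k)).compl
    have hmm : Measurable fun ρ => S.serviceRec A tie (δ, ρ) k *
        {ρ | S.Success A tie k (δ, ρ)}ᶜ.indicator 1 ρ := hm.mul (measurable_one.indicator hms)
    set α := Real.exp (drift (N := N) - 1) with hα
    set β := Real.exp (drift (N := N)) - Real.exp (drift (N := N) - 1) with hβ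
    have hβ0 : 0 ≤ β := sub_nonneg.2 (Real.exp_le_exp.2 (by linarith))
    have hm1 := hS.one_le_m
    have hq0 : (0 : ℝ) ≤ 1 - 1 / (4 * N.m) := by
      rw [sub_nonneg, div_le_one (by positivity)]; linarith
    calc ∫⁻ ρ, S.serviceRec A tie (δ, ρ) (k + 1) ∂S.restLaw
        = ∫⁻ ρ, (ENNReal.ofReal α * S.serviceRec A tie (δ, ρ) k + ENNReal.ofReal β *
            (S.serviceRec A tie (δ, ρ) k * {ρ | S.Success A tie k (δ, ρ)}ᶜ.indicator 1 ρ)) +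
            ENNReal.ofReal (Real.exp (drift (N := N)) - 1) ∂S.restLaw := by
          refine lintegral_congr fun ρ => ?_
          change S.serviceRec A tie (δ, ρ) k * (ENNReal.ofReal α + ENNReal.ofReal β *
            {ρ | S.Success A tie k (δ, ρ)}ᶜ.indicator 1 ρ) + _ = _
          congr 1
          ring
      _ = ENNReal.ofReal α * ∫⁻ ρ, S.serviceRec A tie (δ, ρ) k ∂S.restLaw +
          ENNReal.ofReal β * ∫⁻ ρ, S.serviceRec A tie (δ, ρ) k *
            {ρ | S.Success A tie k (δ, ρ)}ᶜ.indicator 1 ρ ∂S.restLaw +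
            ENNReal.ofReal (Real.exp (drift (N := N)) - 1) := by
          rw [lintegral_add_right _ measurable_const, lintegral_add_left (hm.const_mul _),
            lintegral_const_mul _ hm, lintegral_const_mul _ hmm, lintegral_const, measure_univ,
            mul_one]
      _ ≤ ENNReal.ofReal α * 6 + ENNReal.ofReal β * (ENNReal.ofReal (1 - 1 / (4 * N.m)) * 6) +
            ENNReal.ofReal (Real.exp (drift (N := N)) - 1) := by
          gcongr
          exact h1.trans (by gcongr)
      _ = ENNReal.ofReal ((α + β * (1 - 1 / (4 * N.m))) * 6 +
            (Real.exp (drift (N := N)) - 1)) := by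
          have h6 : (6 : ℝ≥0∞) = ENNReal.ofReal 6 := by simp
          have hd : 0 ≤ Real.exp (drift (N := N)) - 1 :=
            sub_nonneg.2 (Real.one_le_exp hS.drift_pos.le)
          have hα0 : 0 ≤ α := (Real.exp_pos _).le
          rw [h6, ← ENNReal.ofReal_mul hq0, ← ENNReal.ofReal_mul hβ0, ← ENNReal.ofReal_mul hα0,
            ← ENNReal.ofReal_add (by positivity) (by positivity),
            ← ENNReal.ofReal_add (by positivity) hd]
          congr 1
          ring
      _ ≤ ENNReal.ofReal 6 := by
          refine ENNReal.ofReal_le_ofReal ?_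
          have h2 := hS.exp_drift_mul_le
          have h3 := hS.exp_drift_sub_one_le
          rw [← hα, ← hβ] at h2
          linarith
      _ = 6 := by simp

omit hS in
theorem measurable_arrivalRec (r : ℕ) (δ : P → ℕ) (k : ℕ) :
    Measurable fun ρ => S.arrivalRec A tie r (δ, ρ) k := by
  have hbad : ∀ j, Measurable fun ρ : S.Rest => S.jump A δ j *
      {ω | S.Bad A tie j ω}.indicator (1 : S.Sample P → ℝ≥0∞) (δ, ρ) := fun j =>
    ((measurable_one.indicator (S.measurableSet_bad A tie j)).comp
      measurable_prodMk_left).const_mul _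
  refine measurable_affineRec (a := fun j ρ => if j % S.span = r then
      ENNReal.ofReal (Real.exp (-(S.tilt * drift (N := N)))) +
        S.jump A δ j * {ω | S.Bad A tie j ω}.indicator 1 (δ, ρ) else 1)
    (b := fun j ρ => if j % S.span = r then
      S.jump A δ j * {ω | S.Bad A tie j ω}.indicator 1 (δ, ρ) else 0) ?_ ?_ k
  · intro j
    split_ifs
    · exact (hbad j).const_add _
    · exact measurable_const
  · intro j
    split_ifs
    · exact hbad j
    · exact measurable_const

omit hS in
theorem arrivalRec_congr {k r : ℕ} {ω ω' : S.Sample P} (h : S.Agree k ω ω') :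
    S.arrivalRec A tie r ω k = S.arrivalRec A tie r ω' k := by
  refine affineRec_congr fun j hj => ?_
  have := S.bad_congr A tie h hj
  by_cases hb : S.Bad A tie j ω'
  · simp [hb, this.2 hb, h.1]
  · simp [hb, mt this.1 hb]

include hpath

/-- For fixed delays `jump` is a constant and the recursion up to frame `k` depends on earlier
frames only. So each indicator of a failure may be replaced by `failBound`, although failures in
different frames are dependent. -/
theorem Valid.lintegral_arrivalRec_le (r : ℕ) {δ : P → ℕ} (hδ : S.DelaysBounded δ) (k : ℕ) :
    ∫⁻ ρ, S.arrivalRec A tie r (δ, ρ) k ∂S.restLaw ≤ S.delayRec A r δ k := by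
  induction k with
  | zero => simp [arrivalRec, affineRec]
  | succ k ih =>
    have hm := measurable_arrivalRec (S := S) A tie r δ k
    by_cases hr : k % S.span = r
    · have h1 := hS.lintegral_mul_bad_le A tie hpath hδ k hm fun z =>
        arrivalRec_congr A tie (S.agree_mainMix δ k z)
      have h2 := hS.lintegral_mul_bad_le A tie hpath hδ k (F := fun _ => 1) measurable_const
        fun z => rfl
      simp only [one_mul, lintegral_const, measure_univ, mul_one] at h2
      have hmb : Measurable ({ρ | S.Bad A tie k (δ, ρ)}.indicator (1 : S.Rest → ℝ≥0∞)) :=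
        measurable_one.indicator (measurable_prodMk_left (S.measurableSet_bad A tie k))
      have hmm : Measurable fun ρ => S.arrivalRec A tie r (δ, ρ) k *
          {ρ | S.Bad A tie k (δ, ρ)}.indicator 1 ρ := hm.mul hmb
      set α := ENNReal.ofReal (Real.exp (-(S.tilt * drift (N := N)))) with hα
      calc ∫⁻ ρ, S.arrivalRec A tie r (δ, ρ) (k + 1) ∂S.restLaw
          = ∫⁻ ρ, (α * S.arrivalRec A tie r (δ, ρ) k + S.jump A δ k *
              (S.arrivalRec A tie r (δ, ρ) k * {ρ | S.Bad A tie k (δ, ρ)}.indicator 1 ρ)) +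
              S.jump A δ k * {ρ | S.Bad A tie k (δ, ρ)}.indicator 1 ρ ∂S.restLaw := by
            refine lintegral_congr fun ρ => ?_
            unfold arrivalRec
            simp only [affineRec, hr, if_true]
            change S.arrivalRec A tie r (δ, ρ) k * (α + S.jump A δ k *
              {ρ | S.Bad A tie k (δ, ρ)}.indicator 1 ρ) + S.jump A δ k *
              {ρ | S.Bad A tie k (δ, ρ)}.indicator 1 ρ = (α * S.arrivalRec A tie r (δ, ρ) k +
              S.jump A δ k * (S.arrivalRec A tie r (δ, ρ) k *
                {ρ | S.Bad A tie k (δ, ρ)}.indicator 1 ρ)) + S.jump A δ k *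
              {ρ | S.Bad A tie k (δ, ρ)}.indicator 1 ρ
            ring
        _ = (α * ∫⁻ ρ, S.arrivalRec A tie r (δ, ρ) k ∂S.restLaw + S.jump A δ k *
              ∫⁻ ρ, S.arrivalRec A tie r (δ, ρ) k *
                {ρ | S.Bad A tie k (δ, ρ)}.indicator 1 ρ ∂S.restLaw) + S.jump A δ k *
              ∫⁻ ρ, {ρ | S.Bad A tie k (δ, ρ)}.indicator 1 ρ ∂S.restLaw := by
            rw [lintegral_add_right _ (hmb.const_mul _), lintegral_add_left (hm.const_mul _),
              lintegral_const_mul _ hm, lintegral_const_mul _ hmm,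
              lintegral_const_mul _ hmb]
        _ ≤ (α * S.delayRec A r δ k + S.jump A δ k *
              (S.failBound A δ k * S.delayRec A r δ k)) + S.jump A δ k * S.failBound A δ k := by
            gcongr
            exact h1.trans (by gcongr)
        _ = S.delayRec A r δ (k + 1) := by
            unfold delayRec
            simp only [affineRec, hr, if_true]
            ring
    · calc ∫⁻ ρ, S.arrivalRec A tie r (δ, ρ) (k + 1) ∂S.restLaw
          = ∫⁻ ρ, S.arrivalRec A tie r (δ, ρ) k ∂S.restLaw := by
            refine lintegral_congr fun ρ => ?_
            unfold arrivalRec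
            simp [affineRec, hr]
        _ ≤ S.delayRec A r δ k := ih
        _ = S.delayRec A r δ (k + 1) := by
            unfold delayRec
            simp [affineRec, hr]

theorem Valid.lintegral_backlog_le {δ : P → ℕ} (hδ : S.DelaysBounded δ) (k : ℕ) :
    ∫⁻ ρ, S.backlog A tie k (δ, ρ) ∂S.restLaw ≤ 6 + ENNReal.ofReal (1 / S.tilt) *
      ∑ r ∈ Finset.range S.span, S.delayRec A r δ k := by
  have hm : Measurable fun ρ => S.serviceRec A tie (δ, ρ) k :=
    (measurable_serviceRec A tie k).comp measurable_prodMk_left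
  calc _ ≤ ∫⁻ ρ, S.serviceRec A tie (δ, ρ) k + ENNReal.ofReal (1 / S.tilt) *
        ∑ r ∈ Finset.range S.span, S.arrivalRec A tie r (δ, ρ) k ∂S.restLaw :=
        lintegral_mono fun ρ => hS.backlog_le A tie hpath (ω := (δ, ρ)) hδ k
    _ = ∫⁻ ρ, S.serviceRec A tie (δ, ρ) k ∂S.restLaw + ENNReal.ofReal (1 / S.tilt) *
        ∑ r ∈ Finset.range S.span, ∫⁻ ρ, S.arrivalRec A tie r (δ, ρ) k ∂S.restLaw := by
        rw [lintegral_add_left hm,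
          lintegral_const_mul _ (Finset.measurable_fun_sum _ fun r _ =>
            measurable_arrivalRec A tie r δ k), lintegral_finsetSum _ fun r _ =>
            measurable_arrivalRec A tie r δ k]
    _ ≤ _ := by
        gcongr with r
        · exact hS.lintegral_serviceRec_le A tie δ k
        · exact hS.lintegral_arrivalRec_le A tie hpath r hδ k

omit hS hpath in
theorem measurable_backlog (k : ℕ) : Measurable fun ω => S.backlog A tie k ω :=
  measurable_work (S.measurable_state A tie k) measurable_const _

/-- The work after the first phase depends on its seed. It is first replaced by the work at the
beginning of the frame plus the virtual maximum of new work, which do not. -/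
theorem Valid.lintegral_midBacklog_mul_bad_le {δ : P → ℕ} (hδ : S.DelaysBounded δ) (k : ℕ) :
    ∫⁻ ρ, S.midBacklog A tie k (δ, ρ) * {ρ | S.Bad A tie k (δ, ρ)}.indicator 1 ρ ∂S.restLaw ≤
      S.failBound A δ k * (6 + ENNReal.ofReal (1 / S.tilt) *
      ∑ r ∈ Finset.range S.span, S.delayRec A r δ k + N.D * S.virtualCount A δ k) := by
  classical
  have hm : Measurable fun ρ => (S.backlog A tie k (δ, ρ) : ℝ≥0∞) + N.D * S.virtualCount A δ k :=
    (((measurable_of_countable fun n : ℕ => (n : ℝ≥0∞)).comp (measurable_backlog A tie k)).comp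
      measurable_prodMk_left).add_const _
  calc _ ≤ ∫⁻ ρ, ((S.backlog A tie k (δ, ρ) : ℝ≥0∞) + N.D * S.virtualCount A δ k) *
        {ρ | S.Bad A tie k (δ, ρ)}.indicator 1 ρ ∂S.restLaw := by
        refine lintegral_mono fun ρ => ?_
        gcongr
        have h := S.work_mid_le A tie (δ, ρ) k hS.T_pos hpath hδ
        have h' : S.midBacklog A tie k (δ, ρ) ≤
            S.backlog A tie k (δ, ρ) + N.D * S.virtualCount A δ k := by
          refine h.trans (Nat.add_le_add_left ?_ _)
          split_ifs
          · exact le_rfl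
          · exact Nat.zero_le _
        exact_mod_cast h'
    _ ≤ S.failBound A δ k * ∫⁻ ρ, ((S.backlog A tie k (δ, ρ) : ℝ≥0∞) +
          N.D * S.virtualCount A δ k) ∂S.restLaw := by
        refine hS.lintegral_mul_bad_le A tie hpath hδ k hm fun z => ?_
        unfold backlog
        rw [S.state_congr A tie (S.agree_mainMix δ k z)]
    _ ≤ _ := by
        rw [lintegral_add_right _ measurable_const, lintegral_const, measure_univ, mul_one]
        gcongr
        exact hS.lintegral_backlog_le A tie hpath hδ k

end

end Protocol
end WirelessScheduling

/-! ### The expected virtual load of a frame -/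

namespace WirelessScheduling

namespace Injection

variable {E P : Type*} (A : Injection E P)

theorem load_add {a b c : ℕ} (hab : a ≤ b) (hbc : b ≤ c) (e : E) :
    A.load a c e = A.load a b e + A.load b c e := by
  classical
  unfold load
  rw [← Finset.sum_union]
  · refine Finset.sum_congr ?_ fun _ _ => rfl
    ext p
    simp only [Finset.mem_union, A.mem_injectedIn]
    omega
  · rw [Finset.disjoint_left]
    intro p hp hp'
    rw [A.mem_injectedIn] at hp hp'
    omega

variable {V : Type*} [Fintype E] {N : Network V E}

/-- The interval is covered by ⌊(b - a)/w⌋ + 1 consecutive windows of length w; rounding up costs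
one extra w. -/
theorem IsBounded.sum_load_le {A : Injection E P} {w : ℕ} {lam : ℝ} (h : A.IsBounded N w lam)
    (hw : 0 < w) (hlam : 0 ≤ lam) (e : E) {a b : ℕ} (hab : a ≤ b) :
    ∑ e', N.W e e' * A.load a b e' ≤ ((b - a : ℝ) + w) * lam := by
  have hmul : ∀ i : ℕ, ∑ e', N.W e e' * A.load a (a + i * w) e' ≤ (i * w : ℝ) * lam := by
    intro i
    induction i with
    | zero =>
      have : ∀ e', A.load a a e' = 0 := by
        intro e'
        have := A.load_add (a := a) (b := a) (c := a) le_rfl le_rfl e'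
        omega
      simp [this]
    | succ i ih =>
      have h1 : ∀ e', A.load a (a + (i + 1) * w) e' =
          A.load a (a + i * w) e' + A.load (a + i * w) (a + i * w + w) e' := by
        intro e'
        have := A.load_add (a := a) (b := a + i * w) (c := a + i * w + w) (by omega) (by omega) e'
        rw [← this]
        congr 1
        ring
      simp only [h1, Nat.cast_add, mul_add, Finset.sum_add_distrib]
      have h2 := (N.sum_le_interference (A.load (a + i * w) (a + i * w + w)) e).trans
        (h (a + i * w))
      push_cast
      linarith
  have hi : b ≤ a + ((b - a) / w + 1) * w := by
    have := Nat.lt_div_mul_add (a := b - a) hw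
    have h3 : ((b - a) / w + 1) * w = (b - a) / w * w + w := by ring
    omega
  have hmono : ∀ e', A.load a b e' ≤ A.load a (a + ((b - a) / w + 1) * w) e' := fun e' => by
    rw [A.load_add hab hi]; exact Nat.le_add_right _ _
  calc ∑ e', N.W e e' * A.load a b e'
      ≤ ∑ e', N.W e e' * A.load a (a + ((b - a) / w + 1) * w) e' := by
        refine Finset.sum_le_sum fun e' _ => mul_le_mul_of_nonneg_left ?_ (N.W_nonneg _ _)
        exact_mod_cast hmono e'
    _ ≤ _ := hmul _
    _ ≤ _ := by
        refine mul_le_mul_of_nonneg_right ?_ hlam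
        have h3 : (b - a) / w * w ≤ b - a := Nat.div_mul_le_self _ _
        have h4 : (((b - a) / w * w : ℕ) : ℝ) ≤ ((b - a : ℕ) : ℝ) := by exact_mod_cast h3
        rw [Nat.cast_sub hab] at h4
        push_cast at h4 ⊢
        linarith

end Injection

namespace Protocol

variable {V E : Type*} [Fintype E] {N : Network V E} (S : Protocol N) {P : Type}
  (A : Injection E P)

/-- The expectation over a random delay. -/
noncomputable def avg (h : ℕ → ℝ) : ℝ := (∑ d ∈ Finset.range S.maxDelay, h d) / S.maxDelay

theorem avg_mono {h h' : ℕ → ℝ} (hh : ∀ d, h d ≤ h' d) : S.avg h ≤ S.avg h' :=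
  div_le_div_of_nonneg_right (Finset.sum_le_sum fun d _ => hh d) (Nat.cast_nonneg _)

theorem avg_add (h h' : ℕ → ℝ) : S.avg (fun d => h d + h' d) = S.avg h + S.avg h' := by
  simp only [avg, Finset.sum_add_distrib, add_div]

theorem avg_const_mul (c : ℝ) (h : ℕ → ℝ) : S.avg (fun d => c * h d) = c * S.avg h := by
  simp only [avg, ← Finset.mul_sum, mul_div_assoc]

theorem lintegral_delayLaw (hpos : 0 < S.maxDelay) (h : ℕ → ℝ≥0∞) :
    ∫⁻ d, h d ∂S.delayLaw = (∑ d ∈ Finset.range S.maxDelay, h d) * (S.maxDelay : ℝ≥0∞)⁻¹ := by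
  have hI : Finset.Iic (S.maxDelay - 1) = Finset.range S.maxDelay := by
    ext d; simp only [Finset.mem_Iic, Finset.mem_range]; omega
  rw [lintegral_countable', tsum_eq_sum (s := Finset.range S.maxDelay)]
  · rw [Finset.sum_mul]
    refine Finset.sum_congr rfl fun d hd => ?_
    rw [delayLaw, PMF.toMeasure_apply_singleton _ _ (measurableSet_singleton d),
      PMF.uniformOfFinset_apply, if_pos (by rw [hI]; exact hd), hI, Finset.card_range]
  · intro d hd
    rw [delayLaw, PMF.toMeasure_apply_singleton _ _ (measurableSet_singleton d),
      PMF.uniformOfFinset_apply, if_neg (by rw [hI]; exact hd), mul_zero]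

/-- The inequality 1 + x ≤ e^x, applied to the mean. By independence, it reduces products over
packets to sums of averages. -/
theorem lintegral_exp_delayLaw_le (hpos : 0 < S.maxDelay) (h : ℕ → ℝ) :
    ∫⁻ d, ENNReal.ofReal (Real.exp (h d)) ∂S.delayLaw ≤
      ENNReal.ofReal (Real.exp (S.avg fun d => Real.exp (h d) - 1)) := by
  have hpos' : (0 : ℝ) < S.maxDelay := by exact_mod_cast hpos
  rw [S.lintegral_delayLaw hpos, ← ENNReal.ofReal_sum_of_nonneg fun _ _ => (Real.exp_pos _).le,
    ← ENNReal.ofReal_natCast, ← ENNReal.ofReal_inv_of_pos hpos', ← ENNReal.ofReal_mul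
      (Finset.sum_nonneg fun _ _ => (Real.exp_pos _).le)]
  refine ENNReal.ofReal_le_ofReal ?_
  refine le_trans (le_of_eq ?_) (Real.add_one_le_exp _)
  unfold avg
  rw [Finset.sum_sub_distrib]
  simp only [Finset.sum_const, Finset.card_range, nsmul_eq_mul, mul_one]
  field_simp
  ring

theorem lintegral_prod_exp_le (hpos : 0 < S.maxDelay) (U : Finset P) (h : P → ℕ → ℝ) :
    ∫⁻ δ, ∏ p ∈ U, ENNReal.ofReal (Real.exp (h p (δ p)))
        ∂(Measure.infinitePi fun _ : P => S.delayLaw) ≤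
      ENNReal.ofReal (Real.exp (∑ p ∈ U, S.avg fun d => Real.exp (h p d) - 1)) := by
  rw [lintegral_infinitePi_prod_eval (fun _ : P => S.delayLaw) U
    (fun p d => ENNReal.ofReal (Real.exp (h p d))) fun p => measurable_of_countable _,
    Real.exp_sum, ENNReal.ofReal_prod_of_nonneg fun _ _ => (Real.exp_pos _).le]
  exact Finset.prod_le_prod' fun p _ => S.lintegral_exp_delayLaw_le hpos (h p)

open Classical in
/-- The number of transmissions (`0` or `1`) of `p` in frame `k`, if it never fails. -/
noncomputable def attends (p : P) (k d : ℕ) : ℝ := if S.pos A p d k = none then 0 else 1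

/-- The contribution of `p` to the interference at `e` in frame `k`, if it never fails. -/
noncomputable def impact (e : E) (p : P) (k d : ℕ) : ℝ :=
  (S.pos A p d k).elim 0 fun e' => N.W e e'

theorem attends_nonneg (p : P) (k d : ℕ) : 0 ≤ S.attends A p k d := by
  unfold attends; split_ifs <;> norm_num

theorem attends_le_one (p : P) (k d : ℕ) : S.attends A p k d ≤ 1 := by
  unfold attends; split_ifs <;> norm_num

theorem impact_nonneg (e : E) (p : P) (k d : ℕ) : 0 ≤ S.impact A e p k d := by
  unfold impact
  cases S.pos A p d k
  · exact le_rfl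
  · exact N.W_nonneg _ _

theorem impact_le_one (e : E) (p : P) (k d : ℕ) : S.impact A e p k d ≤ 1 := by
  unfold impact
  cases S.pos A p d k
  · exact zero_le_one
  · exact N.W_le_one _ _

theorem virtualCount_eq_sum_attends (δ : P → ℕ) (k : ℕ) :
    (S.virtualCount A δ k : ℝ) = ∑ p ∈ S.window A k, S.attends A p k (δ p) := by
  classical
  unfold virtualCount attends
  rw [Finset.card_filter, Nat.cast_sum]
  refine Finset.sum_congr rfl fun p _ => ?_
  split_ifs <;> simp_all

theorem sum_W_virtualLoad (δ : P → ℕ) (k : ℕ) (e : E) :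
    ∑ e', N.W e e' * S.virtualLoad A δ k e' = ∑ p ∈ S.window A k, S.impact A e p k (δ p) := by
  classical
  have h1 : ∀ p, S.impact A e p k (δ p) =
      ∑ e', N.W e e' * (if S.pos A p (δ p) k = some e' then 1 else 0 : ℕ) := by
    intro p
    unfold impact
    cases S.pos A p (δ p) k <;> simp
  simp only [h1]
  rw [Finset.sum_comm]
  refine Finset.sum_congr rfl fun e' _ => ?_
  rw [← Finset.mul_sum, virtualLoad, Finset.card_filter, Nat.cast_sum]

theorem attends_le_sum_impact (p : P) (k d : ℕ) :
    S.attends A p k d ≤ ∑ e, S.impact A e p k d := by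
  classical
  unfold attends impact
  cases S.pos A p d k with
  | none => simp
  | some e' =>
    simp only [reduceCtorEq, if_false, Option.elim_some]
    have := Finset.single_le_sum (f := fun e => N.W e e') (fun e _ => N.W_nonneg e e')
      (Finset.mem_univ e')
    simpa [N.W_diag] using this

open Classical in
/-- Each link of the path is reached in frame `k` for at most one delay. -/
theorem sum_range_impact_le (e : E) (p : P) (k n : ℕ) :
    ∑ d ∈ Finset.range n, S.impact A e p k d ≤
      ∑ e', N.W e e' * ((A.path p).count e' : ℕ) := by
  have h1 : ∑ e', N.W e e' * ((A.path p).count e' : ℕ) =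
      ∑ i ∈ Finset.range (A.path p).length, ((A.path p)[i]?).elim 0 fun e' => N.W e e' := by
    generalize A.path p = l
    induction l with
    | nil => simp
    | cons a l ih =>
      rw [List.length_cons, Finset.sum_range_succ']
      simp only [List.getElem?_cons_succ, List.getElem?_cons_zero, Option.elim_some]
      rw [← ih]
      simp only [List.count_cons, Nat.cast_add, mul_add, Finset.sum_add_distrib]
      congr 1
      simp
  rw [h1]
  set s := (Finset.range n).filter fun d => S.start A p + d ≤ k ∧
    k - (S.start A p + d) < (A.path p).length with hs
  have h2 : ∑ d ∈ Finset.range n, S.impact A e p k d = ∑ d ∈ s, S.impact A e p k d := by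
    refine (Finset.sum_subset (Finset.filter_subset _ _) fun d hd hd' => ?_).symm
    unfold impact pos
    split_ifs with h
    · rw [List.getElem?_eq_none]
      · rfl
      · by_contra hlt
        exact hd' (Finset.mem_filter.2 ⟨hd, h, not_le.1 hlt⟩)
    · rfl
  rw [h2]
  calc ∑ d ∈ s, S.impact A e p k d
      = ∑ d ∈ s, ((A.path p)[k - (S.start A p + d)]?).elim 0 fun e' => N.W e e' := by
        refine Finset.sum_congr rfl fun d hd => ?_
        rw [impact, pos, if_pos (Finset.mem_filter.1 hd).2.1]
    -- Among the delays in `s`, distinct ones put the packet at distinct positions of its path.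
    _ = ∑ i ∈ s.image (fun d => k - (S.start A p + d)),
          ((A.path p)[i]?).elim 0 fun e' => N.W e e' := by
        rw [Finset.sum_image]
        intro d hd d' hd' h
        have h3 := (Finset.mem_filter.1 hd).2.1
        have h4 := (Finset.mem_filter.1 hd').2.1
        simp only at h
        omega
    _ ≤ _ := by
        refine Finset.sum_le_sum_of_subset_of_nonneg ?_ ?_
        · intro i hi
          obtain ⟨d, hd, rfl⟩ := Finset.mem_image.1 hi
          exact Finset.mem_range.2 (Finset.mem_filter.1 hd).2.2
        · intro i _ _
          cases (A.path p)[i]?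
          · exact le_rfl
          · exact N.W_nonneg _ _

variable {S A} (hS : S.Valid) (hA : A.IsBounded N S.w S.rate)

include hS hA

/-- The expected interference at `e` in frame `k`, if no packet ever fails, is at most `λ' T`. -/
theorem Valid.sum_avg_impact_le (e : E) (k : ℕ) :
    ∑ p ∈ S.window A k, S.avg (S.impact A e p k) ≤ S.frameLoad := by
  have hf := hS.f_pos
  have hε := hS.ε_pos
  have hε1 := hS.ε_lt
  have hM : (0 : ℝ) < S.maxDelay := by exact_mod_cast hS.maxDelay_pos
  have hT : (1 : ℝ) ≤ S.T := by exact_mod_cast hS.T_pos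
  have hrate : 0 ≤ S.rate := div_nonneg (by linarith) hf.le
  have hab : (k - S.span) * S.T ≤ k * S.T := Nat.mul_le_mul_right _ (Nat.sub_le _ _)
  have h1 : ∑ p ∈ S.window A k, S.avg (S.impact A e p k) ≤
      (∑ e', N.W e e' * A.load ((k - S.span) * S.T) (k * S.T) e') / S.maxDelay := by
    unfold avg
    rw [← Finset.sum_div]
    refine div_le_div_of_nonneg_right ?_ hM.le
    refine (Finset.sum_le_sum fun p _ => S.sum_range_impact_le A e p k S.maxDelay).trans ?_
    rw [Finset.sum_comm]
    refine Finset.sum_le_sum fun e' _ => ?_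
    rw [← Finset.mul_sum, Injection.load, Nat.cast_sum]
    rfl
  have h2 := hA.sum_load_le hS.w_pos hrate e hab
  have h3 : ((k * S.T : ℕ) : ℝ) - ((k - S.span) * S.T : ℕ) ≤ S.span * S.T := by
    have : k * S.T ≤ (k - S.span) * S.T + S.span * S.T := by
      rw [← add_mul]; exact Nat.mul_le_mul_right _ (by omega)
    have : ((k * S.T : ℕ) : ℝ) ≤ ((k - S.span) * S.T : ℕ) + S.span * S.T := by exact_mod_cast this
    linarith
  refine h1.trans ?_
  rw [div_le_iff₀ hM]
  -- The window lasts (D + δ_max)T slots, and δ_max is chosen such that D + w ≤ ε' δ_max. The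
  -- resulting factor 1 + ε' is absorbed by (1 + ε')(1 - 2ε') ≤ 1 - ε', the passage from λ to λ'.
  have h4 : ((k * S.T : ℕ) : ℝ) - ((k - S.span) * S.T : ℕ) + S.w ≤
      (1 + S.ε / 2) * S.maxDelay * S.T := by
    have h5 := hS.le_maxDelay
    rw [div_le_iff₀ hε] at h5
    have h6 : (S.span : ℝ) = N.D + S.maxDelay := by unfold span; push_cast; ring
    have h7 : (S.w : ℝ) ≤ S.w * S.T := le_mul_of_one_le_right (Nat.cast_nonneg _) hT
    rw [h6] at h3
    have h8 : ((N.D : ℝ) + S.w) * S.T ≤ S.ε / 2 * S.maxDelay * S.T := by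
      refine mul_le_mul_of_nonneg_right ?_ (by linarith)
      linarith
    linarith
  calc _ ≤ _ := h2
    _ ≤ (1 + S.ε / 2) * S.maxDelay * S.T * S.rate := mul_le_mul_of_nonneg_right h4 hrate
    _ = ((1 + S.ε / 2) * (1 - S.ε)) / S.f N.m * (S.T * S.maxDelay) := by
        unfold rate; ring
    _ ≤ (1 - S.ε / 2) / S.f N.m * (S.T * S.maxDelay) := by
        refine mul_le_mul_of_nonneg_right (div_le_div_of_nonneg_right ?_ hf.le) (by positivity)
        nlinarith
    _ = S.frameLoad * S.maxDelay := by unfold frameLoad rate'; ring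

/-- A request counts fully at its own link, as W has unit diagonal, so the number of requests is at
most the sum of the interference over all links. -/
theorem Valid.sum_avg_attends_le (k : ℕ) :
    ∑ p ∈ S.window A k, S.avg (S.attends A p k) ≤ S.size := by
  have h0 := hS.le_frameLoad
  calc ∑ p ∈ S.window A k, S.avg (S.attends A p k)
      ≤ ∑ p ∈ S.window A k, ∑ e, S.avg (S.impact A e p k) := by
        refine Finset.sum_le_sum fun p _ => ?_
        refine (S.avg_mono (S.attends_le_sum_impact A p k)).trans (le_of_eq ?_)
        unfold avg
        rw [← Finset.sum_div, Finset.sum_comm]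
    _ = ∑ e, ∑ p ∈ S.window A k, S.avg (S.impact A e p k) := Finset.sum_comm
    _ ≤ ∑ _e : E, S.frameLoad := Finset.sum_le_sum fun e _ => hS.sum_avg_impact_le hA e k
    _ = Fintype.card E * S.frameLoad := by simp
    _ ≤ N.m * S.J := by
        have h1 : (Fintype.card E : ℝ) ≤ N.m := by exact_mod_cast le_max_left _ _
        have h2 : S.frameLoad ≤ S.J := by
          rw [hS.J_eq]; nlinarith [hS.ε_pos]
        gcongr

end Protocol
end WirelessScheduling

/-! ### Chernoff bounds for the virtual load, with the delay of one packet fixed -/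

namespace WirelessScheduling
namespace Protocol

variable {V E : Type*} [Fintype E] {N : Network V E} {S : Protocol N} {P : Type}
  {A : Injection E P}

theorem impact_eq_zero_of_attends {e : E} {p : P} {k d : ℕ} (h : S.attends A p k d = 0) :
    S.impact A e p k d = 0 := by
  classical
  unfold attends at h
  split_ifs at h with h'
  · simp [impact, h']
  · exact absurd h one_ne_zero

theorem attends_eq_zero_or_one (p : P) (k d : ℕ) :
    S.attends A p k d = 0 ∨ S.attends A p k d = 1 := by
  unfold attends; split_ifs <;> simp

/-- Fixing the delay of one packet costs at most 1, so independence of all delays remains available.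
-/
theorem sum_update_le [DecidableEq P] {h : P → ℕ → ℝ} (h0 : ∀ p d, 0 ≤ h p d)
    (h1 : ∀ p d, h p d ≤ 1) (U : Finset P) (δ : P → ℕ) (p : P) (d : ℕ) :
    ∑ q ∈ U, h q (Function.update δ p d q) ≤ ∑ q ∈ U, h q (δ q) + 1 := by
  have hle : ∀ q ∈ U, h q (Function.update δ p d q) ≤ h q (δ q) + if q = p then 1 else 0 := by
    intro q _
    by_cases hq : q = p
    · subst hq
      simp only [Function.update_self, if_true]
      linarith [h0 q (δ q), h1 q d]
    · simp [hq]
  refine (Finset.sum_le_sum hle).trans ?_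
  rw [Finset.sum_add_distrib, Finset.sum_ite_eq']
  split_ifs <;> simp

/-- `1 / n`, the exponent used for the moments of the number of transmissions. -/
noncomputable def invSize (S : Protocol N) : ℝ := S.size⁻¹

section

variable (hS : S.Valid)

include hS

theorem Valid.invSize_pos : 0 < S.invSize := inv_pos.2 (by linarith [hS.le_size])

theorem Valid.invSize_le : S.invSize ≤ 1 / 400 := by
  rw [invSize, ← one_div]
  exact one_div_le_one_div_of_le (by norm_num) hS.le_size

/-- The exponent log(1 + ε') is the one of the multiplicative Chernoff bound; (1 + ε')^v ≤ 1 + ε'v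
for 0 ≤ v ≤ 1 is Bernoulli's inequality. The second summand carries along an exponential moment of
the number of requests, which is needed on the event of an overload. -/
theorem Valid.exp_sub_one_le (e : E) (p : P) (k d : ℕ) :
    Real.exp (Real.log (1 + S.ε / 2) * S.impact A e p k d + S.invSize * S.attends A p k d) - 1 ≤
      S.ε / 2 * S.impact A e p k d + 2 * S.invSize * S.attends A p k d := by
  have hε := hS.ε_pos
  have hε1 := hS.ε_lt
  have hη := hS.invSize_pos
  have hη1 := hS.invSize_le
  rcases attends_eq_zero_or_one (S := S) (A := A) p k d with h | h
  · rw [impact_eq_zero_of_attends h, h]; simp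
  rw [h, mul_one, mul_one]
  set v := S.impact A e p k d with hv
  have hv0 : 0 ≤ v := S.impact_nonneg A e p k d
  have hv1 : v ≤ 1 := S.impact_le_one A e p k d
  set η := S.invSize
  have h1 : Real.exp (Real.log (1 + S.ε / 2) * v) ≤ 1 + v * (S.ε / 2) := by
    rw [← Real.rpow_def_of_pos (by linarith)]
    exact rpow_one_add_le_one_add_mul_self (by linarith) hv0 hv1
  have h2 : Real.exp η ≤ 1 + η + η ^ 2 := by
    have := Real.abs_exp_sub_one_sub_id_le (x := η) (by rw [abs_of_pos hη]; linarith)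
    have := (abs_le.1 this).2
    linarith
  have h3 : Real.exp η ≤ 1 + 1.1 * η := by nlinarith
  rw [Real.exp_add]
  have h4 : v * (S.ε / 2) ≤ 1 / 2 := by nlinarith
  have h5 : 0 ≤ v * (S.ε / 2) := by positivity
  calc _ ≤ (1 + v * (S.ε / 2)) * (1 + 1.1 * η) - 1 := by gcongr
    _ ≤ _ := by nlinarith

theorem Valid.exp_sub_one_le' (p : P) (k d : ℕ) :
    Real.exp (S.invSize * S.attends A p k d) - 1 ≤ 2 * S.invSize * S.attends A p k d := by
  have hη := hS.invSize_pos
  have hη1 := hS.invSize_le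
  rcases attends_eq_zero_or_one (S := S) (A := A) p k d with h | h
  · rw [h]; simp
  rw [h, mul_one, mul_one]
  have := Real.abs_exp_sub_one_sub_id_le (x := S.invSize) (by rw [abs_of_pos hη]; linarith)
  have := (abs_le.1 this).2
  nlinarith

/-- The probability of an overload at one link is less than `1 / (m (m J) ^ 4)`. -/
theorem Valid.chernoff_le : N.m * Real.exp (4 + S.ε / 2 * S.frameLoad -
    Real.log (1 + S.ε / 2) * S.J) ≤ 1 / S.size ^ 4 := by
  have hε := hS.ε_pos
  have hε1 := hS.ε_lt
  have hm := hS.one_le_m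
  have hJ := hS.le_J
  set x := S.ε / 2 with hx
  have hx0 : 0 < x := by positivity
  have hx1 : x < 1 / 2 := by rw [hx]; linarith
  set μ := S.frameLoad with hμ
  have hμ0 : 400 ≤ μ := hS.le_frameLoad
  set a := x ^ 2 * μ with ha
  clear_value a μ x
  -- Everything is measured by a = ε'²λ'T: the exponent is at most 4 - 0.4a, while both m and J are
  -- bounded by small exponentials in a. The two terms of the lower bound on T control J and m
  -- respectively.
  have ha1 : 50 / x + 24 * Real.log N.m ≤ a := by
    have h1 := hS.frameLoad_ge
    rw [← hx, ← hμ] at h1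
    have h2 := mul_le_mul_of_nonneg_left h1 (sq_nonneg x)
    rw [← ha] at h2
    refine le_trans (le_of_eq ?_) h2
    field_simp
  have hlog := hS.log_m_nonneg
  have hx2 : 100 ≤ 50 / x := by
    rw [le_div_iff₀ hx0]; linarith
  have ha100 : 100 + 24 * Real.log N.m ≤ a := by linarith
  -- the exponent
  have hs : 2 * x / (x + 2) ≤ Real.log (1 + x) := Real.le_log_one_add_of_nonneg hx0.le
  have hexp : 4 + x * μ - Real.log (1 + x) * S.J ≤ 4 - 0.4 * a := by
    rw [hS.J_eq, ← hx, ← hμ]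
    have h1 : 2 * x / (x + 2) * ((1 + x) * μ) ≤ Real.log (1 + x) * ((1 + x) * μ) :=
      mul_le_mul_of_nonneg_right hs (by positivity)
    have h2 : x * μ + 0.4 * a ≤ 2 * x / (x + 2) * ((1 + x) * μ) := by
      rw [div_mul_eq_mul_div, le_div_iff₀ (by positivity), ha]
      have h3 : 0 ≤ x ^ 2 * μ * (0.2 - 0.4 * x) := by
        refine mul_nonneg (by positivity) (by linarith)
      nlinarith
    linarith
  -- bounds on the parameters
  have hJa : S.J ≤ a ^ 3 / 1600 := by
    have h1 : 50 ≤ a * x := by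
      have : 50 / x ≤ a := by linarith
      rwa [div_le_iff₀ hx0] at this
    -- From ax ≥ 50 and a³ = μ(ax)².
    have h2 : μ * 50 ^ 2 ≤ a ^ 3 := by
      have h3 : μ * 50 ^ 2 ≤ μ * (a * x) ^ 2 := by gcongr
      calc _ ≤ _ := h3
        _ = a ^ 2 * (x ^ 2 * μ) := by ring
        _ = a ^ 3 := by rw [← ha]; ring
    rw [hS.J_eq, ← hx, ← hμ]
    nlinarith
  have ha0 : 0 < a := by linarith
  have haexp : a ≤ 100 * Real.exp (a / 100 - 1) := by
    have := Real.add_one_le_exp (a / 100 - 1)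
    linarith
  have hJexp : S.J ≤ 625 * Real.exp (3 * a / 100 - 3) := by
    refine hJa.trans ?_
    have h1 : a ^ 3 ≤ (100 * Real.exp (a / 100 - 1)) ^ 3 := by gcongr
    have h2 : Real.exp (a / 100 - 1) ^ 3 = Real.exp (3 * a / 100 - 3) := by
      rw [← Real.exp_nat_mul]; congr 1; push_cast; ring
    rw [mul_pow, h2] at h1
    linarith
  have hmexp : (N.m : ℝ) ≤ Real.exp ((a - 100) / 24) := by
    rw [← Real.log_le_iff_le_exp (by linarith)]
    linarith
  rw [le_div_iff₀ (pow_pos (by linarith [hS.le_size]) 4)]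
  have hsize : S.size ^ 4 = (N.m : ℝ) ^ 4 * S.J ^ 4 := by unfold size; ring
  rw [hsize]
  have h5 : (N.m : ℝ) ^ 5 ≤ Real.exp (5 * (a - 100) / 24) := by
    refine (pow_le_pow_left₀ (by positivity) hmexp 5).trans (le_of_eq ?_)
    rw [← Real.exp_nat_mul]; congr 1; push_cast; ring
  have h6 : S.J ^ 4 ≤ 625 ^ 4 * Real.exp (12 * a / 100 - 12) := by
    refine (pow_le_pow_left₀ (by linarith) hJexp 4).trans (le_of_eq ?_)
    rw [mul_pow, ← Real.exp_nat_mul]; congr 2; push_cast; ring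
  have h7 : (625 : ℝ) ^ 4 ≤ Real.exp 26 := by
    have h8 : (2.7182818283 : ℝ) ^ 26 ≤ Real.exp 1 ^ 26 :=
      pow_le_pow_left₀ (by norm_num) Real.exp_one_gt_d9.le 26
    rw [← Real.exp_nat_mul] at h8
    norm_num at h8 ⊢
    linarith
  calc N.m * Real.exp (4 + x * μ - Real.log (1 + x) * S.J) * ((N.m : ℝ) ^ 4 * S.J ^ 4)
      = (N.m : ℝ) ^ 5 * S.J ^ 4 * Real.exp (4 + x * μ - Real.log (1 + x) * S.J) := by ring
    _ ≤ Real.exp (5 * (a - 100) / 24) * (Real.exp 26 * Real.exp (12 * a / 100 - 12)) *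
        Real.exp (4 - 0.4 * a) := by
        gcongr
        exact h6.trans (by gcongr)
    _ = Real.exp (5 * (a - 100) / 24 + (26 + (12 * a / 100 - 12)) + (4 - 0.4 * a)) := by
        rw [Real.exp_add, Real.exp_add, Real.exp_add 26]
    _ ≤ 1 := by
        rw [Real.exp_le_one_iff]
        linarith

variable [DecidableEq P] (p : P) (d : ℕ)

-- Markov's inequality in exponential form, with a union bound over the links. The factor e^1 pays
-- for the fixed delay of `p`, which shifts the exponent by at most log(1 + ε') + 1/(mJ).
open Classical in
theorem Valid.overload_mul_le (δ : P → ℕ) (k : ℕ) :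
    ENNReal.ofReal (Real.exp (S.invSize * S.virtualCount A (Function.update δ p d) k)) *
      (if S.Overload A (Function.update δ p d) k then 1 else 0) ≤
    ∑ e, ENNReal.ofReal (Real.exp (1 - Real.log (1 + S.ε / 2) * S.J)) *
      ∏ q ∈ S.window A k, ENNReal.ofReal (Real.exp (Real.log (1 + S.ε / 2) *
        S.impact A e q k (δ q) + S.invSize * S.attends A q k (δ q))) := by
  have hε := hS.ε_pos
  have hε1 := hS.ε_lt
  have hη := hS.invSize_pos
  have hη1 := hS.invSize_le
  have hs0 : 0 ≤ Real.log (1 + S.ε / 2) := Real.log_nonneg (by linarith)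
  have hs1 : Real.log (1 + S.ε / 2) ≤ 1 / 2 := by
    have := Real.log_le_sub_one_of_pos (x := 1 + S.ε / 2) (by linarith)
    linarith
  split_ifs with h
  · obtain ⟨e, he⟩ := h
    rw [mul_one]
    refine le_trans ?_ (Finset.single_le_sum (f := fun e => ENNReal.ofReal (Real.exp (1 -
      Real.log (1 + S.ε / 2) * S.J)) *
      ∏ q ∈ S.window A k, ENNReal.ofReal (Real.exp (Real.log (1 + S.ε / 2) *
        S.impact A e q k (δ q) + S.invSize * S.attends A q k (δ q))))
      (fun _ _ => zero_le) (Finset.mem_univ e))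
    rw [← ENNReal.ofReal_prod_of_nonneg fun _ _ => (Real.exp_pos _).le, ← Real.exp_sum,
      ← ENNReal.ofReal_mul (Real.exp_pos _).le, ← Real.exp_add]
    refine ENNReal.ofReal_le_ofReal (Real.exp_le_exp.2 ?_)
    rw [sum_W_virtualLoad] at he
    rw [virtualCount_eq_sum_attends, Finset.sum_add_distrib, ← Finset.mul_sum, ← Finset.mul_sum]
    have h1 := sum_update_le (fun q d => S.attends_nonneg A q k d)
      (fun q d => S.attends_le_one A q k d) (S.window A k) δ p d
    have h2 := sum_update_le (fun q d => S.impact_nonneg A e q k d)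
      (fun q d => S.impact_le_one A e q k d) (S.window A k) δ p d
    have h3 := mul_le_mul_of_nonneg_left h1 hη.le
    have h4 := mul_le_mul_of_nonneg_left (he.le.trans h2) hs0
    linarith
  · rw [mul_zero]; exact zero_le

omit [DecidableEq P] hS in
theorem measurable_exp_prod (k : ℕ) (h : P → ℕ → ℝ) :
    Measurable fun δ : P → ℕ => ∏ q ∈ S.window A k, ENNReal.ofReal (Real.exp (h q (δ q))) :=
  Finset.measurable_fun_prod _ fun q _ =>
    (measurable_of_countable fun d => ENNReal.ofReal (Real.exp (h q d))).comp (measurable_pi_apply q)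

variable (hA : A.IsBounded N S.w S.rate)

include hA

open Classical in
theorem Valid.lintegral_overload_le (k : ℕ) :
    ∫⁻ δ, ENNReal.ofReal (Real.exp (S.invSize * S.virtualCount A (Function.update δ p d) k)) *
      (if S.Overload A (Function.update δ p d) k then 1 else 0)
        ∂(Measure.infinitePi fun _ : P => S.delayLaw) ≤ ENNReal.ofReal (1 / S.size ^ 4) := by
  refine (lintegral_mono fun δ => hS.overload_mul_le p d δ k).trans ?_
  have hmeas := fun e => measurable_exp_prod (S := S) (A := A) k fun q d =>
    Real.log (1 + S.ε / 2) * S.impact A e q k d + S.invSize * S.attends A q k d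
  rw [lintegral_finsetSum _ fun e _ => (hmeas e).const_mul _]
  have hη := hS.invSize_pos
  have hε := hS.ε_pos
  have hone : ∀ e, ∫⁻ δ, ENNReal.ofReal (Real.exp (1 - Real.log (1 + S.ε / 2) * S.J)) *
      ∏ q ∈ S.window A k, ENNReal.ofReal (Real.exp (Real.log (1 + S.ε / 2) *
        S.impact A e q k (δ q) + S.invSize * S.attends A q k (δ q)))
        ∂(Measure.infinitePi fun _ : P => S.delayLaw) ≤
      ENNReal.ofReal (Real.exp (4 + S.ε / 2 * S.frameLoad - Real.log (1 + S.ε / 2) * S.J)) := by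
    intro e
    rw [lintegral_const_mul _ (hmeas e)]
    have h1 := S.lintegral_prod_exp_le hS.maxDelay_pos (S.window A k) fun q d =>
      Real.log (1 + S.ε / 2) * S.impact A e q k d + S.invSize * S.attends A q k d
    refine (mul_le_mul_right h1 _).trans ?_
    rw [← ENNReal.ofReal_mul (Real.exp_pos _).le, ← Real.exp_add]
    refine ENNReal.ofReal_le_ofReal (Real.exp_le_exp.2 ?_)
    -- The moment of the number of requests costs only the constant 2, because its exponent is the
    -- inverse of mJ, which bounds the expected number. Together with the 1 from the fixed delay
    -- this stays below the 4 in `Valid.chernoff_le`.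
    have h2 : ∑ q ∈ S.window A k, S.avg (fun d => Real.exp (Real.log (1 + S.ε / 2) *
        S.impact A e q k d + S.invSize * S.attends A q k d) - 1) ≤
        S.ε / 2 * S.frameLoad + 2 := by
      calc _ ≤ ∑ q ∈ S.window A k, (S.ε / 2 * S.avg (S.impact A e q k) +
            2 * S.invSize * S.avg (S.attends A q k)) := by
            refine Finset.sum_le_sum fun q _ => ?_
            rw [← avg_const_mul, ← avg_const_mul, ← avg_add]
            exact S.avg_mono fun d => hS.exp_sub_one_le e q k d
        _ = S.ε / 2 * ∑ q ∈ S.window A k, S.avg (S.impact A e q k) +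
            2 * S.invSize * ∑ q ∈ S.window A k, S.avg (S.attends A q k) := by
            rw [Finset.sum_add_distrib, ← Finset.mul_sum, ← Finset.mul_sum]
        _ ≤ S.ε / 2 * S.frameLoad + 2 * S.invSize * S.size := by
            have := hS.sum_avg_impact_le hA e k
            have := hS.sum_avg_attends_le hA k
            gcongr
        _ = _ := by
            rw [mul_assoc, invSize, inv_mul_cancel₀ (by linarith [hS.le_size])]; ring
    linarith
  calc _ ≤ ∑ _e : E, ENNReal.ofReal (Real.exp (4 + S.ε / 2 * S.frameLoad -
        Real.log (1 + S.ε / 2) * S.J)) := Finset.sum_le_sum fun e _ => hone e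
    _ = ENNReal.ofReal (Fintype.card E * Real.exp (4 + S.ε / 2 * S.frameLoad -
        Real.log (1 + S.ε / 2) * S.J)) := by
        rw [Finset.sum_const, Finset.card_univ, nsmul_eq_mul,
          ENNReal.ofReal_mul (Nat.cast_nonneg _), ENNReal.ofReal_natCast]
    _ ≤ _ := by
        refine ENNReal.ofReal_le_ofReal (le_trans ?_ hS.chernoff_le)
        have : (Fintype.card E : ℝ) ≤ N.m := by exact_mod_cast le_max_left _ _
        gcongr

theorem Valid.lintegral_exp_virtualCount_le (k : ℕ) :
    ∫⁻ δ, ENNReal.ofReal (Real.exp (S.invSize * S.virtualCount A (Function.update δ p d) k))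
        ∂(Measure.infinitePi fun _ : P => S.delayLaw) ≤ ENNReal.ofReal 8 := by
  have hη := hS.invSize_pos
  have hη1 := hS.invSize_le
  have hmeas := measurable_exp_prod (S := S) (A := A) k fun q d => S.invSize * S.attends A q k d
  have h1 : ∀ δ : P → ℕ,
      ENNReal.ofReal (Real.exp (S.invSize * S.virtualCount A (Function.update δ p d) k)) ≤
      ENNReal.ofReal (Real.exp S.invSize) *
        ∏ q ∈ S.window A k, ENNReal.ofReal (Real.exp (S.invSize * S.attends A q k (δ q))) := by
    intro δ
    rw [← ENNReal.ofReal_prod_of_nonneg fun _ _ => (Real.exp_pos _).le, ← Real.exp_sum,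
      ← ENNReal.ofReal_mul (Real.exp_pos _).le, ← Real.exp_add]
    refine ENNReal.ofReal_le_ofReal (Real.exp_le_exp.2 ?_)
    rw [virtualCount_eq_sum_attends, ← Finset.mul_sum]
    have h1 := sum_update_le (fun q d => S.attends_nonneg A q k d)
      (fun q d => S.attends_le_one A q k d) (S.window A k) δ p d
    have h3 := mul_le_mul_of_nonneg_left h1 hη.le
    linarith
  refine (lintegral_mono h1).trans ?_
  rw [lintegral_const_mul _ hmeas]
  refine (mul_le_mul_right (S.lintegral_prod_exp_le hS.maxDelay_pos (S.window A k) fun q d =>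
    S.invSize * S.attends A q k d) _).trans ?_
  rw [← ENNReal.ofReal_mul (Real.exp_pos _).le, ← Real.exp_add]
  refine ENNReal.ofReal_le_ofReal ?_
  have h2 : ∑ q ∈ S.window A k, S.avg (fun d => Real.exp (S.invSize * S.attends A q k d) - 1) ≤
      2 := by
    calc _ ≤ ∑ q ∈ S.window A k, 2 * S.invSize * S.avg (S.attends A q k) := by
          refine Finset.sum_le_sum fun q _ => ?_
          rw [← avg_const_mul]
          exact S.avg_mono fun d => hS.exp_sub_one_le' q k d
      _ = 2 * S.invSize * ∑ q ∈ S.window A k, S.avg (S.attends A q k) := by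
          rw [← Finset.mul_sum]
      _ ≤ 2 * S.invSize * S.size := by
          have := hS.sum_avg_attends_le hA k
          gcongr
      _ = _ := by
          rw [mul_assoc, invSize, inv_mul_cancel₀ (by linarith [hS.le_size])]; ring
  calc _ ≤ Real.exp (2 + 1 / 400) := Real.exp_le_exp.2 (by linarith)
    _ ≤ 8 := by
        rw [← Real.le_log_iff_exp_le (by norm_num)]
        have h8 : Real.log 8 = 3 * Real.log 2 := by
          rw [show (8 : ℝ) = 2 ^ 3 by norm_num, Real.log_pow]; norm_num
        have := Real.log_two_gt_d9
        rw [h8]; linarith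

omit [DecidableEq P] hS hA in
theorem measurable_virtualCount (k : ℕ) : Measurable fun δ : P → ℕ => S.virtualCount A δ k := by
  classical
  unfold virtualCount
  simp only [Finset.card_filter]
  exact Finset.measurable_fun_sum _ fun q _ => (measurable_of_countable fun d : ℕ =>
    if S.pos A q d k ≠ none then 1 else 0).comp (measurable_pi_apply q)

omit [DecidableEq P] hS hA in
theorem measurable_virtualLoad (k : ℕ) (e : E) :
    Measurable fun δ : P → ℕ => S.virtualLoad A δ k e := by
  classical
  unfold virtualLoad
  simp only [Finset.card_filter]
  exact Finset.measurable_fun_sum _ fun q _ => (measurable_of_countable fun d : ℕ =>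
    if S.pos A q d k = some e then 1 else 0).comp (measurable_pi_apply q)

omit [DecidableEq P] hS hA in
theorem measurable_failBound (k : ℕ) : Measurable fun δ : P → ℕ => S.failBound A δ k := by
  classical
  refine Measurable.add_const (Measurable.ite ?_ measurable_const measurable_const) _
  have : {δ : P → ℕ | S.Overload A δ k} =
      ⋃ e, {δ | S.J < ∑ e', N.W e e' * S.virtualLoad A δ k e'} := by
    ext δ; simp [Overload]
  rw [this]
  refine MeasurableSet.iUnion fun e => measurableSet_lt measurable_const ?_
  exact Finset.measurable_fun_sum _ fun e' _ =>
    ((measurable_of_countable fun n : ℕ => (n : ℝ)).comp (measurable_virtualLoad k e')).const_mul _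

omit [DecidableEq P] hS hA in
theorem measurable_exp_virtualCount (c : ℝ) (k : ℕ) :
    Measurable fun δ : P → ℕ => ENNReal.ofReal (Real.exp (c * S.virtualCount A δ k)) :=
  (measurable_of_countable fun n : ℕ => ENNReal.ofReal (Real.exp (c * n))).comp
    (measurable_virtualCount k)

omit [Fintype E] hS hA in
theorem measurable_update_delay : Measurable fun δ : P → ℕ => Function.update δ p d := by
  refine measurable_pi_lambda _ fun q => ?_
  by_cases hq : q = p
  · subst hq; simp only [Function.update_self]; exact measurable_const
  · simp only [Function.update_of_ne hq]; fun_prop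

/-- The exponential moment of the number of transmissions in frames with failures. -/
theorem Valid.lintegral_exp_mul_failBound_le (k : ℕ) :
    ∫⁻ δ, ENNReal.ofReal (Real.exp (S.invSize * S.virtualCount A (Function.update δ p d) k)) *
      S.failBound A (Function.update δ p d) k
        ∂(Measure.infinitePi fun _ : P => S.delayLaw) ≤ ENNReal.ofReal (5 / S.size ^ 4) := by
  classical
  have hsize := hS.le_size
  unfold failBound
  simp only [mul_add]
  have hm : Measurable fun δ : P → ℕ => ENNReal.ofReal
      (Real.exp (S.invSize * S.virtualCount A (Function.update δ p d) k)) :=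
    (measurable_exp_virtualCount _ k).comp (measurable_update_delay p d)
  rw [lintegral_add_right _ (hm.mul_const _), lintegral_mul_const _ hm]
  refine (add_le_add (hS.lintegral_overload_le p d hA k)
    (mul_le_mul_left (hS.lintegral_exp_virtualCount_le p d hA k) _)).trans ?_
  -- With n = mJ, the overload gives 1/n^4 and the error of 𝒜 gives 8 · 1/(2n^4), in total 5/n^4.
  rw [← ENNReal.ofReal_mul (by norm_num), ← ENNReal.ofReal_add (by positivity) (by positivity)]
  refine ENNReal.ofReal_le_ofReal (le_of_eq ?_)
  field_simp
  norm_num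

end

end Protocol
end WirelessScheduling

/-! ### Averaging the arrival recursions over the delays -/

namespace WirelessScheduling
namespace Protocol

variable {V E : Type*} [Fintype E] {N : Network V E} {S : Protocol N} {P : Type}
  {A : Injection E P}

/-- The exponential of the work of the packets that can fail in frame `k`, times the bound on the
conditional probability of a failure. -/
noncomputable def risk (S : Protocol N) (A : Injection E P) (δ : P → ℕ) (k : ℕ) : ℝ≥0∞ :=
  S.jump A δ k * S.failBound A δ k

section Dependence

variable {δ δ' : P → ℕ} {k : ℕ}

theorem risk_congr (h : ∀ q ∈ S.window A k, δ q = δ' q) : S.risk A δ k = S.risk A δ' k := by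
  classical
  have h1 : S.virtualCount A δ k = S.virtualCount A δ' k := by
    unfold virtualCount
    congr 1
    exact Finset.filter_congr fun q hq => by rw [h q hq]
  have h2 : S.virtualLoad A δ k = S.virtualLoad A δ' k := by
    funext e
    unfold virtualLoad
    congr 1
    exact Finset.filter_congr fun q hq => by rw [h q hq]
  have hO : S.Overload A δ k ↔ S.Overload A δ' k := by
    unfold Overload
    rw [h2]
  unfold risk jump failBound
  rw [h1]
  congr 2
  exact if_congr hO rfl rfl

theorem delayRec_congr {r b : ℕ} (hb : ∀ j < k, j % S.span = r → j ≤ b)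
    (h : ∀ q, A.time q < b * S.T → δ q = δ' q) : S.delayRec A r δ k = S.delayRec A r δ' k := by
  refine affineRec_congr fun j hj => ?_
  split_ifs with hr
  · have := risk_congr (S := S) (A := A) (k := j) fun q hq => h q
      (((A.mem_injectedIn.1 hq).2).trans_le (Nat.mul_le_mul_right _ (hb j hj hr)))
    unfold risk at this
    rw [this]
    exact ⟨rfl, rfl⟩
  · exact ⟨rfl, rfl⟩

/-- The recursion moves only in frames of its class. Going back to the last such frame `i` isolates
the one step whose delays may be shared with frame `k`. -/
theorem delayRec_eq (S : Protocol N) (A : Injection E P) (hspan : 0 < S.span) (r k : ℕ) :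
    (∀ δ, S.delayRec A r δ k = 0) ∨ ∃ i < k, i % S.span = r ∧ k ≤ i + S.span ∧
      ∀ δ, S.delayRec A r δ k = S.delayRec A r δ (i + 1) := by
  have main : (∀ δ, S.delayRec A r δ k = 0) ∨ ∃ i < k, i % S.span = r ∧
      (∀ j, i < j → j < k → j % S.span ≠ r) ∧
      ∀ δ, S.delayRec A r δ k = S.delayRec A r δ (i + 1) := by
    induction k with
    | zero => left; exact fun δ => rfl
    | succ k ih =>
      by_cases hr : k % S.span = r
      · right
        exact ⟨k, Nat.lt_succ_self k, hr, fun j h1 h2 => by omega, fun δ => rfl⟩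
      · have hstep : ∀ δ, S.delayRec A r δ (k + 1) = S.delayRec A r δ k := fun δ => by
          unfold delayRec
          simp [affineRec, hr]
        rcases ih with ih | ⟨i, hi, hir, hij, hi'⟩
        · left; exact fun δ => (hstep δ).trans (ih δ)
        · right
          refine ⟨i, by omega, hir, fun j h1 h2 => ?_, fun δ => (hstep δ).trans (hi' δ)⟩
          rcases Nat.lt_or_ge j k with h3 | h3
          · exact hij j h1 h3
          · have : j = k := by omega
            rwa [this]
  refine main.imp id ?_
  rintro ⟨i, hi, hir, hij, hi'⟩
  refine ⟨i, hi, hir, ?_, hi'⟩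
  by_contra hlt
  exact hij (i + S.span) (by omega) (by omega) (by rw [Nat.add_mod_right]; exact hir)

theorem delayRec_succ {r : ℕ} (δ : P → ℕ) (hr : k % S.span = r) :
    S.delayRec A r δ (k + 1) = S.delayRec A r δ k *
      (ENNReal.ofReal (Real.exp (-(S.tilt * drift (N := N)))) + S.risk A δ k) + S.risk A δ k := by
  unfold delayRec
  simp only [affineRec, hr, if_true]
  rfl

theorem measurable_jump (k : ℕ) : Measurable fun δ : P → ℕ => S.jump A δ k :=
  (measurable_of_countable fun n : ℕ => ENNReal.ofReal (Real.exp (S.tilt * (N.D * n)))).comp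
    (measurable_virtualCount k)

theorem measurable_risk (k : ℕ) : Measurable fun δ : P → ℕ => S.risk A δ k :=
  (measurable_jump k).mul (measurable_failBound k)

theorem measurable_delayRec (r k : ℕ) : Measurable fun δ : P → ℕ => S.delayRec A r δ k := by
  refine measurable_affineRec (a := fun j δ => if j % S.span = r then
      ENNReal.ofReal (Real.exp (-(S.tilt * drift (N := N)))) + S.risk A δ j else 1)
    (b := fun j δ => if j % S.span = r then S.risk A δ j else 0) ?_ ?_ k
  · intro j
    split_ifs
    · exact (measurable_risk j).const_add _
    · exact measurable_const
  · intro j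
    split_ifs
    · exact measurable_risk j
    · exact measurable_const

theorem one_le_jump (hS : S.Valid) (δ : P → ℕ) (k : ℕ) : 1 ≤ S.jump A δ k := by
  have := hS.tilt_pos
  unfold jump
  rw [ENNReal.one_le_ofReal]
  exact Real.one_le_exp (by positivity)

theorem jump_mul_jump_le (hS : S.Valid) (δ : P → ℕ) (k : ℕ) : S.jump A δ k * S.jump A δ k ≤
    ENNReal.ofReal (Real.exp (S.invSize * S.virtualCount A δ k)) := by
  have hm := hS.one_le_m
  have hsize := hS.le_size
  unfold jump
  rw [← ENNReal.ofReal_mul (Real.exp_pos _).le, ← Real.exp_add]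
  refine ENNReal.ofReal_le_ofReal (Real.exp_le_exp.2 ?_)
  have hD : (N.D : ℝ) ≤ N.m := by exact_mod_cast le_max_right _ _
  -- `tilt` is half of 1/(m · mJ) and D ≤ m, so even the square of `jump` is covered by the
  -- exponential moment with exponent 1/(mJ).
  have h1 : S.tilt * N.D * 2 ≤ S.invSize := by
    unfold tilt invSize
    rw [← one_div, div_mul_eq_mul_div, div_mul_eq_mul_div, div_le_div_iff₀ (by positivity)
      (by positivity)]
    nlinarith
  have h2 := mul_le_mul_of_nonneg_right h1 (Nat.cast_nonneg (S.virtualCount A δ k) : (0 : ℝ) ≤ _)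
  linarith

theorem jump_le (hS : S.Valid) (δ : P → ℕ) (k : ℕ) : S.jump A δ k ≤
    ENNReal.ofReal (Real.exp (S.invSize * S.virtualCount A δ k)) :=
  (le_mul_of_one_le_left' (one_le_jump hS δ k)).trans (jump_mul_jump_le hS δ k)

theorem failBound_le (hS : S.Valid) (δ : P → ℕ) (k : ℕ) : S.failBound A δ k ≤ 2 := by
  have h1 := hS.one_sub_ge
  unfold failBound
  calc _ ≤ (1 : ℝ≥0∞) + 1 := by
        refine add_le_add ?_ ?_
        · split_ifs
          · exact le_rfl
          · exact zero_le
        · rw [ENNReal.ofReal_le_one]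
          linarith
    _ = 2 := one_add_one_eq_two

end Dependence

section Expectation

variable (hS : S.Valid) [DecidableEq P] (p : P) (d : ℕ) (hA : A.IsBounded N S.w S.rate)

/-- An upper bound on the expectation of `risk`. -/
noncomputable def riskBound (S : Protocol N) : ℝ≥0∞ := ENNReal.ofReal (5 / S.size ^ 4)

include hS hA

theorem Valid.lintegral_risk_le (k : ℕ) :
    ∫⁻ δ, S.risk A (Function.update δ p d) k ∂(Measure.infinitePi fun _ : P => S.delayLaw) ≤
      S.riskBound :=
  (lintegral_mono fun _ => mul_le_mul_left (jump_le hS _ k) _).trans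
    (hS.lintegral_exp_mul_failBound_le p d hA k)

theorem Valid.lintegral_risk_sq_le (k : ℕ) :
    ∫⁻ δ, S.risk A (Function.update δ p d) k * S.risk A (Function.update δ p d) k
      ∂(Measure.infinitePi fun _ : P => S.delayLaw) ≤ 2 * S.riskBound := by
  have hm : Measurable fun δ : P → ℕ => ENNReal.ofReal
      (Real.exp (S.invSize * S.virtualCount A (Function.update δ p d) k)) *
      S.failBound A (Function.update δ p d) k :=
    ((measurable_exp_virtualCount _ k).comp (measurable_update_delay p d)).mul
      ((measurable_failBound k).comp (measurable_update_delay p d))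
  refine le_trans ?_ (mul_le_mul_right (hS.lintegral_exp_mul_failBound_le p d hA k) 2)
  rw [← lintegral_const_mul _ hm]
  refine lintegral_mono fun δ => ?_
  generalize Function.update δ p d = δ'
  calc S.risk A δ' k * S.risk A δ' k
      = S.failBound A δ' k * (S.jump A δ' k * S.jump A δ' k * S.failBound A δ' k) := by
        unfold risk; ring
    _ ≤ 2 * (ENNReal.ofReal (Real.exp (S.invSize * S.virtualCount A δ' k)) *
        S.failBound A δ' k) := by
        gcongr
        · exact failBound_le hS δ' k
        · exact jump_mul_jump_le hS δ' k

/-- The risks of two frames may share delays, so the product is bounded by the sum of the squares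
instead of using independence. -/
theorem Valid.lintegral_risk_mul_le (i k : ℕ) :
    ∫⁻ δ, S.risk A (Function.update δ p d) i * S.risk A (Function.update δ p d) k
      ∂(Measure.infinitePi fun _ : P => S.delayLaw) ≤ 4 * S.riskBound := by
  have hm : Measurable fun δ : P → ℕ =>
      S.risk A (Function.update δ p d) i * S.risk A (Function.update δ p d) i :=
    ((measurable_risk i).comp (measurable_update_delay p d)).mul
      ((measurable_risk i).comp (measurable_update_delay p d))
  calc _ ≤ ∫⁻ δ, S.risk A (Function.update δ p d) i * S.risk A (Function.update δ p d) i +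
        S.risk A (Function.update δ p d) k * S.risk A (Function.update δ p d) k
        ∂(Measure.infinitePi fun _ : P => S.delayLaw) := by
        refine lintegral_mono fun δ => ?_
        rcases le_total (S.risk A (Function.update δ p d) i)
          (S.risk A (Function.update δ p d) k) with h | h
        · exact (mul_le_mul_left h _).trans le_add_self
        · exact (mul_le_mul_right h _).trans le_self_add
    _ ≤ 2 * S.riskBound + 2 * S.riskBound := by
        rw [lintegral_add_left hm]
        exact add_le_add (hS.lintegral_risk_sq_le p d hA i) (hS.lintegral_risk_sq_le p d hA k)
    _ = 4 * S.riskBound := by rw [← add_mul]; norm_num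

omit hS hA in
/-- The arrivals before frame `i` in the residue class of `i` are independent of functions of the
delays of the packets injected at most `span` frames before frame `i`. -/
theorem lintegral_delayRec_mul {r i : ℕ} (hr : i % S.span = r) {G : (P → ℕ) → ℝ≥0∞}
    (hG : Measurable G)
    (hG' : ∀ x y, (∀ q, (i - S.span) * S.T ≤ A.time q → x q = y q) → G x = G y) :
    ∫⁻ δ, S.delayRec A r (Function.update δ p d) i * G (Function.update δ p d)
      ∂(Measure.infinitePi fun _ : P => S.delayLaw) =
    (∫⁻ δ, S.delayRec A r (Function.update δ p d) i
      ∂(Measure.infinitePi fun _ : P => S.delayLaw)) *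
      ∫⁻ δ, G (Function.update δ p d) ∂(Measure.infinitePi fun _ : P => S.delayLaw) := by
  have hupd : ∀ (x y : P → ℕ) q, x q = y q → Function.update x p d q = Function.update y p d q := by
    intro x y q h
    by_cases hq : q = p
    · subst hq; simp
    · simp [hq, h]
  refine lintegral_infinitePi_mul_of_disjoint (fun _ : P => S.delayLaw)
    {q | (i - S.span) * S.T ≤ A.time q}
    ((measurable_delayRec r i).comp (measurable_update_delay p d))
    (hG.comp (measurable_update_delay p d)) ?_ ?_
  · intro x y h
    refine delayRec_congr (b := i - S.span) (fun j hj hjr => ?_) fun q hq =>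
      hupd x y q (h q (by simpa using hq))
    -- An earlier frame `j` of the class satisfies `j ≤ i - span`, and its window ends where the
    -- window of frame `i` begins.
    have h1 : (i - j) % S.span = 0 := Nat.sub_mod_eq_zero_of_mod_eq (hr.trans hjr.symm)
    have h2 : S.span ≤ i - j := Nat.le_of_dvd (by omega) (Nat.dvd_of_mod_eq_zero h1)
    omega
  · intro x y h
    exact hG' _ _ fun q hq => hupd x y q (h q hq)

omit hS hA [DecidableEq P] in
theorem risk_congr_of_le {i k : ℕ} (hik : i ≤ k) (x y : P → ℕ)
    (h : ∀ q, (i - S.span) * S.T ≤ A.time q → x q = y q) : S.risk A x k = S.risk A y k :=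
  risk_congr fun q hq => h q
    ((Nat.mul_le_mul_right _ (by omega)).trans (A.mem_injectedIn.1 hq).1)

omit [DecidableEq P] hA in
-- The decay per step is tilt · drift = 1/(16 m² · mJ), whereas the risk is of order 1/(mJ)^4. Since
-- mJ ≥ 400m, the decay wins; this is the stability of the queue.
theorem Valid.exp_add_riskBound_le :
    ENNReal.ofReal (Real.exp (-(S.tilt * drift (N := N)))) + S.riskBound + S.riskBound ≤ 1 := by
  have hm := hS.one_le_m
  have hsize := hS.le_size
  have hJ := hS.le_J
  unfold riskBound
  rw [← ENNReal.ofReal_add (Real.exp_pos _).le (by positivity),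
    ← ENNReal.ofReal_add (by positivity) (by positivity), ENNReal.ofReal_le_one]
  set x := S.tilt * drift (N := N) with hx
  have hxe : x = 1 / (16 * N.m ^ 2 * S.size) := by
    rw [hx]; unfold tilt drift; field_simp; norm_num
  have hx0 : 0 < x := by rw [hxe]; positivity
  have hx1 : x ≤ 1 := by
    rw [hxe, div_le_one (by positivity)]
    nlinarith [one_le_pow₀ hm (n := 2)]
  have h1 : Real.exp (-x) ≤ 1 - x / 2 := by
    have := Real.abs_exp_sub_one_sub_id_le (x := -x) (by rw [abs_neg, abs_of_pos hx0]; exact hx1)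
    have h2 := (abs_le.1 this).2
    have h3 := Real.add_one_le_exp x
    have h4 : Real.exp (-x) ≤ 1 / (x + 1) := by
      rw [Real.exp_neg, ← one_div]
      exact one_div_le_one_div_of_le (by linarith) h3
    refine h4.trans ?_
    rw [div_le_iff₀ (by linarith)]
    nlinarith
  have h2 : 10 / S.size ^ 4 ≤ x / 2 := by
    rw [hxe, div_div, div_le_div_iff₀ (by positivity) (by positivity)]
    have h3 : N.m * 400 ≤ S.size := by unfold size; gcongr
    have h4 : (N.m * 400 : ℝ) ^ 2 ≤ S.size ^ 2 := by gcongr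
    have h5 : S.size ^ 4 = S.size ^ 2 * (S.size * S.size) := by ring
    have h6 : (N.m * 400 : ℝ) ^ 2 * (400 * S.size) ≤ S.size ^ 2 * (S.size * S.size) := by
      gcongr
    rw [h5]
    refine le_trans ?_ (by linarith : (N.m * 400 : ℝ) ^ 2 * (400 * S.size) ≤ _)
    have h7 : 0 ≤ (N.m : ℝ) ^ 2 * S.size := by positivity
    nlinarith
  have h3 : 5 / S.size ^ 4 + 5 / S.size ^ 4 = 10 / S.size ^ 4 := by ring
  linarith

/-- Induction with the value 1 preserved: the past of the class is independent of the risk of frame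
`k`, and the mean factor plus the mean additive term is at most 1. -/
theorem Valid.lintegral_delayRec_le (r k : ℕ) :
    ∫⁻ δ, S.delayRec A r (Function.update δ p d) k
      ∂(Measure.infinitePi fun _ : P => S.delayLaw) ≤ 1 := by
  induction k with
  | zero => simp [delayRec, affineRec]
  | succ k ih =>
    by_cases hr : k % S.span = r
    · have hmr : Measurable fun δ : P → ℕ => S.risk A (Function.update δ p d) k :=
        (measurable_risk k).comp (measurable_update_delay p d)
      simp only [delayRec_succ _ hr]
      rw [lintegral_add_right _ hmr, lintegral_delayRec_mul p d hr
        (G := fun δ => ENNReal.ofReal (Real.exp (-(S.tilt * drift (N := N)))) + S.risk A δ k)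
        ((measurable_risk k).const_add _) fun x y h => by rw [risk_congr_of_le le_rfl x y h],
        lintegral_add_left measurable_const, lintegral_const, measure_univ, mul_one]
      have h1 := hS.lintegral_risk_le p d hA k
      calc _ ≤ 1 * (ENNReal.ofReal (Real.exp (-(S.tilt * drift (N := N)))) + S.riskBound) +
            S.riskBound := by gcongr
        _ ≤ 1 := by rw [one_mul]; exact hS.exp_add_riskBound_le
    · have hstep : ∀ δ, S.delayRec A r δ (k + 1) = S.delayRec A r δ k := fun δ => by
        unfold delayRec
        simp [affineRec, hr]
      simp only [hstep]
      exact ih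

/-- The queue and the risk of frame `k` are correlated only through the last frame `i` of the class.
What precedes `i` is independent of the risks of both `i` and `k` and has mean at most 1, so there
remain 1 + 4 for the multiplicative part of step `i` and 4 for the additive one. -/
theorem Valid.lintegral_delayRec_mul_risk_le (r k : ℕ) :
    ∫⁻ δ, S.delayRec A r (Function.update δ p d) k * S.risk A (Function.update δ p d) k
      ∂(Measure.infinitePi fun _ : P => S.delayLaw) ≤ 9 * S.riskBound := by
  rcases delayRec_eq S A hS.span_pos r k with h0 | ⟨i, hik, hir, hki, hi⟩
  · simp [h0]
  · simp only [hi, delayRec_succ _ hir]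
    set α := ENNReal.ofReal (Real.exp (-(S.tilt * drift (N := N)))) with hα
    have hα1 : α ≤ 1 := by
      have := hS.exp_add_riskBound_le
      rw [← hα, add_assoc] at this
      exact le_self_add.trans this
    have hmi : Measurable fun δ : P → ℕ => S.risk A (Function.update δ p d) i :=
      (measurable_risk i).comp (measurable_update_delay p d)
    have hmk : Measurable fun δ : P → ℕ => S.risk A (Function.update δ p d) k :=
      (measurable_risk k).comp (measurable_update_delay p d)
    have hmik : Measurable fun δ : P → ℕ => S.risk A (Function.update δ p d) i *
        S.risk A (Function.update δ p d) k := hmi.mul hmk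
    have hG : Measurable fun δ : P → ℕ => α * S.risk A δ k + S.risk A δ i * S.risk A δ k :=
      ((measurable_risk k).const_mul _).add ((measurable_risk i).mul (measurable_risk k))
    calc _ = ∫⁻ δ, S.delayRec A r (Function.update δ p d) i *
          (α * S.risk A (Function.update δ p d) k +
            S.risk A (Function.update δ p d) i * S.risk A (Function.update δ p d) k) +
          S.risk A (Function.update δ p d) i * S.risk A (Function.update δ p d) k
          ∂(Measure.infinitePi fun _ : P => S.delayLaw) := by
          refine lintegral_congr fun δ => ?_
          ring
      _ ≤ 1 * (1 * S.riskBound + 4 * S.riskBound) + 4 * S.riskBound := by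
          rw [lintegral_add_right _ hmik, lintegral_delayRec_mul p d hir hG fun x y h => by
              rw [risk_congr_of_le le_rfl x y h, risk_congr_of_le hik.le x y h],
            lintegral_add_right _ hmik, lintegral_const_mul _ hmk]
          have h1 := hS.lintegral_risk_le p d hA k
          have h2 := hS.lintegral_risk_mul_le p d hA i k
          have h3 := hS.lintegral_delayRec_le p d hA r i
          gcongr
      _ = 9 * S.riskBound := by ring

/-- The expected work of the failed packets in a frame with a failure, as bounded in terms of the
delays. -/
theorem Valid.lintegral_failBound_mul_le (k : ℕ) :
    ∫⁻ δ, S.failBound A (Function.update δ p d) k * (6 + ENNReal.ofReal (1 / S.tilt) *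
      ∑ r ∈ Finset.range S.span, S.delayRec A r (Function.update δ p d) k +
        N.D * S.virtualCount A (Function.update δ p d) k)
      ∂(Measure.infinitePi fun _ : P => S.delayLaw) ≤
      ENNReal.ofReal (1 / S.tilt) * (16 * S.span * S.riskBound) := by
  have hθ := hS.tilt_pos
  have hm := hS.one_le_m
  have hsize := hS.le_size
  set c := ENNReal.ofReal (1 / S.tilt) with hc
  have hc1 : 1 ≤ c := by
    rw [hc, ENNReal.one_le_ofReal, le_div_iff₀ hθ, one_mul]
    unfold tilt
    rw [div_le_one (by positivity)]
    nlinarith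
  have hspan : (1 : ℝ≥0∞) ≤ S.span := by exact_mod_cast hS.span_pos
  have hmk : Measurable fun δ : P → ℕ => S.risk A (Function.update δ p d) k :=
    (measurable_risk k).comp (measurable_update_delay p d)
  have hmr : ∀ r, Measurable fun δ : P → ℕ => S.delayRec A r (Function.update δ p d) k *
      S.risk A (Function.update δ p d) k := fun r =>
    ((measurable_delayRec r k).comp (measurable_update_delay p d)).mul hmk
  -- With c = 1/tilt ≥ 1, the constant 6 and the new work D · `virtualCount` ≤ c · `jump` cost 7c
  -- risks, and each residue class costs 9c, whence 16 · `span`.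
  have hpt : ∀ δ : P → ℕ, S.failBound A δ k * (6 + c *
      ∑ r ∈ Finset.range S.span, S.delayRec A r δ k + N.D * S.virtualCount A δ k) ≤
      (6 + c) * S.risk A δ k + c * ∑ r ∈ Finset.range S.span, S.delayRec A r δ k * S.risk A δ k := by
    intro δ
    have h1 : S.failBound A δ k ≤ S.risk A δ k := le_mul_of_one_le_left' (one_le_jump hS δ k)
    have h2 : (N.D * S.virtualCount A δ k : ℝ≥0∞) ≤ c * S.jump A δ k := by
      rw [hc, jump, ← ENNReal.ofReal_mul (by positivity), ← ENNReal.ofReal_natCast,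
        ← ENNReal.ofReal_natCast, ← ENNReal.ofReal_mul (Nat.cast_nonneg _)]
      refine ENNReal.ofReal_le_ofReal ?_
      rw [one_div, ← div_eq_inv_mul, le_div_iff₀ hθ]
      have := Real.add_one_le_exp (S.tilt * (N.D * S.virtualCount A δ k))
      linarith
    calc _ = S.failBound A δ k * 6 + c * (∑ r ∈ Finset.range S.span, S.delayRec A r δ k *
          S.failBound A δ k) + (N.D * S.virtualCount A δ k) * S.failBound A δ k := by
          rw [← Finset.sum_mul]; ring
      _ ≤ S.risk A δ k * 6 + c * (∑ r ∈ Finset.range S.span, S.delayRec A r δ k *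
          S.risk A δ k) + (c * S.jump A δ k) * S.failBound A δ k := by
          gcongr
      _ = _ := by unfold risk; ring
  refine (lintegral_mono fun δ => hpt _).trans ?_
  rw [lintegral_add_left (hmk.const_mul _), lintegral_const_mul _ hmk,
    lintegral_const_mul _ (Finset.measurable_fun_sum _ fun r _ => hmr r),
    lintegral_finsetSum _ fun r _ => hmr r]
  have h1 := hS.lintegral_risk_le p d hA k
  have h2 := fun r => hS.lintegral_delayRec_mul_risk_le p d hA r k
  calc _ ≤ (6 * c + c) * S.riskBound + c * ∑ r ∈ Finset.range S.span, 9 * S.riskBound := by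
        gcongr
        · exact le_mul_of_one_le_right' hc1
        · exact h2 _
    _ = c * (7 * 1 * S.riskBound + 9 * S.span * S.riskBound) := by
        rw [Finset.sum_const, Finset.card_range, nsmul_eq_mul]; ring
    _ ≤ c * (7 * S.span * S.riskBound + 9 * S.span * S.riskBound) := by gcongr
    _ = _ := by ring

end Expectation

end Protocol
end WirelessScheduling

/-! ### From the failed work to latency and queue length -/

namespace WirelessScheduling

theorem Injection.countable {E P : Type*} (A : Injection E P) : Countable P := by
  rw [← Set.countable_univ_iff]
  refine (Set.countable_iUnion fun t => (A.finite_slot t).countable).mono fun p _ => ?_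
  exact Set.mem_iUnion.2 ⟨A.time p, rfl⟩

namespace Protocol

variable {V E : Type*} [Fintype E] {N : Network V E} {S : Protocol N} {P : Type}
  {A : Injection E P}

section Delays

variable (hS : S.Valid)

include hS

theorem Valid.ae_delay_lt : ∀ᵐ d ∂S.delayLaw, d < S.maxDelay := by
  rw [ae_iff, ← lintegral_indicator_one (MeasurableSet.of_discrete),
    S.lintegral_delayLaw hS.maxDelay_pos]
  refine mul_eq_zero_of_left (Finset.sum_eq_zero fun d hd => ?_) _
  simpa using hd

theorem Valid.ae_delaysBounded (A : Injection E P) :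
    ∀ᵐ δ ∂(Measure.infinitePi fun _ : P => S.delayLaw), S.DelaysBounded δ := by
  have := A.countable
  exact ae_all_iff.2 fun p => (measurePreserving_eval_infinitePi
    (fun _ : P => S.delayLaw) p).quasiMeasurePreserving.ae hS.ae_delay_lt

end Delays

section Pointwise

variable (hS : S.Valid) (tie : (U : Finset P) → U.Nonempty → {p // p ∈ U})
  (hpath : ∀ p, N.IsPath (A.path p)) {ω : S.Sample P} (hδ : S.DelaysBounded ω.1)

include hS hpath

theorem Valid.deliveryTime_le {k : ℕ} {p : P} (h : (S.state A tie ω k p).route = []) :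
    S.deliveryTime A tie p ω ≤ (k * S.T : ℕ) := by
  refine (iInf_le _ k).trans ?_
  rw [if_pos h]
  rcases S.clock_le A tie ω k p hS.mainLength_le hS.phases_le with hc | hc
  · exact_mod_cast hc
  · rw [hc] at h
    exact absurd h (hpath p).1

include hδ

/-- By then the virtual journey is over, so an undelivered packet must have left it. -/
theorem Valid.failed_of_span_le {k : ℕ} {p : P} (hk : S.start A p + S.span ≤ k)
    (h : (S.state A tie ω k p).route ≠ []) : (S.state A tie ω k p).failFrame ≠ ⊤ := by
  intro h1
  refine h ?_
  rw [S.route_of_failFrame_eq_top A tie ω k p hS.T_pos h1, List.drop_eq_nil_iff]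
  have h2 := (hpath p).2.1
  have h3 := hδ p
  unfold span at hk
  omega

theorem Valid.rank_mid_ne_zero {k : ℕ} {p : P} (hk : S.start A p + S.span ≤ k)
    (h : (S.state A tie ω k p).route ≠ []) : S.rank A p k (S.mid A tie ω k) ≠ 0 := by
  have h1 := hS.failed_of_span_le tie hpath hδ hk h
  have hp : p ∈ A.injectedIn 0 (k * S.T) := by
    refine A.mem_injectedIn.2 ⟨Nat.zero_le _, ?_⟩
    rw [← Nat.div_lt_iff_lt_mul hS.T_pos]
    unfold start at hk
    omega
  rw [S.rank_mid_pos A tie ω k p hp, S.mid_of_failFrame_ne_top A tie ω k p h1]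
  exact ⟨h1, h⟩

/-- Up to a deterministic term, the latency is governed by the number of frames which a packet
spends in the buffers of failed packets. -/
theorem Valid.latency_le (p : P) : S.latency A tie p ω ≤ S.T * (S.span + 1 +
    ∑' k, {ω | S.rank A p k (S.mid A tie ω k) ≠ 0}.indicator 1 ω) := by
  classical
  set Z : ℝ≥0∞ := ∑' k, {ω | S.rank A p k (S.mid A tie ω k) ≠ 0}.indicator 1 ω with hZ
  have hT := hS.T_pos
  rcases eq_or_ne Z ⊤ with htop | htop
  · rw [htop, add_top, ENNReal.mul_top (by exact_mod_cast hT.ne')]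
    exact le_top
  set K := S.start A p + S.span with hK
  have hcount : ∀ n : ℕ, (∀ i < n, (S.state A tie ω (K + i) p).route ≠ []) → (n : ℝ≥0∞) ≤ Z := by
    intro n hn
    refine le_trans ?_ (ENNReal.sum_le_tsum ((Finset.range n).image (K + ·)))
    rw [Finset.sum_image fun _ _ _ _ h => Nat.add_left_cancel h]
    have : ∀ i ∈ Finset.range n,
        {ω | S.rank A p (K + i) (S.mid A tie ω (K + i)) ≠ 0}.indicator (1 : S.Sample P → ℝ≥0∞) ω = 1 :=
      fun i hi => Set.indicator_of_mem (s := {ω | S.rank A p (K + i) (S.mid A tie ω (K + i)) ≠ 0})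
        (hS.rank_mid_ne_zero tie hpath hδ (Nat.le_add_right _ _)
          (hn i (Finset.mem_range.1 hi))) 1
    rw [Finset.sum_congr rfl this]
    simp
  obtain ⟨n, hn⟩ := ENNReal.exists_nat_gt htop
  -- Every undelivered frame from `K` on counts in `Z`, so a finite `Z` forces delivery.
  have hex : ∃ i, (S.state A tie ω (K + i) p).route = [] := by
    by_contra! hall
    exact absurd (hcount n fun i _ => hall i) (not_le.2 hn)
  set i := Nat.find hex with hi
  have hiZ : (i : ℝ≥0∞) ≤ Z := hcount i fun j hj => Nat.find_min hex hj
  have h1 := hS.deliveryTime_le tie hpath (Nat.find_spec hex)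
  have h2 : S.start A p * S.T ≤ A.time p + S.T := by
    unfold start
    rw [add_mul, one_mul]
    exact Nat.add_le_add_right (Nat.div_mul_le_self _ _) _
  have h3 : (K + i) * S.T - A.time p ≤ S.T * (S.span + 1 + i) := by
    rw [Nat.sub_le_iff_le_add, hK]
    nlinarith
  calc S.latency A tie p ω ≤ (((S.T * (S.span + 1 + i) : ℕ) : ℕ∞) : ℝ≥0∞) := by
        unfold latency
        refine ENat.toENNReal_le.2 ((tsub_le_tsub_right h1 _).trans ?_)
        exact_mod_cast h3
    _ = S.T * (S.span + 1 + i) := by push_cast; rfl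
    _ ≤ _ := by gcongr

/-- An undelivered packet injected before the last `span` frames has failed, and its non-empty
remaining route contributes at least 1 to the backlog. -/
theorem Valid.queueLength_le (t : ℕ) : S.queueLength A tie t ω ≤
    S.backlog A tie (t / S.T) ω + (A.injectedIn ((t / S.T - S.span) * S.T) (t + 1)).card := by
  classical
  set k := t / S.T with hk
  have hT := hS.T_pos
  set U := (A.injectedIn 0 (k * S.T)).filter fun p =>
    (S.state A tie ω k p).failFrame < ⊤ ∧ (S.state A tie ω k p).route ≠ [] with hU
  have h1 : (A.injectedIn 0 (t + 1)).filter (fun p => (t : ℕ∞) < S.deliveryTime A tie p ω) ⊆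
      U ∪ A.injectedIn ((k - S.span) * S.T) (t + 1) := by
    intro p hp
    rw [Finset.mem_filter, A.mem_injectedIn] at hp
    rw [Finset.mem_union, A.mem_injectedIn, or_iff_not_imp_right]
    intro hlt
    have h2 : A.time p < (k - S.span) * S.T := by
      by_contra h
      exact hlt ⟨not_lt.1 h, hp.1.2⟩
    have h3 : A.time p / S.T < k - S.span := (Nat.div_lt_iff_lt_mul hT).2 h2
    have h4 : (S.state A tie ω k p).route ≠ [] := fun h4 => by
      have h5 := hp.2.trans_le (hS.deliveryTime_le tie hpath h4)
      have h6 : t < k * S.T := by exact_mod_cast h5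
      exact absurd (Nat.div_mul_le_self t S.T) (not_le.2 h6)
    have h5 := hS.failed_of_span_le tie hpath hδ (k := k) (p := p)
      (by unfold start; generalize A.time p / S.T = s at *; omega) h4
    refine Finset.mem_filter.2 ⟨A.mem_injectedIn.2 ⟨Nat.zero_le _, h2.trans_le ?_⟩,
      h5.lt_top, h4⟩
    exact Nat.mul_le_mul_right _ (Nat.sub_le _ _)
  have h2 : U.card ≤ S.backlog A tie k ω := by
    unfold backlog work
    rw [Finset.card_eq_sum_ones, hU, Finset.sum_filter]
    refine Finset.sum_le_sum fun p _ => ?_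
    split_ifs with h3 h4 h4
    · exact List.length_pos_of_ne_nil h3.2
    · exact absurd h3.1 h4
    · exact Nat.zero_le _
    · exact le_rfl
  have h3 := (Finset.card_le_card h1).trans ((Finset.card_union_le _ _).trans
    (Nat.add_le_add_right h2 _))
  unfold queueLength
  exact_mod_cast h3

end Pointwise

/-! ### The expected latency -/

section Latency

variable (hS : S.Valid) (tie : (U : Finset P) → U.Nonempty → {p // p ∈ U})
  (hpath : ∀ p, N.IsPath (A.path p)) (p : P)

theorem measurableSet_rank_mid_ne_zero (k : ℕ) :
    MeasurableSet {ω | S.rank A p k (S.mid A tie ω k) ≠ 0} :=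
  (measurable_rank S A (S.measurable_mid A tie k) p k) (MeasurableSet.of_discrete (s := {0}ᶜ))

include hS

/-- The expected change of the rank of a packet in a frame, given the delays. -/
theorem Valid.lintegral_rank_succ_add_le (δ : P → ℕ) (k : ℕ) :
    ∫⁻ ρ, (S.rank A p (k + 1) (S.state A tie (δ, ρ) (k + 1)) : ℝ≥0∞) ∂S.restLaw +
      ENNReal.ofReal (1 / (4 * N.m)) * ∫⁻ ρ,
        {ω | S.rank A p k (S.mid A tie ω k) ≠ 0}.indicator 1 (δ, ρ) ∂S.restLaw ≤
    ∫⁻ ρ, (S.rank A p k (S.state A tie (δ, ρ) k) : ℝ≥0∞) ∂S.restLaw +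
      ∫⁻ ρ, S.midBacklog A tie k (δ, ρ) *
        {ω | S.FailsAt A tie p k ω}.indicator 1 (δ, ρ) ∂S.restLaw := by
  classical
  have hm1 : Measurable fun ρ =>
      {ω : S.Sample P | S.rank A p k (S.mid A tie ω k) ≠ 0}.indicator (1 : S.Sample P → ℝ≥0∞)
        (δ, ρ) :=
    (measurable_one.indicator (measurableSet_rank_mid_ne_zero tie p k)).comp measurable_prodMk_left
  have hm2 : ∀ k, Measurable fun ρ => (S.rank A p k (S.state A tie (δ, ρ) k) : ℝ≥0∞) := fun k =>
    ((measurable_of_countable fun n : ℕ => (n : ℝ≥0∞)).comp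
      (measurable_rank S A (S.measurable_state A tie k) p k)).comp measurable_prodMk_left
  calc _ ≤ ∫⁻ ρ, (S.rank A p (k + 1) (S.state A tie (δ, ρ) (k + 1)) : ℝ≥0∞) ∂S.restLaw +
        ∫⁻ ρ, {ω | S.rank A p k (S.mid A tie ω k) ≠ 0}.indicator 1 (δ, ρ) *
          {ρ | S.Success A tie k (δ, ρ)}.indicator 1 ρ ∂S.restLaw := by
        gcongr
        refine hS.le_lintegral_mul_success A tie hm1 δ k fun z => ?_
        simp only [Set.indicator, Set.mem_ofPred_eq, S.mid_cleanMix A tie δ k z]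
        congr 1
    _ ≤ ∫⁻ ρ, (S.rank A p k (S.mid A tie (δ, ρ) k) : ℝ≥0∞) ∂S.restLaw := by
        rw [← lintegral_add_left (hm2 (k + 1))]
        refine lintegral_mono fun ρ => ?_
        have h := S.rank_succ_add_le A tie (δ, ρ) k p
        refine le_trans (le_of_eq ?_) (Nat.cast_le.2 h)
        push_cast
        congr 1
        simp only [Set.indicator, Set.mem_ofPred_eq, Pi.one_apply]
        split_ifs <;> simp_all
    _ ≤ _ := by
        rw [← lintegral_add_left (hm2 k)]
        refine lintegral_mono fun ρ => ?_
        have h := S.rank_mid_le A tie (δ, ρ) k p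
        refine (Nat.cast_le.2 h).trans (le_of_eq ?_)
        push_cast
        congr 1
        simp only [Set.indicator, Set.mem_ofPred_eq, Pi.one_apply, midBacklog]
        split_ifs <;> simp

/-- A bound on the conditional expectation of the failed work found by a packet at its failure. -/
noncomputable def failCost (S : Protocol N) (A : Injection E P) (p : P) (δ : P → ℕ) (k : ℕ) :
    ℝ≥0∞ :=
  {d | S.pos A p d k ≠ none}.indicator 1 (δ p) * (S.failBound A δ k *
    (6 + ENNReal.ofReal (1 / S.tilt) * ∑ r ∈ Finset.range S.span, S.delayRec A r δ k +
      N.D * S.virtualCount A δ k))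

include hpath in
theorem Valid.lintegral_midBacklog_mul_failsAt_le {δ : P → ℕ} (hδ : S.DelaysBounded δ) (k : ℕ) :
    ∫⁻ ρ, S.midBacklog A tie k (δ, ρ) *
      {ω | S.FailsAt A tie p k ω}.indicator 1 (δ, ρ) ∂S.restLaw ≤ S.failCost A p δ k := by
  have hfail : ∀ ρ, S.FailsAt A tie p k (δ, ρ) →
      S.pos A p (δ p) k ≠ none ∧ S.Bad A tie k (δ, ρ) := by
    intro ρ h
    have h1 := (S.mid_of_failsAt A tie (δ, ρ) k p h).1
    have h2 := (S.mem_window_of_mem_unfailed A tie (δ, ρ) k p hS.T_pos hpath hδ h1).2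
    have h3 := (S.mem_unfailed A (δ, ρ) k _ p).1 h1
    refine ⟨?_, p, h3.1, h⟩
    change S.pos A p (δ p) k = _ at h2
    rw [h2]
    simpa using h3.2.2.1
  unfold failCost
  by_cases hp : S.pos A p (δ p) k = none
  · refine le_of_eq_of_le ?_ zero_le
    rw [lintegral_eq_zero_of_ae_eq_zero]
    refine Filter.Eventually.of_forall fun ρ => ?_
    have : (δ, ρ) ∉ {ω | S.FailsAt A tie p k ω} := fun h => (hfail ρ h).1 hp
    simp [this]
  · rw [Set.indicator_of_mem (s := {d | S.pos A p d k ≠ none}) hp, Pi.one_apply, one_mul]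
    refine le_trans (lintegral_mono fun ρ => ?_)
      (hS.lintegral_midBacklog_mul_bad_le A tie hpath hδ k)
    gcongr
    by_cases h : S.FailsAt A tie p k (δ, ρ)
    · rw [Set.indicator_of_mem (s := {ω | S.FailsAt A tie p k ω}) h,
        Set.indicator_of_mem (s := {ρ | S.Bad A tie k (δ, ρ)}) (hfail ρ h).2]
      exact le_rfl
    · rw [Set.indicator_of_notMem (s := {ω | S.FailsAt A tie p k ω}) h]
      exact zero_le

omit hS in
theorem sum_indicator_pos_le (hpath : ∀ p, N.IsPath (A.path p)) (d n : ℕ) :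
    ∑ k ∈ Finset.range n, {d | S.pos A p d k ≠ none}.indicator (1 : ℕ → ℝ≥0∞) d ≤ N.D := by
  classical
  have h1 : ∀ k, {d | S.pos A p d k ≠ none}.indicator (1 : ℕ → ℝ≥0∞) d =
      if S.pos A p d k ≠ none then 1 else 0 := fun k => by
    simp only [Set.indicator, Set.mem_ofPred_eq, Pi.one_apply]
  simp only [h1]
  rw [← Finset.sum_filter, Finset.sum_const, nsmul_eq_mul, mul_one]
  have h2 : (Finset.range n).filter (fun k => S.pos A p d k ≠ none) ⊆
      Finset.Ico (S.start A p + d) (S.start A p + d + N.D) := by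
    intro k hk
    have h3 := (Finset.mem_filter.1 hk).2
    unfold pos at h3
    split_ifs at h3 with h4
    · have h5 : k - (S.start A p + d) < (A.path p).length := by
        by_contra h
        exact h3 (List.getElem?_eq_none (not_lt.1 h))
      have h6 := (hpath p).2.1
      rw [Finset.mem_Ico]
      omega
    · exact absurd rfl h3
  have h3 := Finset.card_le_card h2
  rw [Nat.card_Ico, Nat.add_sub_cancel_left] at h3
  exact_mod_cast h3

omit hS in
theorem measurable_failCost (k : ℕ) : Measurable fun δ : P → ℕ => S.failCost A p δ k := by
  have h1 : Measurable fun δ : P → ℕ => (S.virtualCount A δ k : ℝ≥0∞) :=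
    (measurable_of_countable fun n : ℕ => (n : ℝ≥0∞)).comp (measurable_virtualCount k)
  have h2 : Measurable fun δ : P → ℕ =>
      {d | S.pos A p d k ≠ none}.indicator (1 : ℕ → ℝ≥0∞) (δ p) :=
    (measurable_of_countable ({d | S.pos A p d k ≠ none}.indicator (1 : ℕ → ℝ≥0∞))).comp
      (measurable_pi_apply p)
  have h3 : Measurable fun δ : P → ℕ => ∑ r ∈ Finset.range S.span, S.delayRec A r δ k :=
    Finset.measurable_fun_sum _ fun r _ => measurable_delayRec r k
  unfold failCost
  exact h2.mul ((measurable_failBound k).mul (((h3.const_mul _).const_add _).add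
    (h1.const_mul _)))

-- The delay of `p` is integrated out last. For each value of it at most D frames are relevant, and
-- the bound for a single frame holds uniformly in this value.
include hpath in
theorem Valid.sum_lintegral_failCost_le (hA : A.IsBounded N S.w S.rate) (n : ℕ) :
    ∑ k ∈ Finset.range n, ∫⁻ δ, S.failCost A p δ k
      ∂(Measure.infinitePi fun _ : P => S.delayLaw) ≤
      N.D * (ENNReal.ofReal (1 / S.tilt) * (16 * S.span * S.riskBound)) := by
  classical
  set X := ENNReal.ofReal (1 / S.tilt) * (16 * S.span * S.riskBound) with hX
  have h1 : ∀ k, ∫⁻ δ, S.failCost A p δ k ∂(Measure.infinitePi fun _ : P => S.delayLaw) ≤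
      ∫⁻ d, {d | S.pos A p d k ≠ none}.indicator 1 d * X ∂S.delayLaw := by
    intro k
    rw [lintegral_infinitePi_update (fun _ : P => S.delayLaw) p (measurable_failCost p k)]
    refine lintegral_mono fun d => ?_
    unfold failCost
    simp only [Function.update_self]
    rw [lintegral_const_mul']
    · gcongr
      exact hS.lintegral_failBound_mul_le p d hA k
    · exact ((Set.indicator_le_self' (fun _ _ => zero_le) d).trans_lt ENNReal.one_lt_top).ne
  refine (Finset.sum_le_sum fun k _ => h1 k).trans ?_
  rw [← lintegral_finsetSum _ fun k _ => measurable_of_countable _]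
  calc _ ≤ ∫⁻ d, N.D * X ∂S.delayLaw := by
        refine lintegral_mono fun d => ?_
        rw [← Finset.sum_mul]
        gcongr
        exact sum_indicator_pos_le p hpath d n
    _ = N.D * X := by rw [lintegral_const, measure_univ, mul_one]

/-- With n = mJ the claim is 640 m³ ≤ n³, after inserting 1/tilt = 2mn and D ≤ m; it follows from n
≥ 400m. The factor 1/(4m) is the rate at which the rank decreases. -/
theorem Valid.mul_riskBound_le :
    N.D * (ENNReal.ofReal (1 / S.tilt) * (16 * S.span * S.riskBound)) ≤
      ENNReal.ofReal (1 / (4 * N.m)) * S.span := by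
  have hm := hS.one_le_m
  have hsize := hS.le_size
  have hθ := hS.tilt_pos
  have hD : (N.D : ℝ) ≤ N.m := by exact_mod_cast le_max_right _ _
  have h1 : (N.D : ℝ) * (1 / S.tilt) * 16 * (5 / S.size ^ 4) ≤ 1 / (4 * N.m) := by
    have h2 : (1 : ℝ) / S.tilt = 2 * N.m * S.size := by
      unfold tilt
      field_simp
    have h3 : N.m * 400 ≤ S.size := by
      unfold size
      have := hS.le_J
      gcongr
    have h4 : (N.m * 400 : ℝ) ^ 3 ≤ S.size ^ 3 := by gcongr
    rw [h2, mul_div_assoc', div_le_div_iff₀ (by positivity) (by positivity)]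
    calc (N.D : ℝ) * (2 * N.m * S.size) * 16 * 5 * (4 * N.m)
        ≤ N.m * (2 * N.m * S.size) * 16 * 5 * (4 * N.m) := by gcongr
      _ = (640 * N.m ^ 3) * S.size := by ring
      _ ≤ S.size ^ 3 * S.size := by
          gcongr
          have : (0 : ℝ) ≤ N.m ^ 3 := by positivity
          nlinarith
      _ = 1 * S.size ^ 4 := by ring
  calc _ = (N.D * ENNReal.ofReal (1 / S.tilt) * 16 * S.riskBound) * S.span := by ring
    _ ≤ _ := by
      gcongr
      unfold riskBound
      rw [← ENNReal.ofReal_natCast, ← ENNReal.ofReal_mul (by positivity),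
        ← ENNReal.ofReal_ofNat 16, ← ENNReal.ofReal_mul (by positivity),
        ← ENNReal.ofReal_mul (by positivity)]
      exact ENNReal.ofReal_le_ofReal h1

include hpath in
/-- The expected number of frames that a packet spends in the buffers of failed packets. -/
theorem Valid.tsum_lintegral_rank_mid_ne_zero_le (hA : A.IsBounded N S.w S.rate) :
    ∑' k, ∫⁻ ω, {ω | S.rank A p k (S.mid A tie ω k) ≠ 0}.indicator 1 ω ∂(S.prob P) ≤ S.span := by
  set q := ENNReal.ofReal (1 / (4 * N.m)) with hq
  have hm := hS.one_le_m
  have hq0 : q ≠ 0 := by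
    rw [hq, Ne, ENNReal.ofReal_eq_zero, not_le]
    positivity
  have hq1 : q ≠ ⊤ := ENNReal.ofReal_ne_top
  have hI : ∀ k, Measurable ({ω | S.rank A p k (S.mid A tie ω k) ≠ 0}.indicator
      (1 : S.Sample P → ℝ≥0∞)) := fun k =>
    measurable_one.indicator (measurableSet_rank_mid_ne_zero tie p k)
  refine ENNReal.tsum_le_of_sum_range_le fun n => ?_
  rw [← ENNReal.mul_le_mul_iff_right hq0 hq1]
  refine le_trans ?_ (hS.mul_riskBound_le)
  refine le_trans ?_ (hS.sum_lintegral_failCost_le hpath p hA n)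
  have hprod : ∀ k, ∫⁻ ω, {ω | S.rank A p k (S.mid A tie ω k) ≠ 0}.indicator 1 ω ∂(S.prob P) =
      ∫⁻ δ, ∫⁻ ρ, {ω | S.rank A p k (S.mid A tie ω k) ≠ 0}.indicator 1 (δ, ρ) ∂S.restLaw
        ∂(Measure.infinitePi fun _ : P => S.delayLaw) := fun k => by
    rw [S.prob_eq, lintegral_prod _ (hI k).aemeasurable]
  simp only [hprod]
  rw [← lintegral_finsetSum _ fun k _ => (hI k).lintegral_prod_right',
    ← lintegral_finsetSum _ fun k _ => measurable_failCost p k,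
    ← lintegral_const_mul _ (Finset.measurable_fun_sum _ fun k _ => (hI k).lintegral_prod_right')]
  refine lintegral_mono_ae ?_
  filter_upwards [hS.ae_delaysBounded A] with δ hδ
  -- The drift inequality for the rank is summed over the frames. Keeping the current mean rank on
  -- the left makes the induction work; it starts at 0.
  suffices h : ∫⁻ ρ, (S.rank A p n (S.state A tie (δ, ρ) n) : ℝ≥0∞) ∂S.restLaw +
      q * ∑ k ∈ Finset.range n, ∫⁻ ρ,
        {ω | S.rank A p k (S.mid A tie ω k) ≠ 0}.indicator 1 (δ, ρ) ∂S.restLaw ≤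
      ∑ k ∈ Finset.range n, S.failCost A p δ k from le_add_self.trans h
  induction n with
  | zero => simp [rank, state]
  | succ n ih =>
    rw [Finset.sum_range_succ, Finset.sum_range_succ, mul_add]
    calc _ = (∫⁻ ρ, (S.rank A p (n + 1) (S.state A tie (δ, ρ) (n + 1)) : ℝ≥0∞) ∂S.restLaw +
          q * ∫⁻ ρ, {ω | S.rank A p n (S.mid A tie ω n) ≠ 0}.indicator 1 (δ, ρ) ∂S.restLaw) +
          q * ∑ k ∈ Finset.range n, ∫⁻ ρ,
            {ω | S.rank A p k (S.mid A tie ω k) ≠ 0}.indicator 1 (δ, ρ) ∂S.restLaw := by ring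
      _ ≤ (∫⁻ ρ, (S.rank A p n (S.state A tie (δ, ρ) n) : ℝ≥0∞) ∂S.restLaw +
          S.failCost A p δ n) + q * ∑ k ∈ Finset.range n, ∫⁻ ρ,
            {ω | S.rank A p k (S.mid A tie ω k) ≠ 0}.indicator 1 (δ, ρ) ∂S.restLaw := by
          refine add_le_add ((hS.lintegral_rank_succ_add_le tie p δ n).trans ?_) le_rfl
          gcongr
          exact hS.lintegral_midBacklog_mul_failsAt_le tie hpath p hδ n
      _ = (∫⁻ ρ, (S.rank A p n (S.state A tie (δ, ρ) n) : ℝ≥0∞) ∂S.restLaw +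
          q * ∑ k ∈ Finset.range n, ∫⁻ ρ,
            {ω | S.rank A p k (S.mid A tie ω k) ≠ 0}.indicator 1 (δ, ρ) ∂S.restLaw) +
          S.failCost A p δ n := by ring
      _ ≤ _ := by gcongr

theorem Valid.ae_prob_delaysBounded (A : Injection E P) :
    ∀ᵐ ω ∂(S.prob P), S.DelaysBounded ω.1 := by
  rw [S.prob_eq]
  exact Measure.quasiMeasurePreserving_fst.ae (hS.ae_delaysBounded A)

include hpath in
theorem Valid.lintegral_latency_le (hA : A.IsBounded N S.w S.rate) :
    ∫⁻ ω, S.latency A tie p ω ∂(S.prob P) ≤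
      ENNReal.ofReal (14 * (N.D * S.w * S.T / S.ε)) := by
  have hI : ∀ k, Measurable ({ω | S.rank A p k (S.mid A tie ω k) ≠ 0}.indicator
      (1 : S.Sample P → ℝ≥0∞)) := fun k =>
    measurable_one.indicator (measurableSet_rank_mid_ne_zero tie p k)
  have hsum : Measurable fun ω : S.Sample P => (S.span + 1 : ℝ≥0∞) +
      ∑' k, {ω | S.rank A p k (S.mid A tie ω k) ≠ 0}.indicator 1 ω :=
    (Measurable.tsum hI).const_add _
  have hprob : IsProbabilityMeasure (S.prob P) := by
    rw [S.prob_eq]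
    infer_instance
  calc _ ≤ ∫⁻ ω, S.T * (S.span + 1 +
        ∑' k, {ω | S.rank A p k (S.mid A tie ω k) ≠ 0}.indicator 1 ω) ∂(S.prob P) := by
        refine lintegral_mono_ae ?_
        filter_upwards [hS.ae_prob_delaysBounded A] with ω hω
        exact hS.latency_le tie hpath hω p
    _ = S.T * (S.span + 1 + ∑' k, ∫⁻ ω,
        {ω | S.rank A p k (S.mid A tie ω k) ≠ 0}.indicator 1 ω ∂(S.prob P)) := by
        rw [lintegral_const_mul _ hsum,
          lintegral_add_left measurable_const, lintegral_const, measure_univ, mul_one,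
          lintegral_tsum fun k => (hI k).aemeasurable]
    _ ≤ S.T * (S.span + 1 + S.span) := by
        gcongr
        exact hS.tsum_lintegral_rank_mid_ne_zero_le tie hpath p hA
    _ = ENNReal.ofReal (S.T * (S.span + 1 + S.span)) := by
        rw [ENNReal.ofReal_mul (by positivity), ENNReal.ofReal_add (by positivity) (by positivity),
          ENNReal.ofReal_add (by positivity) (by positivity)]
        simp
    _ ≤ _ := by
        refine ENNReal.ofReal_le_ofReal ?_
        -- The constant 14 is twice the 7 of `Valid.span_le`: at most `span + 1` frames without
        -- failure and on average `span` frames in the buffers.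
        have h := hS.span_le
        calc (S.T : ℝ) * (S.span + 1 + S.span) ≤ S.T * (14 * (N.D * S.w / S.ε)) := by
              gcongr
              linarith
          _ = _ := by ring

end Latency

/-! ### The expected queue length -/

section Queue

variable (hS : S.Valid) (tie : (U : Finset P) → U.Nonempty → {p // p ∈ U})
  (hpath : ∀ p, N.IsPath (A.path p))

/-- A bound on the expected queue length. -/
noncomputable def queueBound (S : Protocol N) : ℝ≥0 :=
  6 + (1 / S.tilt).toNNReal * S.span +
    (Fintype.card E * (((S.span + 1) * S.T + S.w) * S.rate)).toNNReal

include hS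

theorem Valid.rate_nonneg : 0 ≤ S.rate :=
  div_nonneg (by linarith [hS.ε_lt]) hS.f_pos.le

include hpath

theorem Valid.card_injectedIn_le (hA : A.IsBounded N S.w S.rate) {a b : ℕ} (hab : a ≤ b) :
    ((A.injectedIn a b).card : ℝ) ≤ Fintype.card E * (((b - a : ℝ) + S.w) * S.rate) := by
  classical
  have h1 : (A.injectedIn a b).card ≤ ∑ e, A.load a b e := by
    unfold Injection.load
    rw [Finset.sum_comm, Finset.card_eq_sum_ones]
    refine Finset.sum_le_sum fun p _ => ?_
    obtain ⟨e, he⟩ := List.exists_mem_of_ne_nil _ (hpath p).1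
    refine le_trans ?_ (Finset.single_le_sum (f := fun e => (A.path p).count e)
      (fun _ _ => Nat.zero_le _) (Finset.mem_univ e))
    exact List.count_pos_iff.2 he
  calc ((A.injectedIn a b).card : ℝ) ≤ ∑ e, (A.load a b e : ℝ) := by exact_mod_cast h1
    _ ≤ ∑ _ : E, ((b - a : ℝ) + S.w) * S.rate :=
        Finset.sum_le_sum fun e _ => (N.le_sum_W_mul _ e).trans
          (hA.sum_load_le hS.w_pos hS.rate_nonneg e hab)
    _ = _ := by simp

theorem Valid.lintegral_prob_backlog_le [Nonempty P] (hA : A.IsBounded N S.w S.rate) (k : ℕ) :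
    ∫⁻ ω, S.backlog A tie k ω ∂(S.prob P) ≤ 6 + ENNReal.ofReal (1 / S.tilt) * S.span := by
  classical
  obtain ⟨p⟩ := ‹Nonempty P›
  have hm : ∀ r, Measurable fun δ : P → ℕ => S.delayRec A r δ k := fun r => measurable_delayRec r k
  have hm' : Measurable fun δ : P → ℕ => 6 + ENNReal.ofReal (1 / S.tilt) *
      ∑ r ∈ Finset.range S.span, S.delayRec A r δ k :=
    ((Finset.measurable_fun_sum _ fun r _ => hm r).const_mul _).const_add _
  have hmd : ∀ d r, Measurable fun δ : P → ℕ => S.delayRec A r (Function.update δ p d) k :=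
    fun d r => (hm r).comp (measurable_update_delay p d)
  have hmb : Measurable fun ω => (S.backlog A tie k ω : ℝ≥0∞) :=
    (measurable_of_countable fun n : ℕ => (n : ℝ≥0∞)).comp (measurable_backlog A tie k)
  rw [S.prob_eq, lintegral_prod _ hmb.aemeasurable]
  calc _ ≤ ∫⁻ δ, 6 + ENNReal.ofReal (1 / S.tilt) *
        ∑ r ∈ Finset.range S.span, S.delayRec A r δ k
        ∂(Measure.infinitePi fun _ : P => S.delayLaw) := by
        refine lintegral_mono_ae ?_
        filter_upwards [hS.ae_delaysBounded A] with δ hδ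
        exact hS.lintegral_backlog_le A tie hpath hδ k
    _ ≤ ∫⁻ d, 6 + ENNReal.ofReal (1 / S.tilt) * S.span ∂S.delayLaw := by
        -- The moment bounds are available with one delay fixed, so an arbitrary packet is singled
        -- out and its delay averaged afterwards.
        rw [lintegral_infinitePi_update (fun _ : P => S.delayLaw) p hm']
        refine lintegral_mono fun d => ?_
        rw [lintegral_add_left measurable_const, lintegral_const, measure_univ, mul_one,
          lintegral_const_mul _ (Finset.measurable_fun_sum _ fun r _ => hmd d r),
          lintegral_finsetSum _ fun r _ => hmd d r]
        gcongr
        refine (Finset.sum_le_sum fun r _ => hS.lintegral_delayRec_le p d hA r k).trans ?_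
        simp
    _ = _ := by rw [lintegral_const, measure_univ, mul_one]

theorem Valid.lintegral_queueLength_le (hA : A.IsBounded N S.w S.rate) (t : ℕ) :
    ∫⁻ ω, S.queueLength A tie t ω ∂(S.prob P) ≤ S.queueBound := by
  rcases isEmpty_or_nonempty P with hP | hP
  · simp [S.queueLength_eq_sum A tie t, Finset.eq_empty_of_isEmpty]
  have hprob : IsProbabilityMeasure (S.prob P) := by
    rw [S.prob_eq]
    infer_instance
  set k := t / S.T with hk
  set a := (k - S.span) * S.T with ha
  have h1 : ((A.injectedIn a (t + 1)).card : ℝ) ≤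
      Fintype.card E * (((S.span + 1) * S.T + S.w) * S.rate) := by
    have hkT : k * S.T ≤ t := Nat.div_mul_le_self _ _
    have htk : t + 1 ≤ (k + 1) * S.T := (Nat.div_lt_iff_lt_mul hS.T_pos).1 (Nat.lt_succ_self k)
    have hat : a ≤ t + 1 := (Nat.mul_le_mul_right _ (Nat.sub_le _ _)).trans (by omega)
    refine (hS.card_injectedIn_le hpath hA hat).trans ?_
    have hr := hS.rate_nonneg
    gcongr
    have h2 : k + 1 ≤ (k - S.span) + (S.span + 1) := by omega
    have h3 : t + 1 ≤ a + (S.span + 1) * S.T := by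
      rw [ha, ← add_mul]
      exact htk.trans (Nat.mul_le_mul_right _ h2)
    have h4 : ((t + 1 : ℕ) : ℝ) ≤ a + (S.span + 1) * S.T := by exact_mod_cast h3
    linarith
  calc _ ≤ ∫⁻ ω, (S.backlog A tie k ω : ℝ≥0∞) + ((A.injectedIn a (t + 1)).card : ℝ≥0∞)
        ∂(S.prob P) := by
        refine lintegral_mono_ae ?_
        filter_upwards [hS.ae_prob_delaysBounded A] with ω hω
        exact hS.queueLength_le tie hpath hω t
    _ = ∫⁻ ω, (S.backlog A tie k ω : ℝ≥0∞) ∂(S.prob P) +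
        ((A.injectedIn a (t + 1)).card : ℝ≥0∞) := by
        rw [lintegral_add_right _ measurable_const, lintegral_const, measure_univ, mul_one]
    _ ≤ 6 + ENNReal.ofReal (1 / S.tilt) * S.span +
        ENNReal.ofReal (Fintype.card E * (((S.span + 1) * S.T + S.w) * S.rate)) := by
        refine add_le_add (hS.lintegral_prob_backlog_le tie hpath hA k) ?_
        rw [← ENNReal.ofReal_natCast]
        exact ENNReal.ofReal_le_ofReal h1
    _ = _ := by
        unfold queueBound ENNReal.ofReal
        push_cast
        rfl

end Queue

end Protocol
end WirelessScheduling

/-! ### The theorem -/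

open WirelessScheduling
theorem mainTheorem4 :
    ∃ C : ℝ, 0 < C ∧
      ∀ (V E : Type*) [Fintype E] (N : Network V E) (S : Protocol N),
        0 < S.f N.m →
        MonotoneOn (S.g N.m) (Set.Ici 1) →
        Asymptotics.IsLittleO Filter.atTop (S.g N.m) (fun n : ℝ => n) →
        S.alg.HasScheduleLength S.f S.g →
        0 < S.ε → S.ε < 1 → 0 < S.w →
        S.FrameLongEnough →
        ∃ B : ℝ≥0, ∀ (P : Type) (A : Injection E P)
          (tie : (U : Finset P) → U.Nonempty → {p // p ∈ U}),
          (∀ p, N.IsPath (A.path p)) →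
          A.IsBounded N S.w S.rate →
          (∀ t, Measurable (S.queueLength A tie t) ∧
            ∫⁻ ω, S.queueLength A tie t ω ∂(S.prob P) ≤ B) ∧
          (∀ p, Measurable (S.latency A tie p) ∧
            ∫⁻ ω, S.latency A tie p ω ∂(S.prob P) ≤
              ENNReal.ofReal (C * (N.D * S.w * S.T / S.ε))) := by
  refine ⟨14, by norm_num, ?_⟩
  intro V E _ N S hf hg ho hsched hε hε1 hw hlong
  by_cases h : Nonempty E ∧ 0 < N.D
  · have hS : S.Valid := ⟨h.1, h.2, hf, hg, ho, hsched, hε, hε1, hw, hlong⟩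
    exact ⟨S.queueBound, fun P A tie hpath hA =>
      ⟨fun t => ⟨S.measurable_queueLength A tie t, hS.lintegral_queueLength_le tie hpath hA t⟩,
        fun p => ⟨S.measurable_latency A tie p, hS.lintegral_latency_le tie hpath p hA⟩⟩⟩
  -- Without links, or with D = 0, there are no paths and hence no packets.
  · refine ⟨0, fun P A tie hpath _ => ?_⟩
    have hP : IsEmpty P := by
      refine ⟨fun p => h ?_⟩
      obtain ⟨h1, h2, -⟩ := hpath p
      exact ⟨⟨(A.path p).head h1⟩, (List.length_pos_of_ne_nil h1).trans_le h2⟩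
    refine ⟨fun t => ⟨S.measurable_queueLength A tie t, ?_⟩, fun p => isEmptyElim p⟩
    simp [S.queueLength_eq_sum A tie t, Finset.eq_empty_of_isEmpty]
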